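/- Let $A:\mathbb R^2\to\mathbb C$ be continuous with $\limsup_{p\to\infty}|A(p)|/|p|^2<1$. Put $\lambda_-(p)=|p|^2-|A(p)|$, $\kappa=\inf_{p}\lambda_-(p)$ and $S=\{p\in\mathbb R^2:\lambda_-(p)=\kappa\}$, and assume that $|A|$ is of class $C^2$ in a neighbourhood of $S$. In $\mathcal H=L^2(\mathbb R^2)\otimes\mathbb C^2$ let $H_0$ be the operator which the Fourier transform turns into multiplication by the matrix $\widehat H_0(p)=\begin{pmatrix}|p|^2&A(p)\\ \overline{A(p)}&|p|^2\end{pmatrix}$, and let $q_0$ be its quadratic form, with domain $H^1(\mathbb R^2)\otimes\mathbb C^2$. Let $m$ be a finite positive Radon measure on $\mathbb R^2$ and $h:\mathbb R^2\to\mathbb R$ a bounded Borel function, and assume that for some $a\in(0,1)$ and $b>0$ $$\int_{\mathbb R^2}(1+|h|^2)|f|^2\,dm\le a\int_{\mathbb R^2}|\nabla f|^2\,dx+b\int_{\mathbb R^2}|f|^2\,dx\qquad\text{for all } f\in\mathcal S(\mathbb R^2).$$ Let $J_2:H^1(\mathbb R^2)\otimes\mathbb C^2\to L^2(\mathbb R^2,m)\otimes\mathbb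 C^2$ be the continuous extension of the map $f\mapsto f$ on Schwartz spinors, put $\nu=hm$, $\nu(f,g)=\int\langle J_2f,J_2g\rangle_{\mathbb C^2}\,h\,dm$ and $q=q_0+\nu$ on $H^1(\mathbb R^2)\otimes\mathbb C^2$. Assume that the perturbation is form-bounded relative to $H_0$ with relative bound less than one: there are $a'<1$ and $b'\in\mathbb R$ with $|\nu(f,f)|\le a'\,q_0(f,f)+b'\|f\|^2$ for all $f\in H^1(\mathbb R^2)\otimes\mathbb C^2$. Then $q$ is closed and semibounded below; let $H=H_0+\nu$ be the operator associated with $q$. If $\nu\le0$ and the intersection of $\operatorname{supp}\nu$ with some circle is an infinite set, then $H$ has at least $\#S$ eigenvalues below $\kappa$: counted with multiplicity, their number is at least the number of points of $S$ if $S$ is finite; if $S$ is infinite, $H$ has infinitely many distinct eigenvalues below $\kappa$. In particular, the same conclusion holds if $m\neq0$ is spherically symmetric (invariant under all linear isometries of $\mathbb R^2$) and $h<0$ $m$-almost everywhere. -/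

import Mathlib

open MeasureTheory Filter SchwartzMap FourierTransform
open scoped ENNReal

noncomputable section

namespace SpinOrbit

/-- The Euclidean plane. -/
abbrev Plane : Type := EuclideanSpace ℝ (Fin 2)

/-- The Hermitian space of spinor values. -/
abbrev C2 : Type := EuclideanSpace ℂ (Fin 2)

/-- The Hilbert space of square-integrable two-dimensional spinors on the plane. -/
abbrev Spinors : Type := Lp C2 2 (volume : Measure Plane)

/-! ### The symbol of the unperturbed operator -/

/-- The symbol of the unperturbed Hamiltonian at the momentum `p`, as a matrix. -/
def symbol (A : Plane → ℂ) (p : Plane) : Matrix (Fin 2) (Fin 2) ℂ :=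
  !![((‖p‖ ^ 2 : ℝ) : ℂ), A p; (starRingEnd ℂ) (A p), ((‖p‖ ^ 2 : ℝ) : ℂ)]

/-- The lower dispersion law. -/
def lowerBand (A : Plane → ℂ) (p : Plane) : ℝ := ‖p‖ ^ 2 - ‖A p‖

/-- The bottom of the spectrum of the unperturbed Hamiltonian. -/
def threshold (A : Plane → ℂ) : ℝ := ⨅ p : Plane, lowerBand A p

/-- The set where the lower dispersion law attains its infimum. -/
def minimumSet (A : Plane → ℂ) : Set Plane := {p | lowerBand A p = threshold A}

/-- The standing assumptions on the symbol `A`, the measure `m` and the density `h`. -/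
structure System where
  /-- the off-diagonal entry of the symbol -/
  A : Plane → ℂ
  /-- the underlying measure; a finite Borel measure on the plane is a Radon measure -/
  m : Measure Plane
  /-- the density of the perturbation with respect to `m` -/
  h : Plane → ℝ
  continuous_A : Continuous A
  limsup_A : limsup (fun p : Plane => ENNReal.ofReal (‖A p‖ / ‖p‖ ^ 2)) (cocompact Plane) < 1
  contDiff_norm_A : ∃ U : Set Plane, IsOpen U ∧ minimumSet A ⊆ U ∧
    ContDiffOn ℝ 2 (fun p => ‖A p‖) U
  finite_m : IsFiniteMeasure m
  measurable_h : Measurable h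
  bounded_h : ∃ C : ℝ, ∀ x, |h x| ≤ C
  formBound : ∃ a : ℝ, 0 < a ∧ a < 1 ∧ ∃ b : ℝ, 0 < b ∧ ∀ f : 𝓢(Plane, ℂ),
    ∫ x, (1 + |h x| ^ 2) * ‖f x‖ ^ 2 ∂m ≤
      a * (∫ x, ∑ i : Fin 2, ‖fderiv ℝ f x (EuclideanSpace.single i 1)‖ ^ 2) +
      b * ∫ x, ‖f x‖ ^ 2

/-! ### The Sobolev space of spinors and the trace operator -/

/-- The Sobolev space of order one of spinors, as the space of the pairs `(f, v)` of
square-integrable spinors with `v(ξ) = |2πξ| (𝓕 f)(ξ)`. Here `𝓕` is the unitary Fourier transform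
with the kernel `exp (-2πi⟨x, ξ⟩)`, so that the momentum is `p = 2πξ`, and `‖v‖` is the
`L²`-norm of the gradient of `f`. The norm is `max ‖f‖ ‖v‖`, a norm of the usual topology. -/
def H1 : Submodule ℂ (Spinors × Spinors) where
  carrier := {z | (z.2 : Plane → C2) =ᵐ[volume]
    fun ξ => ((2 * Real.pi * ‖ξ‖ : ℝ) : ℂ) • (𝓕 z.1 : Spinors) ξ}
  zero_mem' := by
    have h0 : (𝓕 (0 : Spinors) : Spinors) = 0 := (Lp.fourierTransformₗᵢ Plane C2).map_zero
    simp only [Set.mem_ofPred_eq, Prod.fst_zero, Prod.snd_zero, h0]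
    filter_upwards [Lp.coeFn_zero C2 2 (volume : Measure Plane)] with ξ hξ
    exact hξ.trans (by rw [hξ]; exact (smul_zero _).symm)
  add_mem' := by
    intro z w hz hw
    simp only [Set.mem_ofPred_eq, Prod.fst_add, Prod.snd_add] at hz hw ⊢
    have h1 : (𝓕 (z.1 + w.1) : Spinors) = 𝓕 z.1 + 𝓕 w.1 :=
      (Lp.fourierTransformₗᵢ Plane C2).map_add z.1 w.1
    rw [h1]
    filter_upwards [hz, hw, Lp.coeFn_add z.2 w.2,
      Lp.coeFn_add (𝓕 z.1 : Spinors) (𝓕 w.1)] with ξ a b c d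
    rw [c, d, Pi.add_apply, Pi.add_apply, a, b, smul_add]
  smul_mem' := by
    intro k z hz
    simp only [Set.mem_ofPred_eq, Prod.smul_fst, Prod.smul_snd] at hz ⊢
    have h1 : (𝓕 (k • z.1) : Spinors) = k • 𝓕 z.1 :=
      (Lp.fourierTransformₗᵢ Plane C2).map_smul k z.1
    rw [h1]
    filter_upwards [hz, Lp.coeFn_smul k z.2, Lp.coeFn_smul k (𝓕 z.1 : Spinors)] with ξ a b c
    rw [b, c, Pi.smul_apply, Pi.smul_apply, a, smul_comm]

/-- The Fourier transform of an element of the Sobolev space, in the variable `ξ = p / 2π`. -/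
def hat (F : H1) : Spinors := 𝓕 F.1.1

theorem hat_add (F G : H1) : hat (F + G) = hat F + hat G :=
  (Lp.fourierTransformₗᵢ Plane C2).map_add F.1.1 G.1.1

theorem hat_smul (k : ℂ) (F : H1) : hat (k • F) = k • hat F :=
  (Lp.fourierTransformₗᵢ Plane C2).map_smul k F.1.1

theorem memLp_norm_smul (φ : 𝓢(Plane, C2)) :
    MemLp (fun ξ : Plane => ((2 * Real.pi * ‖ξ‖ : ℝ) : ℂ) • φ ξ) 2 volume := by
  have hg : Function.HasTemperateGrowth (fun ξ : Plane => 2 * Real.pi * (1 + ‖ξ‖ ^ 2)) := by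
    fun_prop
  refine ((smulLeftCLM C2 (fun ξ : Plane => 2 * Real.pi * (1 + ‖ξ‖ ^ 2)) φ).memLp 2
    volume).mono ?_ ?_
  · exact (by fun_prop : Continuous fun ξ : Plane =>
      ((2 * Real.pi * ‖ξ‖ : ℝ) : ℂ) • φ ξ).aestronglyMeasurable
  · refine Eventually.of_forall fun ξ => ?_
    rw [smulLeftCLM_apply_apply hg, norm_smul, norm_smul, Complex.norm_real]
    refine mul_le_mul_of_nonneg_right ?_ (norm_nonneg _)
    rw [Real.norm_of_nonneg (by positivity), Real.norm_of_nonneg (by positivity)]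
    have : ‖ξ‖ ≤ 1 + ‖ξ‖ ^ 2 := by nlinarith [sq_nonneg (‖ξ‖ - 1), norm_nonneg ξ]
    gcongr

/-- Schwartz spinors as elements of the Sobolev space. -/
def schwartzToH1 : 𝓢(Plane, C2) →ₗ[ℂ] H1 where
  toFun φ := ⟨(φ.toLp 2 volume, (memLp_norm_smul (𝓕 φ)).toLp), by
    change (_ : Plane → C2) =ᵐ[volume] _
    rw [SchwartzMap.toLp_fourier_eq]
    filter_upwards [(memLp_norm_smul (𝓕 φ)).coeFn_toLp, (𝓕 φ).coeFn_toLp 2 volume] with ξ a b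
    rw [a, b]⟩
  map_add' φ ψ := by
    refine Subtype.ext (Prod.ext rfl ?_)
    refine (MemLp.toLp_congr (memLp_norm_smul (𝓕 (φ + ψ)))
      ((memLp_norm_smul (𝓕 φ)).add (memLp_norm_smul (𝓕 ψ))) ?_).trans
      (MemLp.toLp_add (memLp_norm_smul (𝓕 φ)) (memLp_norm_smul (𝓕 ψ)))
    refine Eventually.of_forall fun ξ => ?_
    simp [FourierTransform.fourier_add, smul_add]
  map_smul' k φ := by
    refine Subtype.ext (Prod.ext rfl ?_)
    refine (MemLp.toLp_congr (memLp_norm_smul (𝓕 (k • φ)))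
      ((memLp_norm_smul (𝓕 φ)).const_smul k) ?_).trans
      (MemLp.toLp_const_smul k (memLp_norm_smul (𝓕 φ)))
    refine Eventually.of_forall fun ξ => ?_
    simp only [FourierTransform.fourier_smul, smul_apply, Pi.smul_apply]
    rw [smul_comm]

namespace System

variable (D : System)

instance instFinite : IsFiniteMeasure D.m := D.finite_m

/-- The threshold of the system. -/
abbrev kappa : ℝ := threshold D.A

/-- The trace operator from the Sobolev space to the square-integrable spinors with respect to
`m`: the continuous extension of the restriction map on Schwartz spinors. -/
def trace : H1 →L[ℂ] Lp C2 2 D.m :=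
  ((SchwartzMap.toLpCLM ℂ C2 2 D.m : 𝓢(Plane, C2) →L[ℂ] Lp C2 2 D.m) :
    𝓢(Plane, C2) →ₗ[ℂ] Lp C2 2 D.m).extendOfNorm schwartzToH1

/-! ### The sesquilinear forms, linear in the second argument -/

/-- The integrand of the unperturbed form at `ξ`. -/
def freeIntegrand (G F : H1) (ξ : Plane) : ℂ :=
  inner ℂ (hat G ξ) (WithLp.toLp 2
    ((symbol D.A ((2 * Real.pi) • ξ)).mulVec (WithLp.ofLp (hat F ξ))) : C2)

/-- The form of the unperturbed operator. -/
def freeForm (G F : H1) : ℂ := ∫ ξ, D.freeIntegrand G F ξ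

/-- The perturbation as a signed measure. -/
def nu : SignedMeasure Plane := D.m.withDensityᵥ D.h

/-- The form of the perturbation. -/
def nuForm (G F : H1) : ℂ :=
  ∫ x, (D.h x : ℂ) * inner ℂ (D.trace G x) (D.trace F x) ∂D.m

/-- The perturbed form. -/
def form (G F : H1) : ℂ := D.freeForm G F + D.nuForm G F

/-- The form of the perturbation is bounded with respect to the form of the unperturbed operator,
with a relative bound less than one. -/
def RelativelyFormBounded : Prop :=
  ∃ a : ℝ, a < 1 ∧ ∃ b : ℝ, ∀ F : H1,
    ‖D.nuForm F F‖ ≤ a * (D.freeForm F F).re + b * ‖F.1.1‖ ^ 2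

theorem exists_norm_A_le : ∃ C : ℝ, ∀ p, ‖D.A p‖ ≤ C + ‖p‖ ^ 2 := by
  have h1 := eventually_lt_of_limsup_lt D.limsup_A
  rw [Filter.Eventually, mem_cocompact] at h1
  obtain ⟨K, hK, hs⟩ := h1
  obtain ⟨C, hC⟩ := (hK.union (isCompact_singleton (x := (0 : Plane)))).exists_bound_of_continuousOn
    D.continuous_A.continuousOn
  refine ⟨max C 0, fun p => ?_⟩
  by_cases hp : p ∈ K ∪ {0}
  · have := hC p hp
    nlinarith [le_max_left C 0, sq_nonneg ‖p‖]
  · rw [Set.mem_union, not_or] at hp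
    have h2 : ENNReal.ofReal (‖D.A p‖ / ‖p‖ ^ 2) < 1 := hs hp.1
    have hp0 : 0 < ‖p‖ := norm_pos_iff.2 hp.2
    rw [ENNReal.ofReal_lt_one, div_lt_one (by positivity)] at h2
    linarith [le_max_right C 0]

theorem norm_symbol_le {C : ℝ} {p : Plane} (hC : ‖D.A p‖ ≤ C + ‖p‖ ^ 2) (u v : C2) :
    ‖(inner ℂ u (WithLp.toLp 2 ((symbol D.A p).mulVec (WithLp.ofLp v)) : C2) : ℂ)‖ ≤
      4 * (|C| + 2 * ‖p‖ ^ 2) * (‖u‖ * ‖v‖) := by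
  have hu : ∀ i, ‖u i‖ ≤ ‖u‖ := fun i => PiLp.norm_apply_le u i
  have hv : ∀ i, ‖v i‖ ≤ ‖v‖ := fun i => PiLp.norm_apply_le v i
  have hs : ∀ i j, ‖symbol D.A p i j‖ ≤ |C| + 2 * ‖p‖ ^ 2 := by
    have h1 : ‖D.A p‖ ≤ |C| + 2 * ‖p‖ ^ 2 := by
      nlinarith [le_abs_self C, sq_nonneg ‖p‖]
    have h2 : ‖(((‖p‖ ^ 2 : ℝ)) : ℂ)‖ ≤ |C| + 2 * ‖p‖ ^ 2 := by
      rw [Complex.norm_real, Real.norm_of_nonneg (by positivity)]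
      nlinarith [abs_nonneg C, sq_nonneg ‖p‖]
    intro i j
    fin_cases i <;> fin_cases j
    · exact h2
    · exact h1
    · change ‖(starRingEnd ℂ) (D.A p)‖ ≤ _
      rw [RCLike.norm_conj]; exact h1
    · exact h2
  rw [EuclideanSpace.inner_eq_star_dotProduct]
  simp only [dotProduct, Matrix.mulVec, Fin.sum_univ_two, Pi.star_apply]
  have key : ∀ i j, ‖symbol D.A p i j * v j * star (u i)‖ ≤
      (|C| + 2 * ‖p‖ ^ 2) * (‖u‖ * ‖v‖) := by
    intro i j
    rw [norm_mul, norm_mul, norm_star]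
    calc _ ≤ (|C| + 2 * ‖p‖ ^ 2) * ‖v‖ * ‖u‖ := by
          gcongr
          · exact hs i j
          · exact hv j
          · exact hu i
      _ = _ := by ring
  calc _ = ‖(symbol D.A p 0 0 * v 0 * star (u 0) + symbol D.A p 0 1 * v 1 * star (u 0)) +
        (symbol D.A p 1 0 * v 0 * star (u 1) + symbol D.A p 1 1 * v 1 * star (u 1))‖ := by
        congr 1; ring
    _ ≤ _ := by
        refine (norm_add_le _ _).trans ((add_le_add (norm_add_le _ _) (norm_add_le _ _)).trans ?_)
        linarith [key 0 0, key 0 1, key 1 0, key 1 1]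

theorem aestronglyMeasurable_freeIntegrand (G F : H1) :
    AEStronglyMeasurable (D.freeIntegrand G F) volume := by
  have hA := D.continuous_A
  have hG : ∀ i, AEStronglyMeasurable (fun ξ => (hat G ξ) i) volume := fun i =>
    (EuclideanSpace.proj (𝕜 := ℂ) i).continuous.comp_aestronglyMeasurable
      (Lp.aestronglyMeasurable (hat G))
  have hF : ∀ i, AEStronglyMeasurable (fun ξ => (hat F ξ) i) volume := fun i =>
    (EuclideanSpace.proj (𝕜 := ℂ) i).continuous.comp_aestronglyMeasurable
      (Lp.aestronglyMeasurable (hat F))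
  have hs : ∀ i j, AEStronglyMeasurable
      (fun ξ : Plane => symbol D.A ((2 * Real.pi) • ξ) i j) volume := by
    have h1 : Continuous (fun ξ : Plane => D.A ((2 * Real.pi) • ξ)) := by fun_prop
    intro i j
    refine Continuous.aestronglyMeasurable ?_
    fin_cases i <;> fin_cases j
    · change Continuous fun ξ : Plane => (((‖(2 * Real.pi) • ξ‖ ^ 2 : ℝ)) : ℂ)
      fun_prop
    · exact h1
    · exact Complex.continuous_conj.comp h1
    · change Continuous fun ξ : Plane => (((‖(2 * Real.pi) • ξ‖ ^ 2 : ℝ)) : ℂ)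
      fun_prop
  have : D.freeIntegrand G F = fun ξ =>
      (symbol D.A ((2 * Real.pi) • ξ) 0 0 * hat F ξ 0 +
        symbol D.A ((2 * Real.pi) • ξ) 0 1 * hat F ξ 1) * star (hat G ξ 0) +
      (symbol D.A ((2 * Real.pi) • ξ) 1 0 * hat F ξ 0 +
        symbol D.A ((2 * Real.pi) • ξ) 1 1 * hat F ξ 1) * star (hat G ξ 1) := by
    funext ξ
    rw [freeIntegrand, EuclideanSpace.inner_eq_star_dotProduct]
    simp only [dotProduct, Matrix.mulVec, Fin.sum_univ_two, Pi.star_apply]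
  rw [this]
  exact ((((hs 0 0).mul (hF 0)).add ((hs 0 1).mul (hF 1))).mul (hG 0).star).add
    ((((hs 1 0).mul (hF 0)).add ((hs 1 1).mul (hF 1))).mul (hG 1).star)

theorem integrable_freeIntegrand (G F : H1) : Integrable (D.freeIntegrand G F) := by
  obtain ⟨C, hC⟩ := D.exists_norm_A_le
  have i1 : Integrable (fun ξ => ‖hat G ξ‖ * ‖hat F ξ‖) :=
    (Lp.memLp (hat G)).norm.integrable_mul (Lp.memLp (hat F)).norm
  have i2 : Integrable (fun ξ => ‖G.1.2 ξ‖ * ‖F.1.2 ξ‖) :=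
    (Lp.memLp G.1.2).norm.integrable_mul (Lp.memLp F.1.2).norm
  refine Integrable.mono ((i1.const_mul (4 * |C|)).add (i2.const_mul 8))
    (D.aestronglyMeasurable_freeIntegrand G F) ?_
  have hG : (G.1.2 : Plane → C2) =ᵐ[volume]
    fun ξ => ((2 * Real.pi * ‖ξ‖ : ℝ) : ℂ) • hat G ξ := G.2
  have hF : (F.1.2 : Plane → C2) =ᵐ[volume]
    fun ξ => ((2 * Real.pi * ‖ξ‖ : ℝ) : ℂ) • hat F ξ := F.2
  filter_upwards [hG, hF] with ξ a b
  have hk : ‖(2 * Real.pi) • ξ‖ = 2 * Real.pi * ‖ξ‖ := by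
    rw [norm_smul, Real.norm_of_nonneg (by positivity)]
  have hk2 : ‖((2 * Real.pi * ‖ξ‖ : ℝ) : ℂ)‖ = 2 * Real.pi * ‖ξ‖ := by
    rw [Complex.norm_real, Real.norm_of_nonneg (by positivity)]
  refine (D.norm_symbol_le (hC _) _ _).trans ?_
  refine le_trans (le_of_eq ?_) (le_abs_self _)
  rw [Pi.add_apply, a, b, hk, norm_smul _ (hat G ξ), norm_smul _ (hat F ξ), hk2]
  ring

theorem freeForm_add (G F F' : H1) :
    D.freeForm G (F + F') = D.freeForm G F + D.freeForm G F' := by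
  rw [freeForm, freeForm, freeForm,
    ← integral_add (D.integrable_freeIntegrand G F) (D.integrable_freeIntegrand G F')]
  refine integral_congr_ae ?_
  filter_upwards [Lp.coeFn_add (hat F) (hat F')] with ξ hξ
  simp only [freeIntegrand]
  rw [hat_add, hξ, Pi.add_apply, ← inner_add_right, WithLp.ofLp_add, Matrix.mulVec_add,
    WithLp.toLp_add]

theorem freeForm_smul (k : ℂ) (G F : H1) : D.freeForm G (k • F) = k * D.freeForm G F := by
  rw [freeForm, freeForm, ← integral_const_mul]
  refine integral_congr_ae ?_
  filter_upwards [Lp.coeFn_smul k (hat F)] with ξ hξ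
  simp only [freeIntegrand]
  rw [hat_smul, hξ, Pi.smul_apply, WithLp.ofLp_smul, Matrix.mulVec_smul, WithLp.toLp_smul,
    inner_smul_right]

theorem integrable_nuForm (G F : H1) :
    Integrable (fun x => (D.h x : ℂ) * inner ℂ (D.trace G x) (D.trace F x)) D.m := by
  obtain ⟨C, hC⟩ := D.bounded_h
  refine Integrable.bdd_mul (c := C) (L2.integrable_inner (𝕜 := ℂ) (D.trace G) (D.trace F)) ?_ ?_
  · exact (Complex.measurable_ofReal.comp D.measurable_h).aestronglyMeasurable
  · exact Eventually.of_forall fun x => by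
      rw [Complex.norm_real, Real.norm_eq_abs]; exact hC x

theorem nuForm_add (G F F' : H1) :
    D.nuForm G (F + F') = D.nuForm G F + D.nuForm G F' := by
  rw [nuForm, nuForm, nuForm,
    ← integral_add (D.integrable_nuForm G F) (D.integrable_nuForm G F')]
  refine integral_congr_ae ?_
  filter_upwards [Lp.coeFn_add (D.trace F) (D.trace F')] with x hx
  rw [map_add, hx, Pi.add_apply, inner_add_right, mul_add]

theorem nuForm_smul (k : ℂ) (G F : H1) : D.nuForm G (k • F) = k * D.nuForm G F := by
  rw [nuForm, nuForm, ← integral_const_mul]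
  refine integral_congr_ae ?_
  filter_upwards [Lp.coeFn_smul k (D.trace F)] with x hx
  rw [map_smul, hx, Pi.smul_apply, inner_smul_right]
  ring

theorem form_add (G F F' : H1) : D.form G (F + F') = D.form G F + D.form G F' := by
  simp only [form, freeForm_add, nuForm_add]; ring

theorem form_smul (k : ℂ) (G F : H1) : D.form G (k • F) = k * D.form G F := by
  simp only [form, freeForm_smul, nuForm_smul]; ring

/-! ### The operator associated with the form -/

/-- The graph of the operator associated with the form: the pairs `(f, u)` with `f` in the form
domain and `q(g, f) = ⟪g, u⟫` for all `g` in the form domain. -/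
def hamiltonianGraph : Submodule ℂ (Spinors × Spinors) where
  carrier := {z | ∃ F : H1, F.1.1 = z.1 ∧ ∀ G : H1, D.form G F = inner ℂ G.1.1 z.2}
  zero_mem' := ⟨0, rfl, fun G => by simpa using D.form_smul 0 G 0⟩
  add_mem' := by
    rintro z w ⟨F, hF, hz⟩ ⟨F', hF', hw⟩
    refine ⟨F + F', by simp [hF, hF'], fun G => ?_⟩
    rw [form_add, hz, hw, Prod.snd_add, inner_add_right]
  smul_mem' := by
    rintro k z ⟨F, hF, hz⟩
    refine ⟨k • F, by simp [hF], fun G => ?_⟩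
    rw [form_smul, hz, Prod.smul_snd, inner_smul_right]

/-- The Hamiltonian, as an unbounded operator. -/
def hamiltonian : Spinors →ₗ.[ℂ] Spinors := D.hamiltonianGraph.toLinearPMap

/-- The Sobolev space is dense, so that the Hamiltonian is well defined. -/
theorem dense_fst_H1 : Dense {f : Spinors | ∃ F : H1, F.1.1 = f} := by
  have h1 : DenseRange (SchwartzMap.toLpCLM ℝ C2 2 (volume : Measure Plane)) :=
    SchwartzMap.denseRange_toLpCLM ENNReal.ofNat_ne_top
  refine Dense.mono ?_ h1
  rintro _ ⟨φ, rfl⟩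
  exact ⟨schwartzToH1 φ, rfl⟩

theorem hamiltonian_graph : D.hamiltonian.graph = D.hamiltonianGraph := by
  refine Submodule.toLinearPMap_graph_eq _ ?_
  rintro ⟨f, u⟩ ⟨F, hF, hu⟩ hf
  simp only at hF hu hf ⊢
  have hF0 : F = 0 := by
    have h1 : F.1.1 = 0 := hF.trans hf
    have h2 : (𝓕 (0 : Spinors) : Spinors) = 0 := (Lp.fourierTransformₗᵢ Plane C2).map_zero
    refine Subtype.ext (Prod.ext h1 (Lp.ext ?_))
    have h3 : (F.1.2 : Plane → C2) =ᵐ[volume]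
      fun ξ => ((2 * Real.pi * ‖ξ‖ : ℝ) : ℂ) • (𝓕 F.1.1 : Spinors) ξ := F.2
    rw [h1, h2] at h3
    filter_upwards [h3, Lp.coeFn_zero C2 2 (volume : Measure Plane)] with ξ a b
    rw [a, b]
    exact (smul_zero _).trans b.symm
  refine dense_fst_H1.eq_zero_of_inner_right ℂ ?_
  rintro _ ⟨G, rfl⟩
  rw [← hu G, hF0]
  simpa using D.form_smul 0 G 0

end System

/-! ### Eigenvalues of an unbounded operator -/

/-- The eigenspace of an unbounded operator for a real number. -/
def eigenspace (T : Spinors →ₗ.[ℂ] Spinors) (E : ℝ) : Submodule ℂ Spinors where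
  carrier := {f | (f, (E : ℂ) • f) ∈ T.graph}
  zero_mem' := by
    have := T.graph.zero_mem
    simp only [Set.mem_ofPred_eq, smul_zero]
    exact this
  add_mem' := by
    intro f g hf hg
    have := T.graph.add_mem hf hg
    rw [Prod.mk_add_mk, ← smul_add] at this
    exact this
  smul_mem' := by
    intro k f hf
    have := T.graph.smul_mem k hf
    rw [Prod.smul_mk, smul_comm] at this
    exact this

/-- The real eigenvalues below `c`. -/
def eigenvaluesBelow (T : Spinors →ₗ.[ℂ] Spinors) (c : ℝ) : Set ℝ :=
  {E | E < c ∧ eigenspace T E ≠ ⊥}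

/-- The number of the eigenvalues below `c`, counted with multiplicity: the dimension of the span
of the corresponding eigenspaces. -/
def countBelow (T : Spinors →ₗ.[ℂ] Spinors) (c : ℝ) : ℕ∞ :=
  Cardinal.toENat (Module.rank ℂ (⨆ E ∈ eigenvaluesBelow T c, eigenspace T E : Submodule ℂ Spinors))

/-- There are at least as many eigenvalues below the threshold, counted with multiplicity, as
there are points in the minimum set; and infinitely many distinct ones if that set is infinite. -/
def System.HasManyEigenvalues (D : System) : Prop :=
  (minimumSet D.A).encard ≤ countBelow D.hamiltonian D.kappa ∧
    ((minimumSet D.A).Infinite → (eigenvaluesBelow D.hamiltonian D.kappa).Infinite)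

end SpinOrbit

end

/-! Eigenvalues below `κ` are counted by a variational argument on the form domain. On the
low-frequency part of a weakly null sequence the trace on `m` tends to zero in norm; on high
frequencies the relative form bound keeps the form above `κ`. The form minus `κ` is therefore
asymptotically nonnegative along bounded weakly null sequences. Consequently, if the form is below
`κ` on an `N`-dimensional trial space, the eigenvectors below `κ` span at least `N` dimensions
(`card_le_rank`): otherwise some trial vector is orthogonal to all of them, and minimizing the
Rayleigh quotient on their orthogonal complement produces one more. Each eigenspace below `κ` is
finite-dimensional, so an infinite count forces infinitely many distinct eigenvalues.

The trial space for finitely many points `p_j` of the minimum set consists of wave packets with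
momenta near the `p_j`, polarized along the lower eigenvector of the symbol
(`exists_negative_family`). The lower band exceeds `κ` by at most a multiple of `|p - p_j|²` near
`p_j`, by the `C²` hypothesis. In dimension two the density `‖ξ‖⁻²` on an annulus, normalized in
`L¹`, has second moment of its square equal to the reciprocal of a multiple of `log (d / e)`. The
kinetic excess can thus be made arbitrarily small while the first component of the packet tends
pointwise to `exp (i p_j · x)`. In the limit only `∫ h |∑ c_j exp (i p_j · x)|² dm` remains, as an
upper bound, and it is nonpositive since `h ≤ 0` almost everywhere.

That integral is zero only if the trigonometric polynomial vanishes on `supp ν`. On a circle the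
polynomial extends to an analytic function of `z` in the punctured complex plane. Infinitely many
zeros on the circle accumulate, so this function vanishes identically, and comparing growth rates at
infinity shows that all coefficients are zero (`trigPolynomial_eq_zero`).

In the symmetric case the logarithmic profile is used once more: a point has zero capacity in the
plane, so `m` is not concentrated at the origin, and by invariance its support contains a whole
circle. -/

open MeasureTheory Filter Topology SchwartzMap FourierTransform
open scoped ENNReal InnerProductSpace LineDeriv

noncomputable section

namespace SpinOrbit

/-! ### Abstract variational principle for a coercive Hermitian form. -/

section Variational

variable {W L : Type*} [NormedAddCommGroup W] [InnerProductSpace ℂ W] [CompleteSpace W]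
  [NormedAddCommGroup L] [InnerProductSpace ℂ L]

set_option linter.unusedSectionVars false

/-- Bounded sequences in a Hilbert space have weakly convergent subsequences. -/
theorem exists_weakly_convergent_subseq [TopologicalSpace.SeparableSpace W] (w : ℕ → W) (B : ℝ)
    (hw : ∀ n, ‖w n‖ ≤ B) :
    ∃ (x : W) (φ : ℕ → ℕ), StrictMono φ ∧
      ∀ u : W, Tendsto (fun n => ⟪u, w (φ n)⟫_ℂ) atTop (𝓝 ⟪u, x⟫_ℂ) := by
  have h := WeakDual.isSeqCompact_closedBall ℂ W 0 B
  obtain ⟨y, -, φ, hφ, hy⟩ := h (x := fun n => StrongDual.toWeakDual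
    (InnerProductSpace.toDual ℂ W (w n))) (by
      intro n
      change InnerProductSpace.toDual ℂ W (w n) ∈ Metric.closedBall 0 B
      rw [mem_closedBall_zero_iff, LinearIsometryEquiv.norm_map]
      exact hw n)
  refine ⟨(InnerProductSpace.toDual ℂ W).symm (WeakDual.toStrongDual y), φ, hφ, fun u => ?_⟩
  have h2 := ((WeakBilin.eval_continuous (topDualPairing ℂ W) u).tendsto y).comp hy
  have h3 : Tendsto (fun n => ⟪w (φ n), u⟫_ℂ) atTop
      (𝓝 ⟪(InnerProductSpace.toDual ℂ W).symm (WeakDual.toStrongDual y), u⟫_ℂ) := by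
    rw [InnerProductSpace.toDual_symm_apply]
    exact h2
  have h4 := (Complex.continuous_conj.tendsto _).comp h3
  simpa only [Function.comp_def, inner_conj_symm] using h4

/-- A bounded Hermitian form `q` on a Hilbert space, together with an injection into another
inner product space, that is coercive and whose negative part below `κ` is weakly compact. -/
structure VariationalForm (ι : W →L[ℂ] L) (q : W → W → ℂ) (κ : ℝ) : Prop where
  add_right : ∀ u v w, q u (v + w) = q u v + q u w
  smul_right : ∀ (k : ℂ) u v, q u (k • v) = k * q u v
  conj_symm : ∀ u v, (starRingEnd ℂ) (q u v) = q v u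
  bounded : ∃ M : ℝ, ∀ u v, ‖q u v‖ ≤ M * ‖u‖ * ‖v‖
  injective : Function.Injective ι
  coercive : ∃ c > 0, ∃ C : ℝ, ∀ w, c * ‖w‖ ^ 2 ≤ (q w w).re + C * ‖ι w‖ ^ 2
  -- This substitutes for the statement that the essential spectrum does not go below `κ`.
  weak_liminf : ∀ w : ℕ → W, (∃ B, ∀ n, ‖w n‖ ≤ B) →
    (∀ u, Tendsto (fun n => ⟪u, w n⟫_ℂ) atTop (𝓝 0)) →
    ∀ ε > 0, ∀ᶠ n in atTop, -ε ≤ (q (w n) (w n)).re - κ * ‖ι (w n)‖ ^ 2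

namespace VariationalForm

variable {ι : W →L[ℂ] L} {q : W → W → ℂ} {κ : ℝ}

/-- The weak solutions of the eigenvalue equation. -/
def solutions (h : VariationalForm ι q κ) (E : ℝ) : Submodule ℂ W where
  carrier := {w | ∀ g, q g w = E * ⟪ι g, ι w⟫_ℂ}
  zero_mem' := fun g => by simpa using h.smul_right 0 g 0
  add_mem' := by
    intro u v hu hv g
    rw [h.add_right, hu, hv, map_add, inner_add_right, mul_add]
  smul_mem' := by
    intro k u hu g
    rw [h.smul_right, hu, map_smul, inner_smul_right]
    ring

theorem re_inner_self (x : L) : (⟪x, x⟫_ℂ).re = ‖x‖ ^ 2 := (norm_sq_eq_re_inner (𝕜 := ℂ) x).symm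

theorem add_left (h : VariationalForm ι q κ) (u v w : W) : q (u + v) w = q u w + q v w := by
  rw [← h.conj_symm, h.add_right, map_add, h.conj_symm, h.conj_symm]

theorem smul_left (h : VariationalForm ι q κ) (k : ℂ) (u v : W) :
    q (k • u) v = (starRingEnd ℂ) k * q u v := by
  rw [← h.conj_symm, h.smul_right, map_mul, h.conj_symm]

theorem re_swap (h : VariationalForm ι q κ) (u v : W) : (q u v).re = (q v u).re := by
  rw [← h.conj_symm, Complex.conj_re]

theorem tendsto_right [TopologicalSpace.SeparableSpace W] (h : VariationalForm ι q κ) {w : ℕ → W} (u : W)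
    (hw : ∀ u, Tendsto (fun n => ⟪u, w n⟫_ℂ) atTop (𝓝 0)) :
    Tendsto (fun n => q u (w n)) atTop (𝓝 0) := by
  obtain ⟨M, hM⟩ := h.bounded
  let l : W →L[ℂ] ℂ := LinearMap.mkContinuous
    { toFun := q u, map_add' := h.add_right u, map_smul' := fun k v => h.smul_right k u v }
    (M * ‖u‖) (fun v => hM u v)
  have := hw ((InnerProductSpace.toDual ℂ W).symm l)
  simp only [InnerProductSpace.toDual_symm_apply] at this
  exact this

theorem tendsto_inner (ι : W →L[ℂ] L) {w : ℕ → W} {x : W} (u : W)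
    (hw : ∀ u, Tendsto (fun n => ⟪u, w n⟫_ℂ) atTop (𝓝 ⟪u, x⟫_ℂ)) :
    Tendsto (fun n => ⟪ι u, ι (w n)⟫_ℂ) atTop (𝓝 ⟪ι u, ι x⟫_ℂ) := by
  have := hw ((InnerProductSpace.toDual ℂ W).symm ((innerSL ℂ (ι u)).comp ι))
  simpa only [InnerProductSpace.toDual_symm_apply, ContinuousLinearMap.comp_apply,
    innerSL_apply_apply] using this

theorem re_add_self (h : VariationalForm ι q κ) (u v : W) :
    (q (u + v) (u + v)).re = (q u u).re + 2 * (q u v).re + (q v v).re := by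
  rw [h.add_right, h.add_left, h.add_left]
  simp only [Complex.add_re]
  rw [h.re_swap v u]
  ring

/-- A nonnegative form vanishes against its null vectors. -/
theorem eq_of_minimizer (h : VariationalForm ι q κ) {S : Submodule ℂ W} {μ : ℝ}
    (hμ : ∀ w ∈ S, μ * ‖ι w‖ ^ 2 ≤ (q w w).re) {F : W} (hF : F ∈ S)
    (hF2 : (q F F).re = μ * ‖ι F‖ ^ 2) (G : W) (hG : G ∈ S) :
    q G F = μ * ⟪ι G, ι F⟫_ℂ := by
  have key : ∀ G ∈ S, (q G F).re = μ * (⟪ι G, ι F⟫_ℂ).re := by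
    intro G hG
    -- The form minus `μ‖ι ·‖²`, evaluated at `t G + F`, is a nonnegative quadratic polynomial in
    -- `t` without constant term; its discriminant forces the linear coefficient to vanish.
    have h1 : ∀ t : ℝ, 0 ≤ ((q G G).re - μ * ‖ι G‖ ^ 2) * (t * t) +
        (2 * ((q G F).re - μ * (⟪ι G, ι F⟫_ℂ).re)) * t + 0 := by
      intro t
      have h2 := hμ _ (S.add_mem (S.smul_mem (t : ℂ) hG) hF)
      rw [h.re_add_self, map_add, map_smul, @norm_add_sq ℂ, h.smul_right, h.smul_left, h.smul_left,
        hF2, inner_smul_left, norm_smul] at h2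
      simp only [Complex.conj_ofReal, Complex.re_ofReal_mul, Complex.norm_real, mul_pow,
        Real.norm_eq_abs, sq_abs, RCLike.re_to_complex] at h2
      nlinarith
    have := discrim_le_zero h1
    rw [discrim] at this
    have h3 : (2 * ((q G F).re - μ * (⟪ι G, ι F⟫_ℂ).re)) = 0 := by
      have : (2 * ((q G F).re - μ * (⟪ι G, ι F⟫_ℂ).re)) ^ 2 ≤ 0 := by linarith
      exact pow_eq_zero_iff (two_ne_zero) |>.1 (le_antisymm this (sq_nonneg _))
    linarith
  apply Complex.ext
  · rw [key G hG, Complex.re_ofReal_mul]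
  -- Testing with `i G` turns the equality of real parts into that of imaginary parts.
  · have := key _ (S.smul_mem Complex.I hG)
    rw [h.smul_left, map_smul, inner_smul_left] at this
    simp only [Complex.conj_I, neg_mul, Complex.neg_re, Complex.I_mul_re, neg_neg] at this
    rw [this, Complex.im_ofReal_mul]

/-- Direct method: a minimizing sequence normalized in `L` converges weakly along a subsequence. The
remainder costs asymptotically at least `κ` per unit of `L`-mass, while the infimum `μ` is below
`κ`; no mass can escape, and the weak limit is a minimizer. -/
theorem exists_minimizer [TopologicalSpace.SeparableSpace W] (h : VariationalForm ι q κ)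
    (S : Submodule ℂ W) {w₀ : W} (hw₀ : w₀ ∈ Sᗮ) (hneg : (q w₀ w₀).re < κ * ‖ι w₀‖ ^ 2) :
    ∃ E < κ, ∃ F ∈ Sᗮ, F ≠ 0 ∧ ∀ G ∈ Sᗮ, q G F = (E : ℂ) * ⟪ι G, ι F⟫_ℂ := by
  obtain ⟨c, hc, C, hC⟩ := h.coercive
  have hι : ∀ w, w ≠ 0 → 0 < ‖ι w‖ := fun w hw =>
    norm_pos_iff.2 fun h0 => hw (h.injective (h0.trans (map_zero ι).symm))
  have hz : q 0 0 = 0 := by simpa using h.smul_right 0 0 0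
  have hw0 : w₀ ≠ 0 := by
    rintro rfl
    simp [hz] at hneg
  -- The supremum of these lower bounds is the bottom of the Rayleigh quotient; coercivity puts `-C`
  -- in the set.
  set T : Set ℝ := {t | ∀ w ∈ Sᗮ, t * ‖ι w‖ ^ 2 ≤ (q w w).re} with hT
  have hne : (-C) ∈ T := fun w _ => by nlinarith [hC w, sq_nonneg ‖w‖]
  set E₀ := (q w₀ w₀).re / ‖ι w₀‖ ^ 2 with hE₀
  have hp := hι w₀ hw0
  have hE0 : E₀ < κ := by rw [hE₀, div_lt_iff₀ (by positivity)]; exact hneg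
  have hbd : ∀ t ∈ T, t ≤ E₀ := fun t ht => by
    rw [hE₀, le_div_iff₀ (by positivity)]; exact ht w₀ hw₀
  have hB : BddAbove T := ⟨E₀, hbd⟩
  set μ := sSup T with hμ
  have hμκ : μ < κ := lt_of_le_of_lt (csSup_le ⟨_, hne⟩ hbd) hE0
  have hμT : ∀ w ∈ Sᗮ, μ * ‖ι w‖ ^ 2 ≤ (q w w).re := by
    intro w hw
    rcases eq_or_ne w 0 with rfl | hw1
    · simp [hz]
    · have hp := hι w hw1
      rw [← le_div_iff₀ (by positivity)]
      refine csSup_le ⟨_, hne⟩ fun t ht => ?_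
      rw [le_div_iff₀ (by positivity)]
      exact ht w hw
  have hseq : ∀ n : ℕ, ∃ w ∈ Sᗮ, ‖ι w‖ = 1 ∧ (q w w).re < μ + 1 / (n + 1 : ℝ) := by
    intro n
    have hn : (0 : ℝ) < 1 / (n + 1 : ℝ) := by positivity
    have : μ + 1 / (n + 1 : ℝ) ∉ T := fun hmem => by linarith [le_csSup hB hmem]
    simp only [hT, Set.mem_ofPred_eq, not_forall, not_le] at this
    obtain ⟨w, hw, hlt⟩ := this
    have hw1 : w ≠ 0 := by rintro rfl; simp [hz] at hlt
    have hp := hι w hw1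
    refine ⟨((‖ι w‖⁻¹ : ℝ) : ℂ) • w, Submodule.smul_mem _ _ hw, ?_, ?_⟩
    · rw [map_smul, norm_smul, Complex.norm_real, norm_inv, norm_norm, inv_mul_cancel₀ hp.ne']
    · rw [h.smul_right, h.smul_left, Complex.conj_ofReal, Complex.re_ofReal_mul,
        Complex.re_ofReal_mul, ← mul_assoc, ← mul_inv, inv_mul_lt_iff₀ (by positivity)]
      linarith
  choose w hwS hw1 hwq using hseq
  have hbound : ∀ n, ‖w n‖ ≤ Real.sqrt ((μ + 1 + C) / c) := by
    intro n
    apply Real.le_sqrt_of_sq_le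
    rw [le_div_iff₀ hc]
    have h1 := hC (w n)
    rw [hw1 n] at h1
    have h2 : 1 / (n + 1 : ℝ) ≤ 1 := by
      rw [div_le_one (by positivity)]; linarith [(Nat.cast_nonneg n : (0 : ℝ) ≤ n)]
    linarith [hwq n]
  obtain ⟨x, φ, hφ, hx⟩ := exists_weakly_convergent_subseq w _ hbound
  have hxS : x ∈ Sᗮ := by
    rw [Submodule.mem_orthogonal]
    intro u hu
    refine tendsto_nhds_unique (hx u) ?_
    have : (fun n => ⟪u, w (φ n)⟫_ℂ) = fun _ => 0 := by
      funext n
      exact (Submodule.mem_orthogonal _ _).1 (hwS (φ n)) u hu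
    rw [this]
    exact tendsto_const_nhds
  have hd : ∀ u, Tendsto (fun n => ⟪u, w (φ n) - x⟫_ℂ) atTop (𝓝 0) := by
    intro u
    simp only [inner_sub_right]
    simpa using (hx u).sub_const ⟪u, x⟫_ℂ
  have hliminf := h.weak_liminf (fun n => w (φ n) - x)
    ⟨Real.sqrt ((μ + 1 + C) / c) + ‖x‖, fun n =>
      (norm_sub_le _ _).trans (by gcongr; exact hbound _)⟩ hd
  have hcross : Tendsto (fun n => (q x (w (φ n) - x)).re) atTop (𝓝 0) := by
    have := (Complex.continuous_re.tendsto _).comp (h.tendsto_right x hd)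
    exact this
  have hcross2 : Tendsto (fun n => (⟪ι x, ι (w (φ n))⟫_ℂ).re) atTop (𝓝 (‖ι x‖ ^ 2)) := by
    have := (Complex.continuous_re.tendsto _).comp (tendsto_inner ι x hx)
    rwa [re_inner_self] at this
  have hx1 : ‖ι x‖ ≤ 1 := by
    have h1 : ‖ι x‖ ^ 2 ≤ ‖ι x‖ * 1 := by
      refine le_of_tendsto hcross2 (Eventually.of_forall fun n => ?_)
      rw [← hw1 (φ n)]
      exact re_inner_le_norm (𝕜 := ℂ) _ _
    nlinarith [norm_nonneg (ι x)]
  -- Expand the form at `w n = x + (w n - x)`: the cross term tends to zero, the remainder is at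
  -- least `κ‖ι (w n - x)‖²` up to an error, and that squared norm tends to `1 - ‖ι x‖²`.
  have hmain : (q x x).re - κ * ‖ι x‖ ^ 2 ≤ μ - κ := by
    refine le_of_forall_pos_le_add fun ε hε => ?_
    have e1 := hliminf (ε / 8) (by positivity)
    have e2 := hcross.eventually (lt_mem_nhds (show -(ε / 8) < 0 by linarith))
    have e3 := (hcross2.const_mul |κ|).eventually
      (Metric.ball_mem_nhds _ (show 0 < ε / 8 by positivity))
    have e4 := (tendsto_one_div_add_atTop_nhds_zero_nat.comp hφ.tendsto_atTop).eventually
      (gt_mem_nhds (show 0 < ε / 8 by positivity))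
    obtain ⟨n, a1, a2, a3, a4⟩ := (e1.and (e2.and (e3.and e4))).exists
    have b1 := h.re_add_self x (w (φ n) - x)
    rw [add_sub_cancel] at b1
    have b2 := hwq (φ n)
    simp only [Function.comp_apply] at a4
    have b3 := @norm_sub_sq ℂ _ _ _ _ (ι (w (φ n))) (ι x)
    rw [← map_sub, hw1, RCLike.re_to_complex, ← RCLike.re_to_complex, inner_re_symm,
      RCLike.re_to_complex] at b3
    rw [Real.dist_eq, ← mul_sub, abs_mul, abs_abs] at a3
    have b4 : |κ * (‖ι x‖ ^ 2 - (⟪ι x, ι (w (φ n))⟫_ℂ).re)| < ε / 8 := by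
      rw [abs_mul, abs_sub_comm]
      exact a3
    rw [abs_lt] at b4
    rw [b3] at a1
    nlinarith [b4.1, b4.2]
  have hge := hμT x hxS
  -- The last two bounds give `(μ - κ)‖ι x‖² ≤ μ - κ` with `μ - κ < 0`, hence `‖ι x‖ ≥ 1`.
  have hx2 : ‖ι x‖ ^ 2 = 1 := by
    have h1 : (μ - κ) * ‖ι x‖ ^ 2 ≤ μ - κ := by linarith
    nlinarith [norm_nonneg (ι x)]
  refine ⟨μ, hμκ, x, hxS, ?_, fun G hG => h.eq_of_minimizer hμT hxS ?_ G hG⟩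
  · rintro rfl
    simp at hx2
  · rw [hx2] at hmain hge ⊢
    linarith

/-- The space spanned by the eigenvectors below `κ`. -/
def solutionsBelow (h : VariationalForm ι q κ) : Submodule ℂ W :=
  ⨆ E : {E : ℝ // E < κ}, h.solutions E

/-- If the eigenvectors below `κ` spanned a space `M` of too small a dimension, a nonzero trial
combination would be `L`-orthogonal to `M`. The constrained minimizer `F` is then an unconstrained
eigenvector, because the form vanishes between `M` and `F`; so `F` lies in `M` and is orthogonal to
itself. -/
theorem card_le_rank [TopologicalSpace.SeparableSpace W] [CompleteSpace L]
    (h : VariationalForm ι q κ) {N : Type*} [Fintype N] (V : N → W)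
    (hV : ∀ c : N → ℂ, c ≠ 0 → (q (∑ j, c j • V j) (∑ j, c j • V j)).re <
      κ * ‖ι (∑ j, c j • V j)‖ ^ 2) :
    (Fintype.card N : Cardinal) ≤ Module.rank ℂ (h.solutionsBelow) := by
  by_contra! hlt
  have hfd : FiniteDimensional ℂ h.solutionsBelow := by
    rw [FiniteDimensional, ← Module.rank_lt_aleph0_iff]
    exact hlt.trans (Cardinal.natCast_lt_aleph0)
  rw [← Module.finrank_eq_rank, Nat.cast_lt] at hlt
  set M := h.solutionsBelow with hM
  -- Through `ι* ι`, orthogonality to `ι M` in `L` becomes orthogonality to `S = ι* ι M` in `W`,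
  -- where the minimization takes place.
  set A := ((ContinuousLinearMap.adjoint ι).comp ι : W →L[ℂ] W) with hA
  set S := M.map (A : W →ₗ[ℂ] W) with hS
  have hSf : Module.finrank ℂ S ≤ Module.finrank ℂ M := Submodule.finrank_map_le _ _
  have hmem : ∀ w, w ∈ Sᗮ ↔ ∀ e ∈ M, ⟪ι e, ι w⟫_ℂ = 0 := by
    intro w
    rw [Submodule.mem_orthogonal]
    constructor
    · intro h1 e he
      rw [← ContinuousLinearMap.adjoint_inner_left]
      exact h1 _ ⟨e, he, rfl⟩
    · rintro h1 _ ⟨e, he, rfl⟩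
      change ⟪(ContinuousLinearMap.adjoint ι) (ι e), w⟫_ℂ = 0
      rw [ContinuousLinearMap.adjoint_inner_left]
      exact h1 e he
  let comb : (N → ℂ) →ₗ[ℂ] W := Fintype.linearCombination ℂ V
  have hcomb : ∀ c, comb c = ∑ j, c j • V j := fun c => Fintype.linearCombination_apply ℂ V c
  have hker : ((S.orthogonalProjectionOnto : W →ₗ[ℂ] S) ∘ₗ comb).ker ≠ ⊥ := by
    apply LinearMap.ker_ne_bot_of_finrank_lt
    rw [Module.finrank_fintype_fun_eq_card]
    omega
  obtain ⟨c, hc, hc0⟩ := Submodule.exists_mem_ne_zero_of_ne_bot hker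
  have hcS : comb c ∈ Sᗮ := by
    rw [← Submodule.orthogonalProjectionOnto_eq_zero_iff]
    exact hc
  obtain ⟨E, hE, F, hF, hF0, hsol⟩ := h.exists_minimizer S hcS (by rw [hcomb]; exact hV c hc0)
  have hF2 := (hmem F).1 hF
  have hqM : ∀ e ∈ M, q e F = 0 := by
    intro e he
    rw [← h.conj_symm]
    have : q F e = 0 := by
      induction he using Submodule.iSup_induction' with
      | mem i x hx =>
        rw [hx F, ← inner_conj_symm, hF2 x (Submodule.mem_iSup_of_mem i hx)]
        simp
      | zero => simpa using h.smul_right 0 F 0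
      | add x y _ _ hx hy => rw [h.add_right, hx, hy, add_zero]
    rw [this, map_zero]
  have hFM : F ∈ M := by
    refine Submodule.mem_iSup_of_mem (⟨E, hE⟩ : {E : ℝ // E < κ}) fun G => ?_
    -- An arbitrary test vector `G` is split by projecting `ι G` onto `ι M`; the difference `G - e`
    -- satisfies the constraint.
    obtain ⟨e, he, heq⟩ := (Submodule.mem_map).1
      ((M.map (ι : W →ₗ[ℂ] L)).orthogonalProjectionOnto (ι G)).2
    have hG : G - e ∈ Sᗮ := by
      rw [hmem]
      intro e' he'
      rw [map_sub]
      change ι e = _ at heq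
      rw [heq]
      exact Submodule.inner_right_of_mem_orthogonal (Submodule.mem_map_of_mem he')
        (Submodule.sub_starProjection_mem_orthogonal _)
    have h1 := hsol _ hG
    have h2 : q G F = q (G - e) F + q e F := by rw [← h.add_left, sub_add_cancel]
    rw [h2, h1, hqM e he, map_sub, inner_sub_left, hF2 e he]
    simp
  have := hF2 F hFM
  rw [inner_self_eq_zero] at this
  exact hF0 (h.injective (this.trans (map_zero ι).symm))

/-- An infinite-dimensional eigenspace contains a bounded sequence with mutual distances at least
one. Coercivity bounds its preimages in `W`; along a weakly convergent subsequence the consecutive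
differences are weakly null, yet their form values stay below `κ` by a fixed amount. -/
theorem finiteDimensional_solutions [TopologicalSpace.SeparableSpace W]
    (h : VariationalForm ι q κ) {E : ℝ} (hE : E < κ) :
    FiniteDimensional ℂ ((h.solutions E).map (ι : W →ₗ[ℂ] L)) := by
  by_contra hinf
  obtain ⟨R, f, hR, hf, hsep⟩ := exists_seq_norm_le_one_le_norm_sub hinf
  obtain ⟨c, hc, C, hC⟩ := h.coercive
  have hex : ∀ n, ∃ w ∈ h.solutions E, ι w = f n := fun n => (f n).2
  choose w hw hwf using hex
  have hq : ∀ w ∈ h.solutions E, (q w w).re = E * ‖ι w‖ ^ 2 := by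
    intro w hw
    rw [hw w, Complex.re_ofReal_mul, re_inner_self]
  have hbound : ∀ n, ‖w n‖ ≤ Real.sqrt ((|E + C| * R ^ 2) / c) := by
    intro n
    apply Real.le_sqrt_of_sq_le
    rw [le_div_iff₀ hc]
    have h1 := hC (w n)
    rw [hq _ (hw n), hwf] at h1
    have h2 : ‖(f n : L)‖ ^ 2 ≤ R ^ 2 := by
      have := hf n
      rw [Submodule.norm_coe]
      gcongr
    have h3 : (E + C) * ‖(f n : L)‖ ^ 2 ≤ |E + C| * R ^ 2 :=
      mul_le_mul (le_abs_self _) h2 (sq_nonneg _) (abs_nonneg _)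
    linarith
  obtain ⟨x, φ, hφ, hx⟩ := exists_weakly_convergent_subseq w _ hbound
  have hd : ∀ u, Tendsto (fun n => ⟪u, w (φ (n + 1)) - w (φ n)⟫_ℂ) atTop (𝓝 0) := by
    intro u
    simp only [inner_sub_right]
    simpa using ((hx u).comp (tendsto_add_atTop_nat 1)).sub (hx u)
  -- Differences of `L`-norm at least one have deficit at least `κ - E`, so `(κ - E) / 2` is
  -- contradictory.
  have hliminf := h.weak_liminf _ ⟨2 * Real.sqrt ((|E + C| * R ^ 2) / c), fun n => by
    refine (norm_sub_le _ _).trans ?_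
    linarith [hbound (φ (n + 1)), hbound (φ n)]⟩ hd ((κ - E) / 2) (by linarith)
  obtain ⟨n, hn⟩ := hliminf.exists
  rw [hq _ (Submodule.sub_mem _ (hw _) (hw _)), map_sub, hwf, hwf] at hn
  have h1 : 1 ≤ ‖(f (φ (n + 1)) : L) - f (φ n)‖ :=
    hsep (hφ.injective.ne (Nat.succ_ne_self n))
  nlinarith [mul_le_mul h1 h1 zero_le_one (norm_nonneg _)]

end VariationalForm

end Variational

/-! ### Trigonometric polynomials vanishing on infinite subsets of a circle. -/

section CircleUniqueness

/-- The identification of the plane with the complex numbers. -/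
def toComplex (p : Plane) : ℂ := ⟨p 0, p 1⟩

theorem toComplex_injective : Function.Injective toComplex := by
  intro p q h
  have h0 := congrArg Complex.re h
  have h1 := congrArg Complex.im h
  ext i
  fin_cases i
  · exact h0
  · exact h1

theorem norm_toComplex (p : Plane) : ‖toComplex p‖ = ‖p‖ := by
  rw [EuclideanSpace.norm_eq, Complex.norm_eq_sqrt_sq_add_sq, Fin.sum_univ_two]
  simp [toComplex]

theorem inner_eq_toComplex (p x : Plane) :
    ((inner ℝ p x : ℝ) : ℂ) = ((starRingEnd ℂ) (toComplex p) * toComplex x +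
      toComplex p * (starRingEnd ℂ) (toComplex x)) / 2 := by
  have : (inner ℝ p x : ℝ) = p 0 * x 0 + p 1 * x 1 := by
    simp [PiLp.inner_apply, Fin.sum_univ_two]
    ring
  rw [this]
  apply Complex.ext
  · simp [toComplex]
  · simp [toComplex]
    ring

/-- Exponential sums in `z` and `z⁻¹` that vanish on the punctured plane have zero coefficients. -/
theorem exp_sum_eq_zero {N : Type*} [Fintype N] (p : N → ℂ) (hp : Function.Injective p)
    (c : N → ℂ)
    (h : ∀ z : ℂ, z ≠ 0 → ∑ j, c j * Complex.exp (Complex.I *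
      ((starRingEnd ℂ) (p j) * z + p j * z⁻¹)) = 0) : c = 0 := by
  classical
  by_contra hc
  obtain ⟨k, hk⟩ := Function.ne_iff.1 hc
  -- The dominant term: the largest `‖p j‖` among the nonzero coefficients.
  obtain ⟨j₀, hj₀, hmax⟩ := Finset.exists_max_image (Finset.univ.filter fun j => c j ≠ 0)
    (fun j => ‖p j‖) ⟨k, by simpa using hk⟩
  simp only [Finset.mem_filter, Finset.mem_univ, true_and] at hj₀ hmax
  -- Along the ray through `u` this term grows like `exp (t ‖p j₀‖)`; for `p j₀ ≠ 0` the direction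
  -- is `-i p j₀ / ‖p j₀‖`.
  obtain ⟨u, hu, hup⟩ : ∃ u : ℂ, ‖u‖ = 1 ∧
      Complex.I * (starRingEnd ℂ) (p j₀) * u = (‖p j₀‖ : ℂ) := by
    rcases eq_or_ne (p j₀) 0 with h0 | h0
    · exact ⟨1, by simp, by simp [h0]⟩
    · have h1 : (‖p j₀‖ : ℂ) ≠ 0 := by simpa using h0
      refine ⟨-Complex.I * p j₀ / ‖p j₀‖, ?_, ?_⟩
      · simp [h0]
      · have h2 : (starRingEnd ℂ) (p j₀) * p j₀ = (‖p j₀‖ : ℂ) ^ 2 := Complex.conj_mul' _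
        field_simp
        linear_combination (-Complex.I ^ 2) * h2 - (‖p j₀‖ : ℂ) ^ 2 * Complex.I_sq
  have hu0 : u ≠ 0 := by rintro rfl; simp at hu
  -- After division by the dominant growth only the term `j₀` survives; the part with `z⁻¹`
  -- contributes a factor tending to one.
  have hterm : ∀ j, Tendsto (fun t : ℝ => c j * Complex.exp (Complex.I *
      ((starRingEnd ℂ) (p j) * (t * u) + p j * (t * u)⁻¹)) * Complex.exp (-(t * ‖p j₀‖)))
      atTop (𝓝 (if j = j₀ then c j₀ else 0)) := by
    intro j
    have hinv : Tendsto (fun t : ℝ => ((t : ℂ) * u)⁻¹) atTop (𝓝 0) := by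
      simp only [mul_inv, ← Complex.ofReal_inv]
      have := ((Complex.continuous_ofReal.tendsto 0).comp tendsto_inv_atTop_zero).mul_const (u⁻¹)
      simpa [Function.comp_def] using this
    have h1 : Tendsto (fun t : ℝ => Complex.exp (Complex.I * (p j * ((t : ℂ) * u)⁻¹))) atTop
        (𝓝 1) := by
      have := (Complex.continuous_exp.tendsto _).comp ((hinv.const_mul (p j)).const_mul Complex.I)
      simpa [Function.comp_def] using this
    have heq : ∀ t : ℝ, c j * Complex.exp (Complex.I *
        ((starRingEnd ℂ) (p j) * (t * u) + p j * (t * u)⁻¹)) * Complex.exp (-(t * ‖p j₀‖)) =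
        c j * (Complex.exp (t * (Complex.I * (starRingEnd ℂ) (p j) * u - ‖p j₀‖)) *
          Complex.exp (Complex.I * (p j * ((t : ℂ) * u)⁻¹))) := by
      intro t
      rw [mul_assoc, ← Complex.exp_add, ← Complex.exp_add]
      congr 2
      ring
    simp only [heq]
    rcases eq_or_ne j j₀ with rfl | hne
    · simp only [hup, sub_self, mul_zero, Complex.exp_zero, if_true, one_mul]
      simpa using h1.const_mul (c j)
    · rw [if_neg hne]
      by_cases hcj : c j = 0
      · simp [hcj]
      -- Equality would require `w` to be real and equal to `‖p j₀‖`, that is `p j = p j₀`.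
      have hlt : (Complex.I * (starRingEnd ℂ) (p j) * u - ‖p j₀‖).re < 0 := by
        rw [Complex.sub_re, Complex.ofReal_re, sub_neg]
        set w := Complex.I * (starRingEnd ℂ) (p j) * u with hw
        have hnw : ‖w‖ = ‖p j‖ := by simp [hw, hu]
        have hle : ‖p j‖ ≤ ‖p j₀‖ := hmax j hcj
        refine lt_of_le_of_ne ((Complex.re_le_norm w).trans (hnw.le.trans hle)) fun heq => hne ?_
        have h3 : w.re = ‖w‖ := le_antisymm (Complex.re_le_norm w) (by rw [hnw, heq]; exact hle)
        have h4 : w = (‖p j₀‖ : ℂ) := by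
          have h6 : w.im = 0 := by
            have := Complex.sq_norm w
            rw [Complex.normSq_apply, ← h3] at this
            nlinarith
          apply Complex.ext
          · rw [heq, Complex.ofReal_re]
          · rw [h6, Complex.ofReal_im]
        rw [hw, ← hup] at h4
        have h7 := mul_left_cancel₀ Complex.I_ne_zero (mul_right_cancel₀ hu0 h4)
        exact hp ((starRingEnd ℂ).injective h7)
      have h2 : Tendsto (fun t : ℝ => Complex.exp
          (t * (Complex.I * (starRingEnd ℂ) (p j) * u - ‖p j₀‖))) atTop (𝓝 0) := by
        rw [tendsto_zero_iff_norm_tendsto_zero]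
        simp only [Complex.norm_exp, Complex.re_ofReal_mul]
        exact Real.tendsto_exp_atBot.comp (tendsto_id.atTop_mul_const_of_neg hlt)
      simpa using (h2.mul h1).const_mul (c j)
  have hsum := tendsto_finsetSum Finset.univ fun j _ => hterm j
  rw [Finset.sum_ite_eq' Finset.univ j₀ (fun _ => c j₀), if_pos (Finset.mem_univ _)] at hsum
  refine hj₀ (tendsto_nhds_unique hsum ?_)
  refine tendsto_const_nhds.congr' ?_
  filter_upwards [eventually_gt_atTop 0] with t ht
  rw [← Finset.sum_mul, h _ (mul_ne_zero (by exact_mod_cast ht.ne') hu0), zero_mul]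

/-- A trigonometric polynomial that vanishes on an infinite subset of a circle is zero. -/
theorem trigPolynomial_eq_zero {N : Type*} [Fintype N] (p : N → Plane)
    (hp : Function.Injective p) (c : N → ℂ) (x₀ : Plane) (r : ℝ) (T : Set Plane)
    (hT : (T ∩ Metric.sphere x₀ r).Infinite)
    (h : ∀ x ∈ T, ∑ j, c j * Complex.exp (Complex.I * (inner ℝ (p j) x : ℝ)) = 0) : c = 0 := by
  have hr : 0 < r := by
    by_contra! hr
    refine hT (Set.Finite.subset (Set.finite_singleton x₀) fun x hx => ?_)
    have := hx.2
    rw [Metric.mem_sphere] at this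
    exact dist_le_zero.1 (this.le.trans hr)
  have hrC : (r : ℂ) ≠ 0 := by exact_mod_cast hr.ne'
  -- The circle is carried to the unit circle, where complex conjugation is inversion.
  let g : Plane → ℂ := fun x => toComplex (x - x₀) / r
  have hg : Function.Injective g := by
    intro x y hxy
    have := toComplex_injective ((div_left_inj' hrC).1 hxy)
    simpa using this
  have hgn : ∀ x ∈ Metric.sphere x₀ r, ‖g x‖ = 1 := by
    intro x hx
    rw [mem_sphere_iff_norm] at hx
    simp only [g, norm_div, norm_toComplex, Complex.norm_real, Real.norm_of_nonneg hr.le, hx]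
    exact div_self hr.ne'
  -- The phases at the centre go into the coefficients. The factor `r / 2` in `p'` combines the
  -- radius with the half in `inner_eq_toComplex`.
  let c' : N → ℂ := fun j => c j * Complex.exp (Complex.I * (inner ℝ (p j) x₀ : ℝ))
  let p' : N → ℂ := fun j => toComplex (p j) * (r / 2)
  have hp' : Function.Injective p' := by
    intro i j hij
    exact hp (toComplex_injective (mul_right_cancel₀ (by simpa using hr.ne') hij))
  let f : ℂ → ℂ := fun z => ∑ j, c' j * Complex.exp (Complex.I *
      ((starRingEnd ℂ) (p' j) * z + p' j * z⁻¹))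
  have hfz : ∀ z ∈ g '' (T ∩ Metric.sphere x₀ r), f z = 0 := by
    rintro _ ⟨x, hx, rfl⟩
    have hinv : (g x)⁻¹ = (starRingEnd ℂ) (g x) := Complex.inv_eq_conj (hgn x hx.2)
    rw [← h x hx.1]
    refine Finset.sum_congr rfl fun j _ => ?_
    simp only [c', mul_assoc]
    rw [← Complex.exp_add]
    congr 2
    have h1 : (inner ℝ (p j) x : ℝ) = inner ℝ (p j) x₀ + inner ℝ (p j) (x - x₀) := by
      rw [← inner_add_right, add_sub_cancel]
    rw [h1, hinv, Complex.ofReal_add, inner_eq_toComplex (p j) (x - x₀)]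
    simp only [p', g, map_mul, map_div₀, Complex.conj_ofReal, map_ofNat]
    field_simp
  have hcomp : IsCompact (Metric.sphere (0 : ℂ) 1) := isCompact_sphere _ _
  -- Compactness gives an accumulation point of zeros on the unit circle, inside the connected
  -- domain of analyticity.
  obtain ⟨z₀, hz₀, hacc⟩ := (hT.image hg.injOn).exists_accPt_of_subset_isCompact hcomp
    (by rintro _ ⟨x, hx, rfl⟩; simpa using hgn x hx.2)
  have hz0 : z₀ ≠ 0 := by rintro rfl; simp at hz₀
  have hf : AnalyticOnNhd ℂ f {0}ᶜ := by
    apply DifferentiableOn.analyticOnNhd _ isOpen_compl_singleton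
    intro z hz
    have hz' : z ≠ 0 := hz
    apply DifferentiableAt.differentiableWithinAt
    simp only [f]
    fun_prop (disch := assumption)
  have hconn : IsPreconnected ({0}ᶜ : Set ℂ) :=
    (isConnected_compl_singleton_of_one_lt_rank (by simp) 0).isPreconnected
  have hzero := hf.eqOn_zero_of_preconnected_of_frequently_eq_zero hconn hz0
    ((accPt_iff_frequently_nhdsNE.1 hacc).mono fun z hz => hfz z hz)
  have hc' := exp_sum_eq_zero p' hp' c' fun z hz => hzero hz
  funext j
  have := congrFun hc' j
  simpa [c', Complex.exp_ne_zero] using this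

end CircleUniqueness

/-! ### Multiplication operators and a Hilbert parametrization of the Sobolev space. -/

section Multiplication

theorem norm_sq_eq_integral {X : Type*} [MeasurableSpace X] {μ : Measure X} (f : Lp C2 2 μ) :
    ‖f‖ ^ 2 = ∫ x, ‖f x‖ ^ 2 ∂μ := by
  rw [norm_sq_eq_re_inner (𝕜 := ℂ) f, L2.inner_def, ← integral_re (L2.integrable_inner f f)]
  refine integral_congr_ae (Eventually.of_forall fun x => ?_)
  exact (norm_sq_eq_re_inner (𝕜 := ℂ) (f x)).symm

theorem memLp_smul_of_bounded {b : Plane → ℝ} (hb : Measurable b) {C : ℝ} (hC : ∀ ξ, |b ξ| ≤ C)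
    (w : Spinors) : MemLp (fun ξ => (b ξ : ℂ) • w ξ) 2 volume := by
  refine MemLp.of_le_mul (c := C) (Lp.memLp w) ?_ (Eventually.of_forall fun ξ => ?_)
  · exact (Complex.measurable_ofReal.comp hb).aestronglyMeasurable.smul (Lp.aestronglyMeasurable w)
  · rw [norm_smul, Complex.norm_real]
    exact mul_le_mul_of_nonneg_right (hC ξ) (norm_nonneg _)

/-- The multiplication by a bounded measurable function. -/
def mulOp (b : Plane → ℝ) (hb : Measurable b) (C : ℝ) (hC : ∀ ξ, |b ξ| ≤ C) :
    Spinors →L[ℂ] Spinors :=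
  LinearMap.mkContinuous
    { toFun := fun w => (memLp_smul_of_bounded hb hC w).toLp
      map_add' := fun v w => by
        apply Lp.ext
        filter_upwards [(memLp_smul_of_bounded hb hC (v + w)).coeFn_toLp,
          (memLp_smul_of_bounded hb hC v).coeFn_toLp, (memLp_smul_of_bounded hb hC w).coeFn_toLp,
          Lp.coeFn_add v w, Lp.coeFn_add (memLp_smul_of_bounded hb hC v).toLp
            (memLp_smul_of_bounded hb hC w).toLp] with ξ h1 h2 h3 h4 h5
        rw [h1, h4, h5, Pi.add_apply, Pi.add_apply, h2, h3, smul_add]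
      map_smul' := fun k w => by
        apply Lp.ext
        filter_upwards [(memLp_smul_of_bounded hb hC (k • w)).coeFn_toLp,
          (memLp_smul_of_bounded hb hC w).coeFn_toLp,
          Lp.coeFn_smul k w, Lp.coeFn_smul k (memLp_smul_of_bounded hb hC w).toLp]
          with ξ h1 h2 h3 h4
        rw [h1, h3, RingHom.id_apply, h4, Pi.smul_apply, Pi.smul_apply, h2, smul_comm] }
    C (fun w => by
      refine Lp.norm_le_mul_norm_of_ae_le_mul ?_
      filter_upwards [(memLp_smul_of_bounded hb hC w).coeFn_toLp] with ξ h1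
      change ‖((memLp_smul_of_bounded hb hC w).toLp : Plane → C2) ξ‖ ≤ _
      rw [h1, norm_smul, Complex.norm_real]
      exact mul_le_mul_of_nonneg_right (hC ξ) (norm_nonneg _))

theorem coeFn_mulOp (b : Plane → ℝ) (hb : Measurable b) (C : ℝ) (hC : ∀ ξ, |b ξ| ≤ C)
    (w : Spinors) : mulOp b hb C hC w =ᵐ[volume] fun ξ => (b ξ : ℂ) • w ξ :=
  (memLp_smul_of_bounded hb hC w).coeFn_toLp

/-- The reciprocal weight. -/
def weightInv (ξ : Plane) : ℝ := (1 + 2 * Real.pi * ‖ξ‖)⁻¹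

theorem weightInv_pos (ξ : Plane) : 0 < weightInv ξ := by
  unfold weightInv; positivity

theorem measurable_weightInv : Measurable weightInv := by
  unfold weightInv; fun_prop

theorem abs_weightInv_le (ξ : Plane) : |weightInv ξ| ≤ 1 := by
  rw [abs_of_pos (weightInv_pos ξ)]
  apply inv_le_one_of_one_le₀
  have : 0 ≤ 2 * Real.pi * ‖ξ‖ := by positivity
  linarith

theorem abs_weight_mul_weightInv_le (ξ : Plane) : |2 * Real.pi * ‖ξ‖ * weightInv ξ| ≤ 1 := by
  have h : 0 ≤ 2 * Real.pi * ‖ξ‖ := by positivity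
  rw [abs_of_nonneg (mul_nonneg h (weightInv_pos ξ).le), weightInv, ← div_eq_mul_inv,
    div_le_one (by positivity)]
  linarith

theorem measurable_weight_mul_weightInv :
    Measurable fun ξ : Plane => 2 * Real.pi * ‖ξ‖ * weightInv ξ := by
  have := measurable_weightInv
  fun_prop

/-- The division by the weight. -/
def divWeight : Spinors →L[ℂ] Spinors := mulOp weightInv measurable_weightInv 1 abs_weightInv_le

/-- The gradient part of the division by the weight. -/
def gradWeight : Spinors →L[ℂ] Spinors :=
  mulOp _ measurable_weight_mul_weightInv 1 abs_weight_mul_weightInv_le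

theorem coeFn_divWeight (w : Spinors) :
    divWeight w =ᵐ[volume] fun ξ => (weightInv ξ : ℂ) • w ξ := coeFn_mulOp _ _ _ _ _

theorem coeFn_gradWeight (w : Spinors) : gradWeight w =ᵐ[volume]
    fun ξ => ((2 * Real.pi * ‖ξ‖ * weightInv ξ : ℝ) : ℂ) • w ξ := coeFn_mulOp _ _ _ _ _

/-- The inverse Fourier transform as a continuous linear map. -/
def fourierInvL : Spinors →L[ℂ] Spinors :=
  ((Lp.fourierTransformₗᵢ Plane C2).symm.toContinuousLinearEquiv : Spinors →L[ℂ] Spinors)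

theorem fourier_fourierInvL (w : Spinors) : (𝓕 (fourierInvL w) : Spinors) = w :=
  (Lp.fourierTransformₗᵢ Plane C2).apply_symm_apply w

/-- The parametrization of the Sobolev space by the square-integrable spinors. -/
def lift : Spinors →L[ℂ] H1 :=
  ((fourierInvL.comp divWeight).prod gradWeight).codRestrict H1 fun w => by
    change (gradWeight w : Plane → C2) =ᵐ[volume] fun ξ =>
      ((2 * Real.pi * ‖ξ‖ : ℝ) : ℂ) • (𝓕 (fourierInvL (divWeight w)) : Spinors) ξ
    rw [fourier_fourierInvL]
    filter_upwards [coeFn_divWeight w, coeFn_gradWeight w] with ξ h1 h2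
    rw [h1, h2, smul_smul]
    push_cast
    rfl

theorem hat_lift (w : Spinors) : hat (lift w) = divWeight w := fourier_fourierInvL _

theorem lift_snd (w : Spinors) : (lift w).1.2 = gradWeight w := rfl

theorem H1_snd (F : H1) : (F.1.2 : Plane → C2) =ᵐ[volume]
    fun ξ => ((2 * Real.pi * ‖ξ‖ : ℝ) : ℂ) • hat F ξ := F.2

theorem H1_ext {F G : H1} (h : hat F = hat G) : F = G := by
  have h1 : F.1.1 = G.1.1 := (Lp.fourierTransformₗᵢ Plane C2).injective h
  refine Subtype.ext (Prod.ext h1 (Lp.ext ?_))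
  filter_upwards [H1_snd F, H1_snd G] with ξ a b
  rw [a, b, h]

/-- The Sobolev space carries a maximum norm, which is not Hilbertian. Pulling the problem back
along `lift` makes weak compactness available; the preimage of `F` is `(1 + |2πξ|)` times its
transform. -/
theorem lift_surjective : Function.Surjective lift := by
  intro F
  refine ⟨hat F + F.1.2, H1_ext ?_⟩
  rw [hat_lift]
  apply Lp.ext
  filter_upwards [coeFn_divWeight (hat F + F.1.2), H1_snd F, Lp.coeFn_add (hat F) F.1.2]
    with ξ h1 h2 h3
  rw [h1, h3, Pi.add_apply, h2]
  have : hat F ξ + ((2 * Real.pi * ‖ξ‖ : ℝ) : ℂ) • hat F ξ =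
      ((1 + 2 * Real.pi * ‖ξ‖ : ℝ) : ℂ) • hat F ξ := by
    rw [Complex.ofReal_add, add_smul, Complex.ofReal_one, one_smul]
  rw [this, smul_smul, ← Complex.ofReal_mul, weightInv, inv_mul_cancel₀ (by positivity),
    Complex.ofReal_one, one_smul]

theorem lift_fst_injective : Function.Injective fun w : Spinors => (lift w).1.1 := by
  intro v w h
  have h1 : divWeight v = divWeight w := by
    rw [← hat_lift, ← hat_lift]
    exact congrArg (fun f : Spinors => (𝓕 f : Spinors)) h
  apply Lp.ext
  filter_upwards [coeFn_divWeight v, coeFn_divWeight w] with ξ h2 h3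
  rw [h1, h3] at h2
  exact (smul_right_injective C2 (by exact_mod_cast (weightInv_pos ξ).ne') h2).symm

theorem norm_fst_eq (F : H1) : ‖F.1.1‖ = ‖hat F‖ :=
  ((Lp.fourierTransformₗᵢ Plane C2).norm_map F.1.1).symm

theorem inner_fst_eq (F G : H1) : ⟪F.1.1, G.1.1⟫_ℂ = ⟪hat F, hat G⟫_ℂ :=
  ((Lp.fourierTransformₗᵢ Plane C2).inner_map_map F.1.1 G.1.1).symm

theorem norm_H1_le (F : H1) : ‖F‖ ≤ ‖hat F‖ + ‖F.1.2‖ := by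
  change ‖F.1‖ ≤ _
  rw [Prod.norm_def, norm_fst_eq]
  exact max_le (le_add_of_nonneg_right (norm_nonneg _)) (le_add_of_nonneg_left (norm_nonneg _))

theorem hat_sub (F G : H1) : hat (F - G) = hat F - hat G :=
  (Lp.fourierTransformₗᵢ Plane C2).map_sub F.1.1 G.1.1

theorem hat_schwartzToH1 (φ : 𝓢(Plane, C2)) : hat (schwartzToH1 φ) = (𝓕 φ).toLp 2 volume :=
  SchwartzMap.toLp_fourier_eq φ

/-- The Sobolev norm of a difference supported in a ball is controlled by the `L²`-norm. -/
theorem norm_H1_le_of_support {F : H1} {R : ℝ} (_hR : 0 ≤ R)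
    (hF : ∀ᵐ ξ, R < ‖ξ‖ → hat F ξ = 0) :
    ‖F‖ ≤ (1 + 2 * Real.pi * R) * ‖hat F‖ := by
  have h : ‖F.1.2‖ ≤ (2 * Real.pi * R) * ‖hat F‖ := by
    refine Lp.norm_le_mul_norm_of_ae_le_mul ?_
    filter_upwards [H1_snd F, hF] with ξ h1 h2
    rw [h1, norm_smul, Complex.norm_real, Real.norm_of_nonneg (by positivity)]
    by_cases h3 : R < ‖ξ‖
    · rw [h2 h3]; simp
    · have := not_lt.1 h3
      gcongr
  linarith [norm_H1_le F]

end Multiplication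

/-! ### Frequency cut-off and density of Schwartz spinors. -/

section Density

/-- Elements of the Sobolev space with bounded frequencies are limits of Schwartz spinors with
uniformly bounded frequencies. -/
theorem exists_schwartz_tendsto {F : H1} {R : ℝ} (hR : 0 < R)
    (hF : ∀ᵐ ξ, R < ‖ξ‖ → hat F ξ = 0) :
    ∃ φ : ℕ → 𝓢(Plane, C2), (∀ n ξ, 2 * R < ‖ξ‖ → 𝓕 (φ n) ξ = 0) ∧
      Tendsto (fun n => schwartzToH1 (φ n)) atTop (𝓝 F) := by
  have hdense : DenseRange (SchwartzMap.toLpCLM ℝ C2 2 (volume : Measure Plane)) :=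
    SchwartzMap.denseRange_toLpCLM ENNReal.ofNat_ne_top
  obtain ⟨s, hs, hlim⟩ := mem_closure_iff_seq_limit.1 (hdense (hat F))
  choose ψ hψ using hs
  -- The bump is one where `hat F` lives, so multiplying by it does not increase the `L²`-distance
  -- to `hat F`. It also keeps frequencies within `2 R`, where `L²`-convergence implies Sobolev
  -- convergence.
  let η : ContDiffBump (0 : Plane) := ⟨R, 2 * R, hR, by linarith⟩
  have hη : Function.HasTemperateGrowth (fun ξ : Plane => η ξ) :=
    η.hasCompactSupport.hasTemperateGrowth η.contDiff
  let χ : ℕ → 𝓢(Plane, C2) := fun n => smulLeftCLM C2 (fun ξ => η ξ) (ψ n)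
  have hχ : ∀ n ξ, χ n ξ = η ξ • ψ n ξ := fun n ξ => smulLeftCLM_apply_apply hη (ψ n) ξ
  have hsupp : ∀ n ξ, 2 * R < ‖ξ‖ → χ n ξ = 0 := by
    intro n ξ h
    rw [hχ, η.zero_of_le_dist (by rw [dist_zero_right]; exact h.le), zero_smul]
  have hfour : ∀ n, 𝓕 (𝓕⁻ (χ n)) = χ n := fun n => FourierTransform.fourier_fourierInv_eq (χ n)
  refine ⟨fun n => 𝓕⁻ (χ n), fun n ξ h => by rw [hfour]; exact hsupp n ξ h, ?_⟩
  have hhat : ∀ n, hat (schwartzToH1 (𝓕⁻ (χ n))) = (χ n).toLp 2 volume := fun n => by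
    rw [hat_schwartzToH1, hfour]
  rw [tendsto_iff_norm_sub_tendsto_zero]
  have hz := (tendsto_iff_norm_sub_tendsto_zero.1 hlim).const_mul (1 + 2 * Real.pi * (2 * R))
  rw [mul_zero] at hz
  refine squeeze_zero (fun n => norm_nonneg _) (fun n => ?_) hz
  have hcoe : hat (schwartzToH1 (𝓕⁻ (χ n)) - F) =ᵐ[volume] fun ξ => χ n ξ - hat F ξ := by
    rw [hat_sub, hhat]
    filter_upwards [Lp.coeFn_sub ((χ n).toLp 2 volume) (hat F), (χ n).coeFn_toLp 2 volume]
      with ξ h1 h2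
    rw [h1, Pi.sub_apply, h2]
  refine (norm_H1_le_of_support (R := 2 * R) (by positivity) ?_).trans ?_
  · filter_upwards [hcoe, hF] with ξ h1 h2 h3
    rw [h1, hsupp n ξ h3, h2 (by linarith), sub_zero]
  · refine mul_le_mul_of_nonneg_left ?_ (by positivity)
    refine Lp.norm_le_norm_of_ae_le ?_
    filter_upwards [hcoe, hF, Lp.coeFn_sub (s n) (hat F), (ψ n).coeFn_toLp 2 volume]
      with ξ h1 h2 h3 h4
    have h5 : s n ξ = ψ n ξ := by rw [← hψ n]; exact h4
    rw [h1, h3, Pi.sub_apply, h5, hχ]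
    by_cases h : R < ‖ξ‖
    · rw [h2 h, sub_zero, sub_zero, norm_smul, Real.norm_of_nonneg η.nonneg]
      exact mul_le_of_le_one_left (norm_nonneg _) η.le_one
    · rw [η.one_of_mem_closedBall (by simpa using not_lt.1 h), one_smul]

/-- The sharp frequency cut-off. -/
def cutoffFun (R : ℝ) : Plane → ℝ := (Metric.closedBall 0 R).indicator 1

theorem measurable_cutoffFun (R : ℝ) : Measurable (cutoffFun R) :=
  measurable_one.indicator measurableSet_closedBall

theorem abs_cutoffFun_le (R : ℝ) (ξ : Plane) : |cutoffFun R ξ| ≤ 1 := by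
  unfold cutoffFun
  by_cases h : ξ ∈ Metric.closedBall (0 : Plane) R <;> simp [h]

theorem cutoffFun_of_lt {R : ℝ} {ξ : Plane} (h : R < ‖ξ‖) : cutoffFun R ξ = 0 := by
  simp [cutoffFun, h]

theorem cutoffFun_of_le {R : ℝ} {ξ : Plane} (h : ‖ξ‖ ≤ R) : cutoffFun R ξ = 1 := by
  simp [cutoffFun, h]

/-- The projection to the frequencies in a ball. -/
def cutoff (R : ℝ) : Spinors →L[ℂ] Spinors :=
  mulOp (cutoffFun R) (measurable_cutoffFun R) 1 (abs_cutoffFun_le R)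

theorem coeFn_cutoff (R : ℝ) (w : Spinors) :
    cutoff R w =ᵐ[volume] fun ξ => (cutoffFun R ξ : ℂ) • w ξ := coeFn_mulOp _ _ _ _ _

theorem hat_lift_cutoff (R : ℝ) (w : Spinors) :
    hat (lift (cutoff R w)) =ᵐ[volume] fun ξ => (cutoffFun R ξ : ℂ) • hat (lift w) ξ := by
  rw [hat_lift, hat_lift]
  filter_upwards [coeFn_divWeight (cutoff R w), coeFn_divWeight w, coeFn_cutoff R w] with ξ h1 h2 h3
  rw [h1, h2, h3, smul_comm]

theorem hat_lift_cutoff_support (R : ℝ) (w : Spinors) :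
    ∀ᵐ ξ, R < ‖ξ‖ → hat (lift (cutoff R w)) ξ = 0 := by
  filter_upwards [hat_lift_cutoff R w] with ξ h1 h2
  rw [h1, cutoffFun_of_lt h2]
  simp

theorem tendsto_cutoff (w : Spinors) : Tendsto (fun n : ℕ => cutoff n w) atTop (𝓝 w) := by
  rw [tendsto_iff_norm_sub_tendsto_zero]
  have h : Tendsto (fun n : ℕ => ‖cutoff n w - w‖ ^ 2) atTop (𝓝 0) := by
    simp only [norm_sq_eq_integral]
    have h1 : ∀ n : ℕ, (fun ξ => ‖(cutoff n w - w) ξ‖ ^ 2) =ᵐ[volume]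
        fun ξ => ‖(cutoffFun n ξ : ℂ) • w ξ - w ξ‖ ^ 2 := fun n => by
      filter_upwards [Lp.coeFn_sub (cutoff n w) w, coeFn_cutoff n w] with ξ h1 h2
      rw [h1, Pi.sub_apply, h2]
    have h2 : (0 : ℝ) = ∫ ξ : Plane, (0 : ℝ) := by simp
    rw [h2]
    refine tendsto_integral_of_dominated_convergence (fun ξ => ‖w ξ‖ ^ 2)
      (fun n => ((Lp.aestronglyMeasurable _).norm.pow 2))
      ((memLp_two_iff_integrable_sq_norm (Lp.aestronglyMeasurable w)).1 (Lp.memLp w)) ?_ ?_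
    · intro n
      filter_upwards [h1 n] with ξ h1
      rw [h1, Real.norm_of_nonneg (by positivity)]
      rcases le_or_gt ‖ξ‖ n with h | h
      · simp [cutoffFun_of_le h]
      · simp [cutoffFun_of_lt h]
    · filter_upwards [ae_all_iff.2 h1] with ξ h1
      refine tendsto_const_nhds.congr' ?_
      filter_upwards [eventually_ge_atTop ⌈‖ξ‖⌉₊] with n hn
      rw [h1 n, cutoffFun_of_le (Nat.ceil_le.1 hn)]
      simp
  have := h.sqrt
  simpa [Real.sqrt_sq] using this

/-- A sharp cut-off reduces to bounded frequencies. Density, with the bound below, identifies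
`trace` on Schwartz spinors. -/
theorem denseRange_schwartzToH1 : DenseRange schwartzToH1 := by
  intro F
  obtain ⟨w, rfl⟩ := lift_surjective F
  -- The shift by one keeps the radius positive.
  have h1 : ∀ n : ℕ, lift (cutoff (n + 1 : ℕ) w) ∈ closure (Set.range schwartzToH1) := by
    intro n
    obtain ⟨φ, -, hφ⟩ := exists_schwartz_tendsto (R := (n + 1 : ℕ)) (by positivity)
      (hat_lift_cutoff_support _ w)
    exact mem_closure_of_tendsto hφ (Eventually.of_forall fun k => ⟨φ k, rfl⟩)
  have h2 : Tendsto (fun n : ℕ => lift (cutoff (n + 1 : ℕ) w)) atTop (𝓝 (lift w)) :=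
    (lift.continuous.tendsto w).comp ((tendsto_cutoff w).comp (tendsto_add_atTop_nat 1))
  exact isClosed_closure.mem_of_tendsto h2 (Eventually.of_forall h1)

end Density

/-! ### Continuity of the trace operator. -/

theorem norm_sq_C2 (v : C2) : ‖v‖ ^ 2 = ‖v 0‖ ^ 2 + ‖v 1‖ ^ 2 := by
  rw [EuclideanSpace.norm_sq_eq, Fin.sum_univ_two]

theorem norm_sq_plane (v : Plane) : ‖v‖ ^ 2 = (v 0) ^ 2 + (v 1) ^ 2 := by
  rw [EuclideanSpace.norm_sq_eq, Fin.sum_univ_two]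
  simp

theorem integrable_norm_sq_schwartz {E : Type*} [NormedAddCommGroup E] [NormedSpace ℝ E]
    (μ : Measure Plane) [μ.HasTemperateGrowth] (φ : 𝓢(Plane, E)) :
    Integrable (fun x => ‖φ x‖ ^ 2) μ :=
  (memLp_two_iff_integrable_sq_norm φ.continuous.aestronglyMeasurable).1 (φ.memLp 2 μ)

theorem norm_toLp_sq (μ : Measure Plane) [μ.HasTemperateGrowth] (φ : 𝓢(Plane, C2)) :
    ‖φ.toLp 2 μ‖ ^ 2 = ∫ x, ‖φ x‖ ^ 2 ∂μ := by
  rw [norm_sq_eq_integral]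
  refine integral_congr_ae ?_
  filter_upwards [φ.coeFn_toLp 2 μ] with x hx
  rw [hx]

theorem integral_norm_sq_components (μ : Measure Plane) [μ.HasTemperateGrowth] (ψ : 𝓢(Plane, C2)) :
    ∫ x, ‖ψ x‖ ^ 2 ∂μ = ∫ x, ‖ψ x 0‖ ^ 2 ∂μ + ∫ x, ‖ψ x 1‖ ^ 2 ∂μ := by
  have h : ∀ i : Fin 2, Integrable (fun x => ‖ψ x i‖ ^ 2) μ := fun i =>
    integrable_norm_sq_schwartz μ (ψ.postcompCLM (EuclideanSpace.proj (𝕜 := ℂ) i))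
  rw [← integral_add (h 0) (h 1)]
  exact integral_congr_ae (Eventually.of_forall fun x => norm_sq_C2 _)

/-- The energy of a Schwartz spinor in terms of its Fourier transform. -/
theorem integral_norm_sq_lineDeriv (φ : 𝓢(Plane, C2)) :
    ∑ k : Fin 2, ∫ x, ‖(∂_{(EuclideanSpace.single k (1 : ℝ) : Plane)} φ : 𝓢(Plane, C2)) x‖ ^ 2 =
      ‖(schwartzToH1 φ).1.2‖ ^ 2 := by
  have h1 : ∀ k : Fin 2,
      ∫ x, ‖(∂_{(EuclideanSpace.single k (1 : ℝ) : Plane)} φ : 𝓢(Plane, C2)) x‖ ^ 2 =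
      ∫ ξ : Plane, (2 * Real.pi * ξ k) ^ 2 * ‖𝓕 φ ξ‖ ^ 2 := by
    intro k
    rw [← SchwartzMap.integral_norm_sq_fourier, SchwartzMap.fourier_lineDerivOp_eq]
    refine integral_congr_ae (Eventually.of_forall fun ξ => ?_)
    have hg : Function.HasTemperateGrowth
        (fun ξ : Plane => (inner ℝ ξ (EuclideanSpace.single k (1 : ℝ)) : ℝ)) :=
      ((innerSL ℝ).flip (EuclideanSpace.single k (1 : ℝ) : Plane)).hasTemperateGrowth
    simp only [smul_apply, smulLeftCLM_apply_apply hg, norm_smul, mul_pow]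
    rw [show (inner ℝ ξ (EuclideanSpace.single k (1 : ℝ)) : ℝ) = ξ k by
      simp [EuclideanSpace.inner_single_right]]
    simp [abs_of_pos Real.pi_pos]
    ring
  have hint : ∀ k : Fin 2, Integrable fun ξ : Plane => (2 * Real.pi * ξ k) ^ 2 * ‖𝓕 φ ξ‖ ^ 2 := by
    intro k
    refine Integrable.mono' (((memLp_two_iff_integrable_sq_norm
      (memLp_norm_smul (𝓕 φ)).1).1 (memLp_norm_smul (𝓕 φ)))) ?_ (Eventually.of_forall fun ξ => ?_)
    · exact (Continuous.aestronglyMeasurable (by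
        have := (𝓕 φ).continuous
        fun_prop))
    · rw [Real.norm_of_nonneg (by positivity), norm_smul, Complex.norm_real,
        Real.norm_of_nonneg (by positivity), mul_pow (2 * Real.pi * ‖ξ‖), mul_pow _ ‖ξ‖,
        mul_pow _ (ξ k)]
      have : (ξ k) ^ 2 ≤ ‖ξ‖ ^ 2 := by
        rw [← sq_abs]
        have := PiLp.norm_apply_le ξ k
        rw [Real.norm_eq_abs] at this
        gcongr
      gcongr
  rw [norm_sq_eq_integral, Fin.sum_univ_two, h1, h1, ← integral_add (hint 0) (hint 1)]
  refine integral_congr_ae ?_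
  filter_upwards [H1_snd (schwartzToH1 φ), (𝓕 φ).coeFn_toLp 2 volume] with ξ a b
  rw [a, hat_schwartzToH1, b, norm_smul, Complex.norm_real,
    Real.norm_of_nonneg (by positivity), mul_pow (2 * Real.pi * ‖ξ‖), mul_pow _ ‖ξ‖,
    norm_sq_plane]
  ring

namespace System

variable (D : System)

/-- The scalar form bound is applied to both components and summed. Only the `1` of the weight `1 +
|h|²` is kept, and `a` is replaced by one. -/
theorem integral_norm_sq_le : ∃ b : ℝ, 0 < b ∧ ∀ φ : 𝓢(Plane, C2),
    ‖φ.toLp 2 D.m‖ ^ 2 ≤ ‖(schwartzToH1 φ).1.2‖ ^ 2 + b * ‖φ.toLp 2 volume‖ ^ 2 := by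
  obtain ⟨a, ha0, ha1, b, hb, hab⟩ := D.formBound
  obtain ⟨C, hC⟩ := D.bounded_h
  refine ⟨b, hb, fun φ => ?_⟩
  let f : Fin 2 → 𝓢(Plane, ℂ) := fun i => φ.postcompCLM (EuclideanSpace.proj (𝕜 := ℂ) i)
  have hf : ∀ i x, f i x = φ x i := fun i x => rfl
  have hder : ∀ i k x, fderiv ℝ (f i) x (EuclideanSpace.single k 1) =
      (∂_{(EuclideanSpace.single k (1 : ℝ) : Plane)} φ : 𝓢(Plane, C2)) x i := by
    intro i k x
    rw [SchwartzMap.lineDerivOp_apply_eq_fderiv]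
    have h1 : HasFDerivAt (f i) (((EuclideanSpace.proj (𝕜 := ℂ) i :
        C2 →L[ℂ] ℂ).restrictScalars ℝ).comp (fderiv ℝ φ x)) x :=
      ((EuclideanSpace.proj (𝕜 := ℂ) i : C2 →L[ℂ] ℂ).restrictScalars ℝ).hasFDerivAt.comp x
        φ.differentiableAt.hasFDerivAt
    rw [h1.fderiv]
    rfl
  have hsq : ∀ i, Integrable (fun x => ‖f i x‖ ^ 2) D.m := fun i =>
    integrable_norm_sq_schwartz D.m (f i)
  have hkey : ∀ i, ∫ x, ‖φ x i‖ ^ 2 ∂D.m ≤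
      (∑ k : Fin 2, ∫ x, ‖(∂_{(EuclideanSpace.single k (1 : ℝ) : Plane)} φ : 𝓢(Plane, C2)) x i‖ ^ 2)
      + b * ∫ x, ‖φ x i‖ ^ 2 := by
    intro i
    have h1 := hab (f i)
    have h2 : ∫ x, ‖φ x i‖ ^ 2 ∂D.m ≤ ∫ x, (1 + |D.h x| ^ 2) * ‖f i x‖ ^ 2 ∂D.m := by
      refine integral_mono (hsq i) ?_ fun x => ?_
      · refine (hsq i).bdd_mul (c := 1 + C ^ 2) ?_ (Eventually.of_forall fun x => ?_)
        · have := D.measurable_h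
          exact (by fun_prop : Measurable fun x => 1 + |D.h x| ^ 2).aestronglyMeasurable
        · rw [Real.norm_of_nonneg (by positivity)]
          have := hC x
          gcongr
      · change ‖φ x i‖ ^ 2 ≤ (1 + |D.h x| ^ 2) * ‖φ x i‖ ^ 2
        nlinarith [mul_nonneg (sq_nonneg |D.h x|) (sq_nonneg ‖φ x i‖)]
    have hint : ∀ k : Fin 2, Integrable fun x : Plane =>
        ‖(∂_{(EuclideanSpace.single k (1 : ℝ) : Plane)} φ : 𝓢(Plane, C2)) x i‖ ^ 2 := fun k =>
      integrable_norm_sq_schwartz volume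
        ((∂_{(EuclideanSpace.single k (1 : ℝ) : Plane)} φ : 𝓢(Plane, C2)).postcompCLM
          (EuclideanSpace.proj (𝕜 := ℂ) i))
    rw [← integral_finsetSum _ fun k _ => hint k]
    simp only [hder] at h1
    have h3 : 0 ≤ ∫ x, ∑ k : Fin 2,
        ‖(∂_{(EuclideanSpace.single k (1 : ℝ) : Plane)} φ : 𝓢(Plane, C2)) x i‖ ^ 2 :=
      integral_nonneg fun x => Finset.sum_nonneg fun k _ => by positivity
    have h4 : ∫ x, ‖f i x‖ ^ 2 = ∫ x, ‖φ x i‖ ^ 2 := rfl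
    rw [h4] at h1
    nlinarith
  have hsplit := @integral_norm_sq_components
  rw [norm_toLp_sq, norm_toLp_sq, ← integral_norm_sq_lineDeriv, hsplit D.m, hsplit volume,
    Fin.sum_univ_two, hsplit volume, hsplit volume]
  have h0 := hkey 0
  have h1 := hkey 1
  rw [Fin.sum_univ_two] at h0 h1
  linarith

theorem exists_trace_bound : ∃ C : ℝ, ∀ φ : 𝓢(Plane, C2),
    ‖(SchwartzMap.toLpCLM ℂ C2 2 D.m : 𝓢(Plane, C2) →L[ℂ] Lp C2 2 D.m) φ‖ ≤
      C * ‖schwartzToH1 φ‖ := by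
  obtain ⟨b, hb, h⟩ := D.integral_norm_sq_le
  refine ⟨Real.sqrt (1 + b), fun φ => ?_⟩
  have h1 : ‖(schwartzToH1 φ).1.2‖ ≤ ‖schwartzToH1 φ‖ := le_max_right _ _
  have h2 : ‖φ.toLp 2 volume‖ ≤ ‖schwartzToH1 φ‖ := le_max_left _ _
  rw [SchwartzMap.toLpCLM_apply]
  refine le_of_sq_le_sq ?_ (by positivity)
  rw [mul_pow, Real.sq_sqrt (by positivity)]
  refine (h φ).trans ?_
  have h3 : ‖(schwartzToH1 φ).1.2‖ ^ 2 ≤ ‖schwartzToH1 φ‖ ^ 2 := by gcongr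
  have h4 : ‖φ.toLp 2 volume‖ ^ 2 ≤ ‖schwartzToH1 φ‖ ^ 2 := by gcongr
  nlinarith

theorem trace_schwartz (φ : 𝓢(Plane, C2)) : D.trace (schwartzToH1 φ) = φ.toLp 2 D.m :=
  LinearMap.extendOfNorm_eq denseRange_schwartzToH1 D.exists_trace_bound φ

end System

/-! ### The trace as an inverse Fourier integral. -/

section PlaneWave

/-- A plane wave, as a function of the frequency. -/
def wave (x ξ : Plane) : ℂ := Complex.exp (((2 * Real.pi * (inner ℝ ξ x : ℝ) : ℝ) : ℂ) * Complex.I)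

theorem norm_wave (x ξ : Plane) : ‖wave x ξ‖ = 1 := Complex.norm_exp_ofReal_mul_I _

theorem continuous_wave (x : Plane) : Continuous (wave x) := by
  unfold wave; fun_prop

theorem memLp_planeWave (R : ℝ) (x : Plane) (i : Fin 2) :
    MemLp ((Metric.closedBall (0 : Plane) R).indicator
      fun ξ => (starRingEnd ℂ (wave x ξ)) • (EuclideanSpace.single i 1 : C2)) 2 volume := by
  rw [memLp_indicator_iff_restrict measurableSet_closedBall]
  have : IsFiniteMeasure (volume.restrict (Metric.closedBall (0 : Plane) R)) :=
    ⟨by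
      rw [Measure.restrict_apply_univ]
      exact measure_closedBall_lt_top⟩
  refine MemLp.of_bound (C := 1) ?_ (Eventually.of_forall fun ξ => ?_)
  · have := continuous_wave x
    exact (by fun_prop : Continuous fun ξ =>
      (starRingEnd ℂ (wave x ξ)) • (EuclideanSpace.single i 1 : C2)).aestronglyMeasurable
  · rw [norm_smul, RCLike.norm_conj, norm_wave]
    simp

/-- The truncated plane wave as a square-integrable spinor. -/
def planeWave (R : ℝ) (x : Plane) (i : Fin 2) : Spinors := (memLp_planeWave R x i).toLp

/-- The conjugate in `planeWave` cancels the antilinearity of the first slot. Pointwise evaluation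
thereby becomes pairing with a fixed `L²` vector, which is weakly continuous. -/
theorem inner_planeWave (R : ℝ) (x : Plane) (i : Fin 2) (w : Spinors) :
    ⟪planeWave R x i, w⟫_ℂ = ∫ ξ in Metric.closedBall (0 : Plane) R, wave x ξ * w ξ i := by
  rw [L2.inner_def, ← integral_indicator measurableSet_closedBall]
  refine integral_congr_ae ?_
  filter_upwards [(memLp_planeWave R x i).coeFn_toLp] with ξ h
  rw [planeWave, h]
  by_cases hξ : ξ ∈ Metric.closedBall (0 : Plane) R
  · rw [Set.indicator_of_mem hξ, Set.indicator_of_mem hξ, inner_smul_left,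
      EuclideanSpace.inner_single_left]
    simp
  · rw [Set.indicator_of_notMem hξ, Set.indicator_of_notMem hξ, inner_zero_left]

theorem inner_planeWave_of_support {R : ℝ} {w : Spinors} (hw : ∀ᵐ ξ, R < ‖ξ‖ → w ξ = 0)
    (x : Plane) (i : Fin 2) : ⟪planeWave R x i, w⟫_ℂ = ∫ ξ, wave x ξ * w ξ i := by
  rw [inner_planeWave, ← integral_indicator measurableSet_closedBall]
  refine integral_congr_ae ?_
  filter_upwards [hw] with ξ h
  by_cases hξ : ξ ∈ Metric.closedBall (0 : Plane) R
  · rw [Set.indicator_of_mem hξ]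
  · rw [Set.indicator_of_notMem hξ, h (by simpa using hξ)]
    simp

theorem norm_planeWave_le (R : ℝ) (x : Plane) (i : Fin 2) :
    ‖planeWave R x i‖ ≤ Real.sqrt (volume.real (Metric.closedBall (0 : Plane) R)) := by
  apply Real.le_sqrt_of_sq_le
  rw [norm_sq_eq_integral, ← integral_indicator_one measurableSet_closedBall]
  refine le_of_eq (integral_congr_ae ?_)
  filter_upwards [(memLp_planeWave R x i).coeFn_toLp] with ξ h
  rw [planeWave, h]
  by_cases hξ : ξ ∈ Metric.closedBall (0 : Plane) R
  · rw [Set.indicator_of_mem hξ, Set.indicator_of_mem hξ, norm_smul, RCLike.norm_conj, norm_wave]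
    simp
  · rw [Set.indicator_of_notMem hξ, Set.indicator_of_notMem hξ]
    simp

/-- The trace of an element of the Sobolev space with bounded frequencies is given by the inverse
Fourier integral. -/
theorem System.trace_eq_integral (D : System) {F : H1} {R : ℝ} (hR : 0 < R)
    (hF : ∀ᵐ ξ, R < ‖ξ‖ → hat F ξ = 0) :
    ∀ᵐ x ∂D.m, ∀ i, D.trace F x i = ∫ ξ, wave x ξ * hat F ξ i := by
  obtain ⟨φ, hφ, hlim⟩ := exists_schwartz_tendsto hR hF
  have htr : Tendsto (fun n => (φ n).toLp 2 D.m) atTop (𝓝 (D.trace F)) := by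
    simp only [← D.trace_schwartz]
    exact (D.trace.continuous.tendsto F).comp hlim
  have hL : Tendsto (fun n => hat (schwartzToH1 (φ n))) atTop (𝓝 (hat F)) := by
    have hc : Continuous fun F : H1 => hat F :=
      (Lp.fourierTransformₗᵢ Plane C2).continuous.comp
        (continuous_fst.comp continuous_subtype_val)
    exact (hc.tendsto F).comp hlim
  -- All approximants have frequencies in the ball of radius `2 R`, so their values at every point
  -- `x` converge, even though `m` may be singular.
  have hpt : ∀ x i, Tendsto (fun n => φ n x i) atTop (𝓝 (∫ ξ, wave x ξ * hat F ξ i)) := by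
    intro x i
    rw [← inner_planeWave_of_support (R := 2 * R) (hF.mono fun ξ h h' => h (by linarith))]
    have h1 : ∀ n, φ n x i = ⟪planeWave (2 * R) x i, hat (schwartzToH1 (φ n))⟫_ℂ := by
      intro n
      have hcoe := (𝓕 (φ n)).coeFn_toLp 2 volume
      rw [inner_planeWave_of_support, hat_schwartzToH1]
      · have h2 : φ n x = ∫ ξ, wave x ξ • 𝓕 (φ n) ξ := by
          have h3 : φ n = 𝓕⁻ (𝓕 (φ n)) := (FourierTransform.fourierInv_fourier_eq (φ n)).symm
          conv_lhs => rw [h3, SchwartzMap.fourierInv_coe, Real.fourierInv_eq']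
          rfl
        have hi : Integrable fun ξ => wave x ξ • 𝓕 (φ n) ξ := by
          refine ((𝓕 (φ n)).integrable (μ := volume)).bdd_smul 1
            (continuous_wave x).aestronglyMeasurable (Eventually.of_forall fun ξ => ?_)
          exact (norm_wave x ξ).le
        have h4 := (EuclideanSpace.proj (𝕜 := ℂ) i : C2 →L[ℂ] ℂ).integral_comp_comm hi
        rw [h2]
        refine h4.symm.trans (integral_congr_ae ?_)
        filter_upwards [hcoe] with ξ h5
        rw [h5]
        rfl
      · rw [hat_schwartzToH1]
        filter_upwards [hcoe] with ξ h5 h6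
        rw [h5, hφ n ξ h6]
    simp only [h1]
    exact tendsto_const_nhds.inner hL
  -- Convergence in `L²(m)` gives convergence `m`-almost everywhere along a subsequence, which
  -- identifies the two limits.
  have hmeas := tendstoInMeasure_of_tendsto_Lp htr
  obtain ⟨ns, hmono, hns⟩ := hmeas.exists_seq_tendsto_ae
  filter_upwards [hns, ae_all_iff.2 fun n => (φ (ns n)).coeFn_toLp 2 D.m] with x h1 h3 i
  have h4 : Tendsto (fun n => φ (ns n) x i) atTop (𝓝 (D.trace F x i)) := by
    have := ((EuclideanSpace.proj (𝕜 := ℂ) i : C2 →L[ℂ] ℂ).continuous.tendsto _).comp h1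
    refine this.congr fun n => ?_
    simp only [Function.comp_apply, h3 n]
    rfl
  exact tendsto_nhds_unique h4 ((hpt x i).comp hmono.tendsto_atTop)

end PlaneWave

/-! ### Integral inequalities for spinors and the lower bound of the symbol. -/

theorem integral_norm_mul_le {X : Type*} [MeasurableSpace X] {μ : Measure X} (f g : Lp C2 2 μ) :
    ∫ x, ‖f x‖ * ‖g x‖ ∂μ ≤ ‖f‖ * ‖g‖ := by
  have hn : ∀ f : Lp C2 2 μ, ‖(Lp.memLp f).norm.toLp‖ = ‖f‖ := fun f => by
    rw [Lp.norm_toLp, eLpNorm_norm, Lp.norm_def]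
  have h := real_inner_le_norm (Lp.memLp f).norm.toLp (Lp.memLp g).norm.toLp
  rw [L2.inner_def, hn, hn] at h
  refine le_trans (le_of_eq (integral_congr_ae ?_)) h
  filter_upwards [(Lp.memLp f).norm.coeFn_toLp, (Lp.memLp g).norm.coeFn_toLp] with x h1 h2
  rw [h1, h2]
  simp [mul_comm]

theorem integrable_norm_mul {X : Type*} [MeasurableSpace X] {μ : Measure X} (f g : Lp C2 2 μ) :
    Integrable (fun x => ‖f x‖ * ‖g x‖) μ :=
  (Lp.memLp f).norm.integrable_mul (Lp.memLp g).norm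

theorem integrable_norm_sq {X : Type*} [MeasurableSpace X] {μ : Measure X} (f : Lp C2 2 μ) :
    Integrable (fun x => ‖f x‖ ^ 2) μ :=
  (memLp_two_iff_integrable_sq_norm (Lp.aestronglyMeasurable f)).1 (Lp.memLp f)

/-- Weak convergence passes to continuous linear functionals. -/
theorem tendsto_of_weakly {w : ℕ → Spinors}
    (hw : ∀ u, Tendsto (fun n => ⟪u, w n⟫_ℂ) atTop (𝓝 0)) (K : Spinors →L[ℂ] Spinors) (u : Spinors) :
    Tendsto (fun n => ⟪u, K (w n)⟫_ℂ) atTop (𝓝 0) := by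
  simpa only [ContinuousLinearMap.adjoint_inner_left] using hw (ContinuousLinearMap.adjoint K u)

section Symbol

/-- The sesquilinear form of the symbol. -/
theorem inner_symbol (A : Plane → ℂ) (p : Plane) (u v : C2) :
    (inner ℂ u (WithLp.toLp 2 ((symbol A p).mulVec (WithLp.ofLp v)) : C2) : ℂ) =
      (((‖p‖ ^ 2 : ℝ) : ℂ) * v 0 + A p * v 1) * (starRingEnd ℂ) (u 0) +
      ((starRingEnd ℂ) (A p) * v 0 + ((‖p‖ ^ 2 : ℝ) : ℂ) * v 1) * (starRingEnd ℂ) (u 1) := by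
  rw [EuclideanSpace.inner_eq_star_dotProduct]
  simp only [dotProduct, Matrix.mulVec, Fin.sum_univ_two, Pi.star_apply, symbol]
  simp

theorem inner_symbol_conj (A : Plane → ℂ) (p : Plane) (u v : C2) :
    (starRingEnd ℂ) (inner ℂ u (WithLp.toLp 2 ((symbol A p).mulVec (WithLp.ofLp v)) : C2) : ℂ) =
      inner ℂ v (WithLp.toLp 2 ((symbol A p).mulVec (WithLp.ofLp u)) : C2) := by
  rw [inner_symbol, inner_symbol]
  simp only [map_add, map_mul, Complex.conj_conj, Complex.conj_ofReal]
  ring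

/-- The off-diagonal entries contribute at least `-2 |A| |u₀| |u₁|`, hence at least `-|A| ‖u‖²`. -/
theorem lowerBand_mul_le (A : Plane → ℂ) (p : Plane) (u : C2) :
    lowerBand A p * ‖u‖ ^ 2 ≤
      (inner ℂ u (WithLp.toLp 2 ((symbol A p).mulVec (WithLp.ofLp u)) : C2) : ℂ).re := by
  have h1 : (inner ℂ u (WithLp.toLp 2 ((symbol A p).mulVec (WithLp.ofLp u)) : C2) : ℂ) =
      ((‖p‖ ^ 2 * ‖u‖ ^ 2 : ℝ) : ℂ) + (A p * u 1 * (starRingEnd ℂ) (u 0) +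
        (starRingEnd ℂ) (A p * u 1 * (starRingEnd ℂ) (u 0))) := by
    rw [inner_symbol, norm_sq_C2]
    push_cast
    rw [← Complex.mul_conj', ← Complex.mul_conj']
    simp only [map_mul, Complex.conj_conj]
    ring
  rw [h1, Complex.add_conj, Complex.add_re, Complex.ofReal_re, Complex.ofReal_re, lowerBand]
  have h2 : -(‖A p‖ * ‖u 1‖ * ‖u 0‖) ≤ (A p * u 1 * (starRingEnd ℂ) (u 0)).re := by
    have := Complex.abs_re_le_norm (A p * u 1 * (starRingEnd ℂ) (u 0))
    rw [norm_mul, norm_mul, RCLike.norm_conj] at this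
    exact (abs_le.1 this).1
  rw [norm_sq_C2]
  nlinarith [mul_nonneg (norm_nonneg (A p)) (sq_nonneg (‖u 0‖ - ‖u 1‖))]

end Symbol

/-! ### Form estimates, compactness, and reduction to the variational scheme. -/

namespace System

variable (D : System)

/-- A number strictly between the upper limit and one leaves the share `1 - θ` of the kinetic energy
for coercivity. The exceptional compact set is enlarged by the origin, where the quotient carries no
information, and is absorbed in `C`. -/
theorem exists_norm_A_le_lt : ∃ θ : ℝ, θ < 1 ∧ ∃ C : ℝ, 0 ≤ C ∧ ∀ p, ‖D.A p‖ ≤ C + θ * ‖p‖ ^ 2 := by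
  obtain ⟨t, ht1, ht2⟩ := exists_between D.limsup_A
  have h1 := eventually_lt_of_limsup_lt ht1
  rw [Filter.Eventually, mem_cocompact] at h1
  obtain ⟨K, hK, hs⟩ := h1
  obtain ⟨C, hC⟩ := (hK.union (isCompact_singleton (x := (0 : Plane)))).exists_bound_of_continuousOn
    D.continuous_A.continuousOn
  have htop : t ≠ ⊤ := (ht2.trans ENNReal.one_lt_top).ne
  refine ⟨t.toReal, by simpa using (ENNReal.toReal_lt_toReal htop ENNReal.one_ne_top).2 ht2,
    max C 0, le_max_right _ _, fun p => ?_⟩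
  by_cases hp : p ∈ K ∪ {0}
  · have := hC p hp
    nlinarith [le_max_left C 0, mul_nonneg (ENNReal.toReal_nonneg (a := t)) (sq_nonneg ‖p‖)]
  · rw [Set.mem_union, not_or] at hp
    have h2 : ENNReal.ofReal (‖D.A p‖ / ‖p‖ ^ 2) < t := hs hp.1
    have hp0 : 0 < ‖p‖ := norm_pos_iff.2 hp.2
    rw [ENNReal.ofReal_lt_iff_lt_toReal (by positivity) htop, div_lt_iff₀ (by positivity)] at h2
    linarith [le_max_right C 0]

theorem kappa_le (p : Plane) : D.kappa ≤ lowerBand D.A p := by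
  obtain ⟨C, hC⟩ := D.exists_norm_A_le
  refine ciInf_le ⟨-C, ?_⟩ p
  rintro _ ⟨p, rfl⟩
  simp only [lowerBand]
  linarith [hC p]

theorem freeForm_conj (G F : H1) : (starRingEnd ℂ) (D.freeForm G F) = D.freeForm F G := by
  rw [freeForm, ← integral_conj]
  exact integral_congr_ae (Eventually.of_forall fun ξ => inner_symbol_conj _ _ _ _)

theorem nuForm_conj (G F : H1) : (starRingEnd ℂ) (D.nuForm G F) = D.nuForm F G := by
  rw [nuForm, ← integral_conj]
  refine integral_congr_ae (Eventually.of_forall fun x => ?_)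
  simp only [map_mul, Complex.conj_ofReal, inner_conj_symm]

theorem form_conj (G F : H1) : (starRingEnd ℂ) (D.form G F) = D.form F G := by
  rw [form, map_add, freeForm_conj, nuForm_conj, form]

theorem norm_freeForm_le : ∃ M : ℝ, 0 ≤ M ∧ ∀ G F : H1, ‖D.freeForm G F‖ ≤ M * ‖G‖ * ‖F‖ := by
  obtain ⟨C, hC⟩ := D.exists_norm_A_le
  refine ⟨4 * |C| + 8, by positivity, fun G F => ?_⟩
  have i1 := integrable_norm_mul (hat G) (hat F)
  have i2 := integrable_norm_mul G.1.2 F.1.2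
  have h1 : ‖D.freeForm G F‖ ≤ ∫ ξ, (4 * |C| * (‖hat G ξ‖ * ‖hat F ξ‖) +
      8 * (‖G.1.2 ξ‖ * ‖F.1.2 ξ‖)) := by
    refine norm_integral_le_of_norm_le ((i1.const_mul _).add (i2.const_mul _)) ?_
    filter_upwards [H1_snd G, H1_snd F] with ξ a b
    have hk : ‖(2 * Real.pi) • ξ‖ = 2 * Real.pi * ‖ξ‖ := by
      rw [norm_smul, Real.norm_of_nonneg (by positivity)]
    have hk2 : ‖((2 * Real.pi * ‖ξ‖ : ℝ) : ℂ)‖ = 2 * Real.pi * ‖ξ‖ := by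
      rw [Complex.norm_real, Real.norm_of_nonneg (by positivity)]
    refine (D.norm_symbol_le (hC _) _ _).trans (le_of_eq ?_)
    rw [a, b, hk, norm_smul _ (hat G ξ), norm_smul _ (hat F ξ), hk2]
    ring
  rw [integral_add (i1.const_mul _) (i2.const_mul _), integral_const_mul, integral_const_mul] at h1
  have h2 := integral_norm_mul_le (hat G) (hat F)
  have h3 := integral_norm_mul_le G.1.2 F.1.2
  have n1 : ∀ F : H1, ‖hat F‖ ≤ ‖F‖ := fun F => by
    rw [← norm_fst_eq]; exact le_max_left _ _
  have n2 : ∀ F : H1, ‖F.1.2‖ ≤ ‖F‖ := fun F => le_max_right _ _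
  have h4 : ‖hat G‖ * ‖hat F‖ ≤ ‖G‖ * ‖F‖ := by gcongr <;> apply n1
  have h5 : ‖G.1.2‖ * ‖F.1.2‖ ≤ ‖G‖ * ‖F‖ := by gcongr <;> apply n2
  nlinarith [abs_nonneg C]

theorem norm_nuForm_le : ∃ M : ℝ, 0 ≤ M ∧ ∀ G F : H1,
    ‖D.nuForm G F‖ ≤ M * ‖D.trace G‖ * ‖D.trace F‖ := by
  obtain ⟨C, hC⟩ := D.bounded_h
  have hC0 : 0 ≤ C := (abs_nonneg _).trans (hC 0)
  refine ⟨C, hC0, fun G F => ?_⟩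
  have h1 : ‖D.nuForm G F‖ ≤ ∫ x, C * (‖D.trace G x‖ * ‖D.trace F x‖) ∂D.m := by
    refine norm_integral_le_of_norm_le ((integrable_norm_mul _ _).const_mul _)
      (Eventually.of_forall fun x => ?_)
    rw [norm_mul, Complex.norm_real]
    exact mul_le_mul (hC x) (norm_inner_le_norm _ _) (norm_nonneg _) hC0
  rw [integral_const_mul] at h1
  have := integral_norm_mul_le (D.trace G) (D.trace F)
  nlinarith

theorem le_freeForm {F : H1} {t : ℝ}
    (h : ∀ᵐ ξ : Plane, hat F ξ ≠ 0 → t ≤ lowerBand D.A ((2 * Real.pi) • ξ)) :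
    t * ‖F.1.1‖ ^ 2 ≤ (D.freeForm F F).re := by
  rw [norm_fst_eq, norm_sq_eq_integral, ← integral_const_mul]
  have h1 : (D.freeForm F F).re = ∫ ξ, (D.freeIntegrand F F ξ).re :=
    (integral_re (D.integrable_freeIntegrand F F)).symm
  rw [h1]
  refine integral_mono_ae ((integrable_norm_sq _).const_mul _)
    (D.integrable_freeIntegrand F F).re ?_
  filter_upwards [h] with ξ h2
  refine le_trans ?_ (lowerBand_mul_le D.A ((2 * Real.pi) • ξ) (hat F ξ))
  by_cases h3 : hat F ξ = 0
  · simp [h3]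
  · have := h2 h3
    gcongr

theorem le_freeForm_coercive {θ C : ℝ} (hC : ∀ p, ‖D.A p‖ ≤ C + θ * ‖p‖ ^ 2) (F : H1) :
    (1 - θ) * ‖F.1.2‖ ^ 2 - C * ‖F.1.1‖ ^ 2 ≤ (D.freeForm F F).re := by
  rw [norm_fst_eq, norm_sq_eq_integral, norm_sq_eq_integral, ← integral_const_mul,
    ← integral_const_mul, ← integral_sub ((integrable_norm_sq _).const_mul _)
    ((integrable_norm_sq _).const_mul _)]
  have h1 : (D.freeForm F F).re = ∫ ξ, (D.freeIntegrand F F ξ).re :=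
    (integral_re (D.integrable_freeIntegrand F F)).symm
  rw [h1]
  refine integral_mono_ae (((integrable_norm_sq _).const_mul _).sub
    ((integrable_norm_sq _).const_mul _)) (D.integrable_freeIntegrand F F).re ?_
  filter_upwards [H1_snd F] with ξ a
  refine le_trans ?_ (lowerBand_mul_le D.A ((2 * Real.pi) • ξ) (hat F ξ))
  have hk : ‖(2 * Real.pi) • ξ‖ = 2 * Real.pi * ‖ξ‖ := by
    rw [norm_smul, Real.norm_of_nonneg (by positivity)]
  have := hC ((2 * Real.pi) • ξ)
  rw [hk] at this
  rw [a, norm_smul, Complex.norm_real, Real.norm_of_nonneg (by positivity), lowerBand, hk]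
  have h2 := mul_le_mul_of_nonneg_right this (sq_nonneg ‖hat F ξ‖)
  nlinarith

/-- This is the compactness behind the theorem. At bounded frequencies the trace at a point is a
pairing with a fixed vector, so it tends to zero; the bound is uniform in the point and `m` is
finite, so dominated convergence applies. -/
theorem tendsto_trace_cutoff {R : ℝ} (hR : 0 < R) {w : ℕ → Spinors} {B : ℝ} (hB : ∀ n, ‖w n‖ ≤ B)
    (hw : ∀ u, Tendsto (fun n => ⟪u, w n⟫_ℂ) atTop (𝓝 0)) :
    Tendsto (fun n => ‖D.trace (lift (cutoff R (w n)))‖) atTop (𝓝 0) := by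
  let K : Spinors →L[ℂ] Spinors := divWeight.comp (cutoff R)
  have hK : ∀ n, hat (lift (cutoff R (w n))) = K (w n) := fun n => hat_lift _
  have hform : ∀ᵐ x ∂D.m, ∀ n i, D.trace (lift (cutoff R (w n))) x i =
      ⟪planeWave R x i, K (w n)⟫_ℂ := by
    rw [ae_all_iff]
    intro n
    filter_upwards [D.trace_eq_integral hR (hat_lift_cutoff_support R (w n))] with x hx i
    rw [hx i, ← hK, inner_planeWave_of_support (hat_lift_cutoff_support R (w n))]
  set M := Real.sqrt (volume.real (Metric.closedBall (0 : Plane) R)) * (‖K‖ * B) with hM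
  have hbound : ∀ x i n, ‖⟪planeWave R x i, K (w n)⟫_ℂ‖ ≤ M := by
    intro x i n
    refine (norm_inner_le_norm _ _).trans ?_
    refine mul_le_mul (norm_planeWave_le R x i) ?_ (norm_nonneg _) (Real.sqrt_nonneg _)
    exact (K.le_opNorm _).trans (mul_le_mul_of_nonneg_left (hB n) (norm_nonneg _))
  have h : Tendsto (fun n => ‖D.trace (lift (cutoff R (w n)))‖ ^ 2) atTop (𝓝 0) := by
    simp only [norm_sq_eq_integral]
    have h2 : (0 : ℝ) = ∫ x : Plane, (0 : ℝ) ∂D.m := by simp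
    rw [h2]
    refine tendsto_integral_of_dominated_convergence (fun _ => M ^ 2 + M ^ 2)
      (fun n => ((Lp.aestronglyMeasurable _).norm.pow 2)) (integrable_const _) ?_ ?_
    · intro n
      filter_upwards [hform] with x hx
      rw [norm_sq_C2, hx, hx, Real.norm_of_nonneg (by positivity)]
      gcongr <;> apply hbound
    · filter_upwards [hform] with x hx
      have h3 : ∀ i, Tendsto (fun n => ‖⟪planeWave R x i, K (w n)⟫_ℂ‖ ^ 2) atTop (𝓝 0) := by
        intro i
        simpa using (tendsto_of_weakly hw K (planeWave R x i)).norm.pow 2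
      simp only [norm_sq_C2, hx]
      simpa using (h3 0).add (h3 1)
  have := h.sqrt
  simpa [Real.sqrt_sq] using this

theorem form_add_left (G G' F : H1) : D.form (G + G') F = D.form G F + D.form G' F := by
  rw [← D.form_conj, form_add, map_add, D.form_conj, D.form_conj]

/-- The map of the square-integrable spinors onto the form domain. -/
def domainEmbedding : Spinors →L[ℂ] Spinors :=
  (ContinuousLinearMap.fst ℂ Spinors Spinors).comp (H1.subtypeL.comp lift)

theorem domainEmbedding_apply (w : Spinors) : domainEmbedding w = (lift w).1.1 := rfl

/-- Elements with high frequencies do not contribute to the spectrum below the threshold. -/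
theorem exists_high_frequency_nonneg (hD : D.RelativelyFormBounded) :
    ∃ R : ℝ, 0 < R ∧ ∀ F : H1, (∀ᵐ ξ, ‖ξ‖ ≤ R → hat F ξ = 0) →
      D.kappa * ‖F.1.1‖ ^ 2 ≤ (D.form F F).re := by
  obtain ⟨a, ha, b, hab⟩ := hD
  obtain ⟨θ, hθ, C, hC0, hC⟩ := D.exists_norm_A_le_lt
  -- From `|p|² ≥ T` it follows that the lower band is at least `(1 - θ) T - C = |b + κ| / (1 - a)`,
  -- so `(1 - a) q₀ - b‖F‖²` is at least `κ‖F‖²`.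
  set T := (|b + D.kappa| / (1 - a) + C) / (1 - θ) with hT
  have h1a : 0 < 1 - a := by linarith
  have h1θ : 0 < 1 - θ := by linarith
  have hT0 : 0 ≤ T := by positivity
  refine ⟨1 + T, by positivity, fun F hF => ?_⟩
  have hlow : ∀ᵐ ξ : Plane, hat F ξ ≠ 0 →
      |b + D.kappa| / (1 - a) ≤ lowerBand D.A ((2 * Real.pi) • ξ) := by
    filter_upwards [hF] with ξ h1 h2
    have h3 : 1 + T < ‖ξ‖ := by
      by_contra! h3
      exact h2 (h1 h3)
    have h4 : T ≤ ‖(2 * Real.pi) • ξ‖ ^ 2 := by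
      rw [norm_smul, Real.norm_of_nonneg (by positivity), mul_pow]
      have h5 : 1 ≤ (2 * Real.pi) ^ 2 := by nlinarith [Real.pi_gt_three]
      nlinarith [sq_nonneg ‖ξ‖]
    have h5 := hC ((2 * Real.pi) • ξ)
    have h6 : |b + D.kappa| / (1 - a) + C = T * (1 - θ) := by
      rw [hT, div_mul_cancel₀ _ h1θ.ne']
    rw [lowerBand]
    nlinarith
  have h1 := D.le_freeForm hlow
  have h2 := (abs_le.1 ((Complex.abs_re_le_norm _).trans (hab F))).1
  have h3 : (1 - a) * (|b + D.kappa| / (1 - a) * ‖F.1.1‖ ^ 2) = |b + D.kappa| * ‖F.1.1‖ ^ 2 := by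
    field_simp
  have h4 := mul_le_mul_of_nonneg_left h1 h1a.le
  have h5 := mul_le_mul_of_nonneg_right (le_abs_self (b + D.kappa)) (sq_nonneg ‖F.1.1‖)
  rw [form, Complex.add_re]
  nlinarith

theorem freeForm_eq_zero_of_disjoint {G F : H1} (h : ∀ᵐ ξ, hat G ξ = 0 ∨ hat F ξ = 0) :
    D.freeForm G F = 0 := by
  rw [freeForm]
  refine integral_eq_zero_of_ae ?_
  filter_upwards [h] with ξ h
  simp only [freeIntegrand, inner_symbol]
  rcases h with h | h <;> simp [h]

/-- Low and high frequencies are orthogonal for the free form and for the norm, so only the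
perturbation couples them. Every perturbation term that involves the low part vanishes in the limit;
the free low part and the high part are each at least `κ`. -/
theorem liminf_form_nonneg (hD : D.RelativelyFormBounded) {w : ℕ → Spinors} {B : ℝ}
    (hB : ∀ n, ‖w n‖ ≤ B) (hw : ∀ u, Tendsto (fun n => ⟪u, w n⟫_ℂ) atTop (𝓝 0)) {ε : ℝ} (hε : 0 < ε) :
    ∀ᶠ n in atTop, -ε ≤ (D.form (lift (w n)) (lift (w n))).re -
      D.kappa * ‖domainEmbedding (w n)‖ ^ 2 := by
  obtain ⟨R, hR, hhigh⟩ := D.exists_high_frequency_nonneg hD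
  obtain ⟨M, hM0, hM⟩ := D.norm_nuForm_le
  set P : ℝ := ‖D.trace‖ * (‖lift‖ * (B + ‖cutoff R‖ * B)) with hP
  have hlim : Tendsto (fun n => M * ‖D.trace (lift (cutoff R (w n)))‖ *
      ‖D.trace (lift (cutoff R (w n)))‖ + 2 * (M * ‖D.trace (lift (cutoff R (w n)))‖ * P))
      atTop (𝓝 0) := by
    have h := D.tendsto_trace_cutoff hR hB hw
    have h1 := h.const_mul M
    simpa using (h1.mul h).add ((h1.mul_const P).const_mul 2)
  filter_upwards [hlim.eventually (gt_mem_nhds hε)] with n hn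
  set L := lift (cutoff R (w n)) with hL
  set H := lift (w n - cutoff R (w n)) with hH
  have hsum : lift (w n) = L + H := by rw [hL, hH, ← map_add, add_sub_cancel]
  have hHsupp : ∀ᵐ ξ, ‖ξ‖ ≤ R → hat H ξ = 0 := by
    rw [hH, hat_lift]
    filter_upwards [coeFn_divWeight (w n - cutoff R (w n)), Lp.coeFn_sub (w n) (cutoff R (w n)),
      coeFn_cutoff R (w n)] with ξ h1 h2 h3 h4
    rw [h1, h2, Pi.sub_apply, h3, cutoffFun_of_le h4]
    simp
  have hdisj : ∀ᵐ ξ, hat L ξ = 0 ∨ hat H ξ = 0 := by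
    filter_upwards [hHsupp, hat_lift_cutoff_support R (w n)] with ξ h1 h2
    rcases le_or_gt ‖ξ‖ R with h | h
    · exact Or.inr (h1 h)
    · exact Or.inl (h2 h)
  have hnormsq : ‖domainEmbedding (w n)‖ ^ 2 = ‖L.1.1‖ ^ 2 + ‖H.1.1‖ ^ 2 := by
    have h0 : ⟪L.1.1, H.1.1⟫_ℂ = 0 := by
      rw [inner_fst_eq, L2.inner_def]
      refine integral_eq_zero_of_ae ?_
      filter_upwards [hdisj] with ξ h
      rcases h with h | h <;> simp [h]
    rw [domainEmbedding_apply, hsum]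
    change ‖L.1.1 + H.1.1‖ ^ 2 = _
    rw [sq, sq, sq]
    exact norm_add_sq_eq_norm_sq_add_norm_sq_of_inner_eq_zero _ _ h0
  have hQ : (D.form (lift (w n)) (lift (w n))).re = (D.freeForm L L).re + (D.nuForm L L).re +
      2 * (D.nuForm L H).re + (D.form H H).re := by
    have hz := D.freeForm_eq_zero_of_disjoint hdisj
    have hHL : D.form H L = (starRingEnd ℂ) (D.form L H) := (D.form_conj L H).symm
    rw [hsum, form_add, form_add_left, form_add_left, hHL]
    rw [form, form, hz, zero_add]
    simp only [Complex.add_re, Complex.conj_re]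
    ring
  have h1 := hhigh H hHsupp
  have h2 := D.le_freeForm (F := L) (t := D.kappa)
    (Eventually.of_forall fun ξ _ => D.kappa_le _)
  have h3 := (abs_le.1 ((Complex.abs_re_le_norm _).trans (hM L L))).1
  have h4 := (abs_le.1 ((Complex.abs_re_le_norm _).trans (hM L H))).1
  have h5 : ‖D.trace H‖ ≤ P := by
    refine (D.trace.le_opNorm _).trans (mul_le_mul_of_nonneg_left ?_ (norm_nonneg _))
    refine (lift.le_opNorm _).trans (mul_le_mul_of_nonneg_left ?_ (norm_nonneg _))
    refine (norm_sub_le _ _).trans (add_le_add (hB n) ?_)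
    exact ((cutoff R).le_opNorm _).trans (mul_le_mul_of_nonneg_left (hB n) (norm_nonneg _))
  have h6 : M * ‖D.trace L‖ * ‖D.trace H‖ ≤ M * ‖D.trace L‖ * P := by gcongr
  rw [hQ, hnormsq]
  linarith

/-- The form of the Hamiltonian fits into the abstract variational scheme. -/
theorem variationalForm (hD : D.RelativelyFormBounded) :
    VariationalForm domainEmbedding (fun u v => D.form (lift u) (lift v)) D.kappa where
  add_right u v w := by rw [map_add, form_add]
  smul_right k u v := by rw [map_smul, form_smul]
  conj_symm u v := D.form_conj _ _
  bounded := by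
    obtain ⟨M, hM0, hM⟩ := D.norm_freeForm_le
    obtain ⟨M', hM0', hM'⟩ := D.norm_nuForm_le
    refine ⟨(M + M' * ‖D.trace‖ * ‖D.trace‖) * ‖lift‖ * ‖lift‖, fun u v => ?_⟩
    have h1 := lift.le_opNorm u
    have h2 := lift.le_opNorm v
    have h3 := D.trace.le_opNorm (lift u)
    have h4 := D.trace.le_opNorm (lift v)
    calc ‖D.form (lift u) (lift v)‖
        ≤ M * ‖lift u‖ * ‖lift v‖ + M' * ‖D.trace (lift u)‖ * ‖D.trace (lift v)‖ :=
          (norm_add_le _ _).trans (add_le_add (hM _ _) (hM' _ _))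
      _ ≤ M * ‖lift u‖ * ‖lift v‖ + M' * (‖D.trace‖ * ‖lift u‖) * (‖D.trace‖ * ‖lift v‖) := by
          gcongr
      _ = (M + M' * ‖D.trace‖ * ‖D.trace‖) * ‖lift u‖ * ‖lift v‖ := by ring
      _ ≤ (M + M' * ‖D.trace‖ * ‖D.trace‖) * (‖lift‖ * ‖u‖) * (‖lift‖ * ‖v‖) := by gcongr
      _ = _ := by ring
  injective := lift_fst_injective
  coercive := by
    obtain ⟨a, ha, b, hab⟩ := hD
    obtain ⟨θ, hθ, C, hC0, hC⟩ := D.exists_norm_A_le_lt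
    have h1a : 0 < 1 - a := by linarith
    have h1θ : 0 < 1 - θ := by linarith
    -- The half compensates the two in `‖w‖² ≤ 2‖f‖² + 2‖∇f‖²`.
    refine ⟨(1 - a) * (1 - θ) / 2, by positivity, (1 - a) * C + b + (1 - a) * (1 - θ), fun w => ?_⟩
    set F := lift w with hF
    have h1 := D.le_freeForm_coercive hC F
    have h2 := (abs_le.1 ((Complex.abs_re_le_norm _).trans (hab F))).1
    have hw : ‖w‖ ≤ ‖F.1.1‖ + ‖F.1.2‖ := by
      have : w = hat F + F.1.2 := by
        apply Lp.ext
        filter_upwards [coeFn_divWeight w, coeFn_gradWeight w, Lp.coeFn_add (hat F) F.1.2]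
          with ξ h1 h2 h3
        rw [h3, Pi.add_apply, hF, hat_lift, lift_snd, h1, h2, ← add_smul, ← Complex.ofReal_add]
        have : weightInv ξ + 2 * Real.pi * ‖ξ‖ * weightInv ξ = 1 := by
          rw [weightInv]
          have : 1 + 2 * Real.pi * ‖ξ‖ ≠ 0 := by positivity
          field_simp
        rw [this, Complex.ofReal_one, one_smul]
      rw [norm_fst_eq]
      conv_lhs => rw [this]
      exact norm_add_le _ _
    have hw2 : ‖w‖ ^ 2 ≤ 2 * ‖F.1.1‖ ^ 2 + 2 * ‖F.1.2‖ ^ 2 := by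
      nlinarith [norm_nonneg w, sq_nonneg (‖F.1.1‖ - ‖F.1.2‖)]
    have h3 := mul_le_mul_of_nonneg_left h1 h1a.le
    have h4 := mul_le_mul_of_nonneg_left hw2 (by positivity : 0 ≤ (1 - a) * (1 - θ) / 2)
    change _ ≤ (D.form F F).re + _ * ‖F.1.1‖ ^ 2
    rw [form, Complex.add_re]
    nlinarith
  weak_liminf := by
    rintro w ⟨B, hB⟩ hw ε hε
    exact D.liminf_form_nonneg hD hB hw hε

instance : Fact ((2 : ℝ≥0∞) ≠ ⊤) := ⟨ENNReal.ofNat_ne_top⟩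

instance : TopologicalSpace.SeparableSpace Spinors := inferInstance

/-- The eigenspaces of the Hamiltonian in terms of its form. -/
theorem eigenspace_eq (hD : D.RelativelyFormBounded) (E : ℝ) :
    eigenspace D.hamiltonian E = ((D.variationalForm hD).solutions E).map
      (domainEmbedding : Spinors →ₗ[ℂ] Spinors) := by
  ext f
  change (f, (E : ℂ) • f) ∈ D.hamiltonian.graph ↔ _
  rw [hamiltonian_graph, Submodule.mem_map]
  constructor
  · rintro ⟨F, hF, hG⟩
    obtain ⟨w, rfl⟩ := lift_surjective F
    refine ⟨w, fun g => ?_, hF⟩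
    change D.form (lift g) (lift w) = _
    rw [hG (lift g), inner_smul_right]
    simp only at hF
    rw [← hF]
    rfl
  · rintro ⟨w, hw, hwf⟩
    refine ⟨lift w, hwf, fun G => ?_⟩
    obtain ⟨g, rfl⟩ := lift_surjective G
    refine (hw g).trans ?_
    rw [inner_smul_right]
    change _ = (E : ℂ) * ⟪domainEmbedding g, f⟫_ℂ
    rw [← hwf]
    rfl

theorem iSup_eigenspace_eq (hD : D.RelativelyFormBounded) :
    (⨆ E ∈ eigenvaluesBelow D.hamiltonian D.kappa, eigenspace D.hamiltonian E :
      Submodule ℂ Spinors) = (D.variationalForm hD).solutionsBelow.map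
      (domainEmbedding : Spinors →ₗ[ℂ] Spinors) := by
  rw [VariationalForm.solutionsBelow, Submodule.map_iSup]
  refine Eq.trans ?_ (iSup_congr fun E : {E : ℝ // E < D.kappa} => D.eigenspace_eq hD E)
  apply le_antisymm
  · refine iSup₂_le fun E hE => ?_
    exact le_iSup (fun E : {E : ℝ // E < D.kappa} => eigenspace D.hamiltonian E) ⟨E, hE.1⟩
  · refine iSup_le fun E => ?_
    by_cases h : eigenspace D.hamiltonian E = ⊥
    · rw [h]; exact bot_le
    · exact le_iSup₂_of_le (E : ℝ) ⟨E.2, h⟩ le_rfl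

theorem card_le_countBelow (hD : D.RelativelyFormBounded) {N : Type*} [Fintype N] (V : N → H1)
    (hV : ∀ c : N → ℂ, c ≠ 0 → (D.form (∑ j, c j • V j) (∑ j, c j • V j)).re <
      D.kappa * ‖(∑ j, c j • V j).1.1‖ ^ 2) :
    (Fintype.card N : ℕ∞) ≤ countBelow D.hamiltonian D.kappa := by
  choose w hw using fun j => lift_surjective (V j)
  have h := (D.variationalForm hD).card_le_rank w fun c hc => by
    have h1 : lift (∑ j, c j • w j) = ∑ j, c j • V j := by
      rw [map_sum]
      simp only [map_smul, hw]
    rw [domainEmbedding_apply, h1]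
    exact hV c hc
  rw [countBelow, iSup_eigenspace_eq D hD,
    ((Submodule.equivMapOfInjective (domainEmbedding : Spinors →ₗ[ℂ] Spinors) lift_fst_injective
      (D.variationalForm hD).solutionsBelow).rank_eq).symm]
  have h2 := Cardinal.toENat.monotone' h
  simpa using h2

/-- Finitely many finite-dimensional eigenspaces have a finite-dimensional span. -/
theorem infinite_eigenvaluesBelow (hD : D.RelativelyFormBounded)
    (h : countBelow D.hamiltonian D.kappa = ⊤) :
    (eigenvaluesBelow D.hamiltonian D.kappa).Infinite := by
  intro hfin
  have h1 : ∀ E : eigenvaluesBelow D.hamiltonian D.kappa,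
      FiniteDimensional ℂ (eigenspace D.hamiltonian E) := fun E => by
    rw [D.eigenspace_eq hD]
    exact (D.variationalForm hD).finiteDimensional_solutions E.2.1
  have : Finite (eigenvaluesBelow D.hamiltonian D.kappa) := hfin
  have h2 : FiniteDimensional ℂ (⨆ E ∈ eigenvaluesBelow D.hamiltonian D.kappa,
      eigenspace D.hamiltonian E : Submodule ℂ Spinors) := by
    rw [← iSup_subtype'']
    exact Submodule.finiteDimensional_iSup _
  rw [countBelow, Cardinal.toENat_eq_top] at h
  exact absurd (Module.rank_lt_aleph0_iff.2 h2) (not_lt.2 h)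

end System

/-! ### The logarithmic profile and its wave packets. -/

section Profile

/-- The integral of `‖ξ‖⁻²` over an annulus. -/
def annulusMass (e d : ℝ) : ℝ := 2 * (volume.real (Metric.ball (0 : Plane) 1) * Real.log (d / e))

/-- The function `‖ξ‖⁻²` on an annulus, normalized in `L¹`. -/
def profile (e d : ℝ) (ξ : Plane) : ℝ :=
  (annulusMass e d)⁻¹ * (Set.Ioo e d).indicator (fun r => (r ^ 2)⁻¹) ‖ξ‖

theorem measurable_profile (e d : ℝ) : Measurable (profile e d) := by
  unfold profile
  refine Measurable.const_mul ?_ _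
  exact ((by fun_prop : Measurable fun r : ℝ => (r ^ 2)⁻¹).indicator measurableSet_Ioo).comp
    measurable_norm

variable {e d : ℝ}

theorem annulusMass_pos (he : 0 < e) (hed : e < d) : 0 < annulusMass e d := by
  have h1 : 0 < volume.real (Metric.ball (0 : Plane) 1) :=
    ENNReal.toReal_pos (Metric.measure_ball_pos _ _ one_pos).ne' measure_ball_lt_top.ne
  have h2 : 0 < Real.log (d / e) := Real.log_pos (by rwa [one_lt_div he])
  unfold annulusMass
  positivity

theorem profile_nonneg (he : 0 < e) (hed : e < d) (ξ : Plane) : 0 ≤ profile e d ξ :=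
  mul_nonneg (inv_nonneg.2 (annulusMass_pos he hed).le)
    (Set.indicator_nonneg (fun r _ => by positivity) _)

theorem profile_le (he : 0 < e) (hed : e < d) (ξ : Plane) :
    profile e d ξ ≤ (annulusMass e d)⁻¹ * (e ^ 2)⁻¹ := by
  refine mul_le_mul_of_nonneg_left ?_ (inv_nonneg.2 (annulusMass_pos he hed).le)
  refine Set.indicator_apply_le' (fun hr => ?_) (fun _ => by positivity)
  have := hr.1
  gcongr

theorem profile_of_le {ξ : Plane} (h : ‖ξ‖ ≤ e) : profile e d ξ = 0 := by
  rw [profile, Set.indicator_of_notMem (fun h' => absurd h'.1 (not_lt.2 h)), mul_zero]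

theorem profile_of_ge {ξ : Plane} (h : d ≤ ‖ξ‖) : profile e d ξ = 0 := by
  rw [profile, Set.indicator_of_notMem (fun h' => absurd h'.2 (not_lt.2 h)), mul_zero]

/-- In polar coordinates `r · r⁻² = r⁻¹` integrates to the logarithm; the two in `annulusMass` is
the dimension. -/
theorem integral_profile (he : 0 < e) (hed : e < d) : ∫ ξ, profile e d ξ = 1 := by
  unfold profile
  rw [integral_const_mul, integral_fun_norm_addHaar volume
    ((Set.Ioo e d).indicator fun r => (r ^ 2)⁻¹)]
  have h1 : ∫ y in Set.Ioi (0 : ℝ), y ^ (Module.finrank ℝ Plane - 1) •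
      (Set.Ioo e d).indicator (fun r => (r ^ 2)⁻¹) y = Real.log (d / e) := by
    rw [finrank_euclideanSpace_fin]
    have h2 : ∀ y ∈ Set.Ioi (0 : ℝ), y ^ (2 - 1) •
        (Set.Ioo e d).indicator (fun r => (r ^ 2)⁻¹) y =
        (Set.Ioo e d).indicator (fun r => r⁻¹) y := by
      intro y hy
      have hy0 : y ≠ 0 := (Set.mem_Ioi.1 hy).ne'
      by_cases h : y ∈ Set.Ioo e d
      · rw [Set.indicator_of_mem h, Set.indicator_of_mem h, smul_eq_mul, pow_one]
        field_simp
      · rw [Set.indicator_of_notMem h, Set.indicator_of_notMem h, smul_zero]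
    rw [setIntegral_congr_fun measurableSet_Ioi h2, setIntegral_indicator measurableSet_Ioo,
      Set.inter_eq_self_of_subset_right
        (fun y (hy : y ∈ Set.Ioo e d) => Set.mem_Ioi.2 (he.trans hy.1)),
      ← integral_Ioc_eq_integral_Ioo, ← intervalIntegral.integral_of_le hed.le,
      integral_inv_of_pos he (he.trans hed)]
  rw [h1, finrank_euclideanSpace_fin, nsmul_eq_mul, smul_eq_mul, Nat.cast_ofNat]
  exact inv_mul_cancel₀ (annulusMass_pos he hed).ne'

theorem integrable_profile (he : 0 < e) (hed : e < d) : Integrable (profile e d) :=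
  -- The integral of a nonintegrable function is zero by convention.
  Integrable.of_integral_ne_zero (by rw [integral_profile he hed]; exact one_ne_zero)

/-- The weighted square is again a multiple of the profile. Its integral is therefore the reciprocal
of the mass, which tends to zero as `d / e` grows. -/
theorem norm_sq_mul_profile_sq (he : 0 < e) (ξ : Plane) :
    ‖ξ‖ ^ 2 * profile e d ξ ^ 2 = (annulusMass e d)⁻¹ * profile e d ξ := by
  unfold profile
  by_cases h : ‖ξ‖ ∈ Set.Ioo e d
  · have : ‖ξ‖ ≠ 0 := (he.trans h.1).ne'
    rw [Set.indicator_of_mem h]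
    field_simp
  · rw [Set.indicator_of_notMem h]
    simp

theorem integral_norm_sq_mul_profile_sq (he : 0 < e) (hed : e < d) :
    ∫ ξ, ‖ξ‖ ^ 2 * profile e d ξ ^ 2 = (annulusMass e d)⁻¹ := by
  simp only [norm_sq_mul_profile_sq he]
  rw [integral_const_mul, integral_profile he hed, mul_one]

theorem integrable_norm_sq_mul_profile_sq (he : 0 < e) (hed : e < d) :
    Integrable fun ξ : Plane => ‖ξ‖ ^ 2 * profile e d ξ ^ 2 := by
  simp only [norm_sq_mul_profile_sq he]
  exact (integrable_profile he hed).const_mul _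

theorem norm_wave_sub_le (x ξ ξ₀ : Plane) :
    ‖wave x ξ - wave x ξ₀‖ ≤ 2 * Real.pi * (‖x‖ * ‖ξ - ξ₀‖) := by
  have h1 : wave x ξ - wave x ξ₀ = wave x ξ₀ * (Complex.exp (Complex.I *
      ((2 * Real.pi * (inner ℝ (ξ - ξ₀) x : ℝ) : ℝ) : ℂ)) - 1) := by
    rw [mul_sub, mul_one, wave, wave, ← Complex.exp_add, inner_sub_left]
    congr 2
    push_cast
    ring
  rw [h1, norm_mul, norm_wave, one_mul]
  refine (Real.norm_exp_I_mul_ofReal_sub_one_le).trans ?_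
  rw [Real.norm_eq_abs, abs_mul, abs_of_pos (by positivity : 0 < 2 * Real.pi)]
  have := abs_real_inner_le_norm (ξ - ξ₀) x
  gcongr
  linarith

/-- The inverse Fourier integral of a translated profile. -/
def packet (e d : ℝ) (ξ₀ x : Plane) : ℂ := ∫ ξ, wave x ξ * (profile e d (ξ - ξ₀) : ℂ)

theorem integrable_packet (he : 0 < e) (hed : e < d) (ξ₀ x : Plane) :
    Integrable fun ξ => wave x ξ * (profile e d (ξ - ξ₀) : ℂ) :=
  ((integrable_profile he hed).comp_sub_right ξ₀).ofReal.bdd_mul (c := 1)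
    (continuous_wave x).aestronglyMeasurable (Eventually.of_forall fun ξ => (norm_wave x ξ).le)

theorem norm_packet_le (he : 0 < e) (hed : e < d) (ξ₀ x : Plane) : ‖packet e d ξ₀ x‖ ≤ 1 := by
  rw [← integral_profile he hed, ← integral_sub_right_eq_self (profile e d) ξ₀]
  refine norm_integral_le_of_norm_le ((integrable_profile he hed).comp_sub_right ξ₀)
    (Eventually.of_forall fun ξ => ?_)
  rw [norm_mul, norm_wave, one_mul, Complex.norm_real,
    Real.norm_of_nonneg (profile_nonneg he hed _)]

/-- The packet is an average of `wave x` over frequencies within `d` of `ξ₀`, and `wave x` is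
Lipschitz with constant `2π‖x‖`. -/
theorem norm_packet_sub_le (he : 0 < e) (hed : e < d) (ξ₀ x : Plane) :
    ‖packet e d ξ₀ x - wave x ξ₀‖ ≤ 2 * Real.pi * (‖x‖ * d) := by
  have hi := (integrable_profile he hed).comp_sub_right ξ₀
  have h0 : ∫ ξ, profile e d (ξ - ξ₀) = 1 := by
    rw [integral_sub_right_eq_self (profile e d) ξ₀, integral_profile he hed]
  have h1 : wave x ξ₀ = ∫ ξ, wave x ξ₀ * (profile e d (ξ - ξ₀) : ℂ) := by
    rw [integral_const_mul, integral_complex_ofReal, h0]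
    simp
  rw [packet]
  conv_lhs => rw [h1]
  have hi2 : Integrable fun ξ => wave x ξ₀ * (profile e d (ξ - ξ₀) : ℂ) := hi.ofReal.const_mul _
  rw [← integral_sub (integrable_packet he hed ξ₀ x) hi2]
  have h2 : 2 * Real.pi * (‖x‖ * d) =
      ∫ ξ, 2 * Real.pi * (‖x‖ * d) * profile e d (ξ - ξ₀) := by
    rw [integral_const_mul, h0, mul_one]
  rw [h2]
  refine norm_integral_le_of_norm_le (hi.const_mul _) (Eventually.of_forall fun ξ => ?_)
  rw [← sub_mul, norm_mul, Complex.norm_real, Real.norm_of_nonneg (profile_nonneg he hed _)]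
  by_cases h : d ≤ ‖ξ - ξ₀‖
  · rw [profile_of_ge h, mul_zero, mul_zero]
  · refine mul_le_mul_of_nonneg_right ((norm_wave_sub_le x ξ ξ₀).trans ?_)
      (profile_nonneg he hed _)
    have := (not_le.1 h).le
    gcongr

end Profile

/-! ### Quadratic bounds at minima and the lower polarization. -/

/-- Bounded functions of bounded support are Fourier transforms of elements of the Sobolev
space. -/
theorem exists_hat_eq {u : Plane → C2} (hu : AEStronglyMeasurable u volume) {C R : ℝ}
    (hC : ∀ ξ, ‖u ξ‖ ≤ C) (hR : ∀ ξ, R < ‖ξ‖ → u ξ = 0) : ∃ F : H1, hat F =ᵐ[volume] u := by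
  have hmem : MemLp (fun ξ : Plane => ((1 + 2 * Real.pi * ‖ξ‖ : ℝ) : ℂ) • u ξ) 2 volume := by
    have h1 : (fun ξ : Plane => ((1 + 2 * Real.pi * ‖ξ‖ : ℝ) : ℂ) • u ξ) =
        (Metric.closedBall 0 R).indicator
          (fun ξ : Plane => ((1 + 2 * Real.pi * ‖ξ‖ : ℝ) : ℂ) • u ξ) := by
      refine (Set.indicator_eq_self.2 fun ξ h => ?_).symm
      by_contra h2
      exact h (by simp [hR ξ (by simpa using h2)])
    rw [h1, memLp_indicator_iff_restrict measurableSet_closedBall]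
    have : IsFiniteMeasure (volume.restrict (Metric.closedBall (0 : Plane) R)) :=
      ⟨by
        rw [Measure.restrict_apply_univ]
        exact measure_closedBall_lt_top⟩
    refine MemLp.of_bound (C := (1 + 2 * Real.pi * R) * C) ?_ ?_
    · exact ((by fun_prop : Continuous fun ξ : Plane =>
        ((1 + 2 * Real.pi * ‖ξ‖ : ℝ) : ℂ)).aestronglyMeasurable.smul hu).restrict
    · filter_upwards [ae_restrict_mem measurableSet_closedBall] with ξ hξ
      rw [norm_smul, Complex.norm_real, Real.norm_of_nonneg (by positivity)]
      have h3 : ‖ξ‖ ≤ R := by simpa using hξ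
      have := hC ξ
      have h4 : 0 ≤ R := (norm_nonneg ξ).trans h3
      gcongr
  refine ⟨lift hmem.toLp, ?_⟩
  rw [hat_lift]
  filter_upwards [coeFn_divWeight hmem.toLp, hmem.coeFn_toLp] with ξ h1 h2
  rw [h1, h2, smul_smul, ← Complex.ofReal_mul, weightInv, inv_mul_cancel₀ (by positivity),
    Complex.ofReal_one, one_smul]

/-- A function that is twice continuously differentiable near a global minimum is bounded by a
parabola there. -/
theorem exists_parabola {f : Plane → ℝ} {p₀ : Plane} (hf : ContDiffAt ℝ 2 f p₀)
    (hmin : ∀ p, f p₀ ≤ f p) :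
    ∃ K : ℝ, 0 ≤ K ∧ ∃ δ : ℝ, 0 < δ ∧ ∀ p, ‖p - p₀‖ < δ → f p - f p₀ ≤ K * ‖p - p₀‖ ^ 2 := by
  -- The derivative vanishes at the minimum and is Lipschitz nearby, so it is at most `K‖y - p₀‖`;
  -- the mean value inequality gives the parabola.
  have h0 : fderiv ℝ f p₀ = 0 :=
    IsLocalMin.fderiv_eq_zero (Eventually.of_forall hmin)
  have h1 : ContDiffAt ℝ 1 (fderiv ℝ f) p₀ := hf.fderiv_right (by norm_num)
  obtain ⟨K, t, ht, hK⟩ := h1.exists_lipschitzOnWith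
  have h2 : ∀ᶠ p in 𝓝 p₀, DifferentiableAt ℝ f p := by
    filter_upwards [hf.eventually (by simp)] with p hp
    exact hp.differentiableAt (by norm_num)
  obtain ⟨δ, hδ, hball⟩ := Metric.mem_nhds_iff.1 (inter_mem ht h2)
  refine ⟨K, K.2, δ, hδ, fun p hp => ?_⟩
  have hsub : ∀ y ∈ Metric.closedBall p₀ ‖p - p₀‖, y ∈ Metric.ball p₀ δ := fun y hy => by
    rw [Metric.mem_ball]
    exact lt_of_le_of_lt (Metric.mem_closedBall.1 hy) hp
  have h3 := (convex_closedBall p₀ ‖p - p₀‖).norm_image_sub_le_of_norm_fderiv_le (𝕜 := ℝ) (f := f)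
    (C := K * ‖p - p₀‖) (fun y hy => (hball (hsub y hy)).2) (fun y hy => by
      have h4 := hK.norm_sub_le (hball (hsub y hy)).1 (mem_of_mem_nhds ht)
      rw [h0, sub_zero] at h4
      refine h4.trans (mul_le_mul_of_nonneg_left ?_ K.2)
      exact mem_closedBall_iff_norm.1 hy) (Metric.mem_closedBall_self (norm_nonneg _))
    (mem_closedBall_iff_norm.2 le_rfl)
  calc f p - f p₀ ≤ ‖f p - f p₀‖ := le_abs_self _
    _ ≤ K * ‖p - p₀‖ * ‖p - p₀‖ := h3
    _ = _ := by ring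

/-- The polarization of the lower band. -/
def polarization (A : Plane → ℂ) (p : Plane) : C2 :=
  !₂[1, -(starRingEnd ℂ) (A p) / (‖A p‖ : ℂ)]

theorem polarization_zero (A : Plane → ℂ) (p : Plane) : polarization A p 0 = 1 := rfl

theorem norm_polarization_sq_le (A : Plane → ℂ) (p : Plane) : ‖polarization A p‖ ^ 2 ≤ 2 := by
  rw [norm_sq_C2]
  have : ‖polarization A p 1‖ ≤ 1 := by
    change ‖-(starRingEnd ℂ) (A p) / (‖A p‖ : ℂ)‖ ≤ 1
    rw [norm_div, norm_neg, RCLike.norm_conj, Complex.norm_real, norm_norm]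
    exact div_self_le_one _
  rw [polarization_zero, norm_one]
  nlinarith [norm_nonneg (polarization A p 1)]

/-- The vector is an eigenvector of the symbol for the lower band. Where `A p = 0` its second entry
is zero by the convention on division, but the symbol is then scalar. -/
theorem inner_symbol_polarization (A : Plane → ℂ) (p : Plane) (z : ℂ) :
    (inner ℂ (z • polarization A p) (WithLp.toLp 2
      ((symbol A p).mulVec (WithLp.ofLp (z • polarization A p))) : C2) : ℂ) =
      ((lowerBand A p * ‖z • polarization A p‖ ^ 2 : ℝ) : ℂ) := by
  rw [inner_symbol, norm_sq_C2]
  have h0 : (z • polarization A p) 0 = z := by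
    change z * 1 = z
    rw [mul_one]
  have h1 : (z • polarization A p) 1 = z * (-(starRingEnd ℂ) (A p) / (‖A p‖ : ℂ)) := rfl
  rw [h0, h1, lowerBand]
  push_cast
  rw [← Complex.mul_conj', ← Complex.mul_conj']
  by_cases hA : A p = 0
  · simp [hA]
    ring
  · have h2 : (‖A p‖ : ℂ) ≠ 0 := by simpa using hA
    have h3 : A p * (starRingEnd ℂ) (A p) = (‖A p‖ : ℂ) ^ 2 := Complex.mul_conj' _
    simp only [map_mul, map_div₀, map_neg, Complex.conj_conj, Complex.conj_ofReal]
    generalize (starRingEnd ℂ) (A p) = β at *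
    generalize (‖A p‖ : ℂ) = n at *
    field_simp
    linear_combination (-(z * (starRingEnd ℂ) z) * n) * h3

theorem measurable_polarization {A : Plane → ℂ} (hA : Continuous A) :
    Measurable (polarization A) := by
  have h : Measurable fun p => (![1, -(starRingEnd ℂ) (A p) / (‖A p‖ : ℂ)] : Fin 2 → ℂ) := by
    rw [measurable_pi_iff]
    intro i
    fin_cases i
    · exact measurable_const
    · exact ((Complex.continuous_conj.comp hA).measurable.neg).div
        (Complex.continuous_ofReal.comp hA.norm).measurable
  exact (WithLp.measurable_toLp 2 (Fin 2 → ℂ)).comp h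

theorem coeFn_hat_sum {N : Type*} [Fintype N] (c : N → ℂ) (V : N → H1) {u : N → Plane → C2}
    (hu : ∀ j, hat (V j) =ᵐ[volume] u j) :
    hat (∑ j, c j • V j) =ᵐ[volume] fun ξ => ∑ j, c j • u j ξ := by
  classical
  have key : ∀ s : Finset N, hat (∑ j ∈ s, c j • V j) =ᵐ[volume]
      fun ξ => ∑ j ∈ s, c j • u j ξ := by
    intro s
    induction s using Finset.induction_on with
    | empty =>
      have h0 : hat (0 : H1) = 0 := (Lp.fourierTransformₗᵢ Plane C2).map_zero
      simp only [Finset.sum_empty, h0]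
      exact Lp.coeFn_zero C2 2 volume
    | insert j s hj ih =>
      simp only [Finset.sum_insert hj]
      rw [hat_add, hat_smul]
      filter_upwards [ih, hu j, Lp.coeFn_add (c j • hat (V j)) (hat (∑ j ∈ s, c j • V j)),
        Lp.coeFn_smul (c j) (hat (V j))] with ξ h1 h2 h3 h4
      rw [h3, Pi.add_apply, h4, Pi.smul_apply, h1, h2]
  exact key Finset.univ

/-! ### Trial spaces of wave packets. -/

namespace System

variable (D : System)

theorem integrable_h : Integrable D.h D.m := by
  obtain ⟨C, hC⟩ := D.bounded_h
  exact Integrable.of_bound D.measurable_h.aestronglyMeasurable C (Eventually.of_forall hC)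

theorem nu_apply {s : Set Plane} (hs : MeasurableSet s) : D.nu s = ∫ x in s, D.h x ∂D.m :=
  withDensityᵥ_apply D.integrable_h hs

theorem exists_wavePacket {e d : ℝ} (he : 0 < e) (hed : e < d) (ξ₀ : Plane) :
    ∃ F : H1, hat F =ᵐ[volume]
      fun ξ => (profile e d (ξ - ξ₀) : ℂ) • polarization D.A ((2 * Real.pi) • ξ) := by
  have hpol : Measurable fun ξ : Plane => polarization D.A ((2 * Real.pi) • ξ) :=
    (measurable_polarization D.continuous_A).comp (measurable_const_smul _)
  have hprof : Measurable fun ξ : Plane => (profile e d (ξ - ξ₀) : ℂ) :=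
    Complex.measurable_ofReal.comp ((measurable_profile e d).comp (measurable_id.sub_const ξ₀))
  refine exists_hat_eq (C := (annulusMass e d)⁻¹ * (e ^ 2)⁻¹ * 2) (R := ‖ξ₀‖ + d)
    (hprof.smul hpol).aestronglyMeasurable (fun ξ => ?_) fun ξ h => ?_
  · rw [norm_smul, Complex.norm_real, Real.norm_of_nonneg (profile_nonneg he hed _)]
    have h1 := norm_polarization_sq_le D.A ((2 * Real.pi) • ξ)
    have h2 : ‖polarization D.A ((2 * Real.pi) • ξ)‖ ≤ 2 := by
      nlinarith [norm_nonneg (polarization D.A ((2 * Real.pi) • ξ))]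
    have := annulusMass_pos he hed
    exact mul_le_mul (profile_le he hed _) h2 (norm_nonneg _) (by positivity)
  · rw [profile_of_ge]
    · simp
    · have := norm_sub_norm_le ξ ξ₀
      linarith

theorem trace_wavePacket {e d : ℝ} (he : 0 < e) (hed : e < d) {N : Type*} [Fintype N]
    (ξ₀ : N → Plane) (c : N → ℂ) {F : H1} (hF : hat F =ᵐ[volume] fun ξ =>
      (∑ j, c j * (profile e d (ξ - ξ₀ j) : ℂ)) • polarization D.A ((2 * Real.pi) • ξ)) :
    ∀ᵐ x ∂D.m, D.trace F x 0 = ∑ j, c j * packet e d (ξ₀ j) x := by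
  have hd : 0 < d := he.trans hed
  have hsupp : ∀ᵐ ξ, (∑ j, ‖ξ₀ j‖) + d < ‖ξ‖ → hat F ξ = 0 := by
    filter_upwards [hF] with ξ h1 h2
    rw [h1, Finset.sum_eq_zero, zero_smul]
    intro j _
    rw [profile_of_ge, Complex.ofReal_zero, mul_zero]
    have h3 := norm_sub_norm_le ξ (ξ₀ j)
    have h4 := Finset.single_le_sum (f := fun j => ‖ξ₀ j‖) (fun j _ => norm_nonneg _)
      (Finset.mem_univ j)
    linarith
  filter_upwards [D.trace_eq_integral (by positivity) hsupp] with x hx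
  rw [hx 0]
  have h1 : ∫ ξ, wave x ξ * hat F ξ 0 =
      ∫ ξ, ∑ j, c j * (wave x ξ * (profile e d (ξ - ξ₀ j) : ℂ)) := by
    refine integral_congr_ae ?_
    filter_upwards [hF] with ξ h
    rw [h]
    change wave x ξ * ((∑ j, c j * (profile e d (ξ - ξ₀ j) : ℂ)) * 1) = _
    rw [mul_one, Finset.mul_sum]
    exact Finset.sum_congr rfl fun j _ => by ring
  rw [h1, integral_finsetSum _ fun j _ => (integrable_packet he hed (ξ₀ j) x).const_mul _]
  simp only [integral_const_mul]
  rfl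

theorem freeForm_polarized {F : H1} {z : Plane → ℂ}
    (hF : hat F =ᵐ[volume] fun ξ => z ξ • polarization D.A ((2 * Real.pi) • ξ)) :
    (Integrable fun ξ => (lowerBand D.A ((2 * Real.pi) • ξ) - D.kappa) * ‖hat F ξ‖ ^ 2) ∧
    (D.freeForm F F).re - D.kappa * ‖F.1.1‖ ^ 2 =
      ∫ ξ, (lowerBand D.A ((2 * Real.pi) • ξ) - D.kappa) * ‖hat F ξ‖ ^ 2 := by
  have h1 : (D.freeForm F F).re = ∫ ξ, (D.freeIntegrand F F ξ).re :=
    (integral_re (D.integrable_freeIntegrand F F)).symm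
  have hi : Integrable fun ξ => (D.freeIntegrand F F ξ).re := (D.integrable_freeIntegrand F F).re
  have hj : Integrable fun ξ => D.kappa * ‖hat F ξ‖ ^ 2 := (integrable_norm_sq (hat F)).const_mul _
  have hae : (fun ξ => (D.freeIntegrand F F ξ).re - D.kappa * ‖hat F ξ‖ ^ 2) =ᵐ[volume]
      fun ξ => (lowerBand D.A ((2 * Real.pi) • ξ) - D.kappa) * ‖hat F ξ‖ ^ 2 := by
    filter_upwards [hF] with ξ h
    rw [freeIntegrand, h, inner_symbol_polarization, Complex.ofReal_re]
    ring
  refine ⟨(hi.sub hj).congr hae, ?_⟩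
  rw [h1, norm_fst_eq, norm_sq_eq_integral, ← integral_const_mul, ← integral_sub hi hj]
  exact integral_congr_ae hae

/-- The excess of the band over `κ` is paired with the energy of the profile. The two bounds the
squared polarization, one cardinality comes from Cauchy–Schwarz, the other from adding equal
energies. -/
theorem freeForm_wavePacket_le {e d K : ℝ} (he : 0 < e) (hed : e < d) {N : Type*}
    [Fintype N] (ξ₀ : N → Plane) (hpar : ∀ j ξ, ‖ξ - ξ₀ j‖ < d →
      lowerBand D.A ((2 * Real.pi) • ξ) - D.kappa ≤ K * ‖ξ - ξ₀ j‖ ^ 2)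
    (c : N → ℂ) (hc : ∀ j, ‖c j‖ ≤ 1) {F : H1} (hF : hat F =ᵐ[volume] fun ξ =>
      (∑ j, c j * (profile e d (ξ - ξ₀ j) : ℂ)) • polarization D.A ((2 * Real.pi) • ξ)) :
    (D.freeForm F F).re - D.kappa * ‖F.1.1‖ ^ 2 ≤
      2 * Fintype.card N * (Fintype.card N * (K * (annulusMass e d)⁻¹)) := by
  obtain ⟨hi, heq⟩ := D.freeForm_polarized hF
  have hint : ∀ j, Integrable fun ξ => K * (‖ξ - ξ₀ j‖ ^ 2 * profile e d (ξ - ξ₀ j) ^ 2) := fun j =>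
    ((integrable_norm_sq_mul_profile_sq he hed).comp_sub_right (ξ₀ j)).const_mul K
  have hval : ∀ j, ∫ ξ, K * (‖ξ - ξ₀ j‖ ^ 2 * profile e d (ξ - ξ₀ j) ^ 2) =
      K * (annulusMass e d)⁻¹ := fun j => by
    rw [integral_const_mul, integral_sub_right_eq_self
      (fun ξ : Plane => ‖ξ‖ ^ 2 * profile e d ξ ^ 2) (ξ₀ j), integral_norm_sq_mul_profile_sq he hed]
  have hrhs : 2 * Fintype.card N * (Fintype.card N * (K * (annulusMass e d)⁻¹)) =
      ∫ ξ, 2 * Fintype.card N * ∑ j, K * (‖ξ - ξ₀ j‖ ^ 2 * profile e d (ξ - ξ₀ j) ^ 2) := by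
    rw [integral_const_mul, integral_finsetSum _ fun j _ => hint j]
    simp only [hval, Finset.sum_const, Finset.card_univ, nsmul_eq_mul]
  rw [heq, hrhs]
  refine integral_mono_ae hi ((integrable_finsetSum _ fun j _ => hint j).const_mul _) ?_
  filter_upwards [hF] with ξ h
  have hgap : 0 ≤ lowerBand D.A ((2 * Real.pi) • ξ) - D.kappa := sub_nonneg.2 (D.kappa_le _)
  have h1 : ‖hat F ξ‖ ^ 2 ≤ 2 * (Fintype.card N * ∑ j, profile e d (ξ - ξ₀ j) ^ 2) := by
    rw [h, norm_smul, mul_pow, mul_comm]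
    have h2 : ‖∑ j, c j * (profile e d (ξ - ξ₀ j) : ℂ)‖ ≤ ∑ j, profile e d (ξ - ξ₀ j) := by
      refine norm_sum_le_of_le _ fun j _ => ?_
      rw [norm_mul, Complex.norm_real, Real.norm_of_nonneg (profile_nonneg he hed _)]
      exact mul_le_of_le_one_left (profile_nonneg he hed _) (hc j)
    have h3 := sq_sum_le_card_mul_sum_sq (s := Finset.univ)
      (f := fun j => profile e d (ξ - ξ₀ j))
    rw [Finset.card_univ] at h3
    have h4 : ‖∑ j, c j * (profile e d (ξ - ξ₀ j) : ℂ)‖ ^ 2 ≤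
        Fintype.card N * ∑ j, profile e d (ξ - ξ₀ j) ^ 2 :=
      le_trans (by gcongr) h3
    exact mul_le_mul (norm_polarization_sq_le _ _) h4 (sq_nonneg _) zero_le_two
  refine (mul_le_mul_of_nonneg_left h1 hgap).trans ?_
  have h5 : ∀ j, (lowerBand D.A ((2 * Real.pi) • ξ) - D.kappa) * profile e d (ξ - ξ₀ j) ^ 2 ≤
      K * (‖ξ - ξ₀ j‖ ^ 2 * profile e d (ξ - ξ₀ j) ^ 2) := by
    intro j
    by_cases hj : d ≤ ‖ξ - ξ₀ j‖
    · rw [profile_of_ge hj]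
      simp
    · rw [← mul_assoc]
      exact mul_le_mul_of_nonneg_right (hpar j ξ (not_le.1 hj)) (sq_nonneg _)
  calc _ = 2 * Fintype.card N *
        ∑ j, (lowerBand D.A ((2 * Real.pi) • ξ) - D.kappa) * profile e d (ξ - ξ₀ j) ^ 2 := by
        rw [← Finset.mul_sum]; ring
    _ ≤ _ := by
        exact mul_le_mul_of_nonneg_left (Finset.sum_le_sum fun j _ => h5 j) (by positivity)

theorem nuForm_self (F : H1) : (D.nuForm F F).re = ∫ x, D.h x * ‖D.trace F x‖ ^ 2 ∂D.m := by
  have h1 : (D.nuForm F F).re = ∫ x, ((D.h x : ℂ) * inner ℂ (D.trace F x) (D.trace F x)).re ∂D.m :=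
    (integral_re (D.integrable_nuForm F F)).symm
  rw [h1]
  refine integral_congr_ae (Eventually.of_forall fun x => ?_)
  simp only [Complex.re_ofReal_mul, VariationalForm.re_inner_self]

/-- As `h ≤ 0`, dropping the second component only raises the form. The first component of a packet
does not see the phase of `A`. -/
theorem nuForm_re_le (hneg : ∀ᵐ x ∂D.m, D.h x ≤ 0) {F : H1} {g : Plane → ℂ}
    (hg : ∀ᵐ x ∂D.m, D.trace F x 0 = g x) :
    (D.nuForm F F).re ≤ ∫ x, D.h x * ‖g x‖ ^ 2 ∂D.m := by
  obtain ⟨C, hC⟩ := D.bounded_h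
  rw [nuForm_self]
  have hi : Integrable (fun x => D.h x * ‖D.trace F x‖ ^ 2) D.m :=
    (integrable_norm_sq (D.trace F)).bdd_mul (c := C) D.measurable_h.aestronglyMeasurable
      (Eventually.of_forall hC)
  have hm : AEStronglyMeasurable (fun x => D.trace F x 0) D.m :=
    (EuclideanSpace.proj (𝕜 := ℂ) (0 : Fin 2)).continuous.comp_aestronglyMeasurable
      (Lp.aestronglyMeasurable (D.trace F))
  have hj0 : Integrable (fun x => D.h x * ‖D.trace F x 0‖ ^ 2) D.m := by
    refine hi.mono (D.measurable_h.aestronglyMeasurable.mul (hm.norm.pow 2))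
      (Eventually.of_forall fun x => ?_)
    rw [norm_mul, norm_mul, Real.norm_of_nonneg (sq_nonneg ‖D.trace F x 0‖),
      Real.norm_of_nonneg (sq_nonneg ‖D.trace F x‖)]
    have := PiLp.norm_apply_le (D.trace F x) 0
    gcongr
  have hj : Integrable (fun x => D.h x * ‖g x‖ ^ 2) D.m :=
    hj0.congr (hg.mono fun x hx => by simp only [hx])
  refine integral_mono_ae hi hj ?_
  filter_upwards [hneg, hg] with x h1 h2
  rw [← h2]
  refine mul_le_mul_of_nonpos_left ?_ h1
  have := PiLp.norm_apply_le (D.trace F x) 0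
  gcongr

theorem exists_parabola_lowerBand {p₀ : Plane} (hp₀ : p₀ ∈ minimumSet D.A) :
    ∃ K : ℝ, 0 ≤ K ∧ ∃ δ : ℝ, 0 < δ ∧ ∀ ξ : Plane, ‖ξ - (2 * Real.pi)⁻¹ • p₀‖ < δ →
      lowerBand D.A ((2 * Real.pi) • ξ) - D.kappa ≤ K * ‖ξ - (2 * Real.pi)⁻¹ • p₀‖ ^ 2 := by
  obtain ⟨U, hU, hsub, hdiff⟩ := D.contDiff_norm_A
  have h1 : ContDiffAt ℝ 2 (lowerBand D.A) p₀ :=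
    (contDiff_norm_sq ℝ).contDiffAt.sub (hdiff.contDiffAt (hU.mem_nhds (hsub hp₀)))
  have hval : lowerBand D.A p₀ = D.kappa := hp₀
  obtain ⟨K, hK, δ, hδ, h⟩ := exists_parabola h1 fun p => by rw [hval]; exact D.kappa_le p
  have hpi : 0 < 2 * Real.pi := by positivity
  have hnorm : ∀ ξ : Plane, ‖(2 * Real.pi) • ξ - p₀‖ =
      2 * Real.pi * ‖ξ - (2 * Real.pi)⁻¹ • p₀‖ := by
    intro ξ
    have h2 : (2 * Real.pi) • ξ - p₀ = (2 * Real.pi) • (ξ - (2 * Real.pi)⁻¹ • p₀) := by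
      rw [smul_sub, smul_inv_smul₀ hpi.ne']
    rw [h2, norm_smul, Real.norm_of_nonneg hpi.le]
  -- The rescaling `p = 2πξ` accounts for both constants.
  refine ⟨K * (2 * Real.pi) ^ 2, by positivity, δ / (2 * Real.pi), by positivity, fun ξ hξ => ?_⟩
  rw [lt_div_iff₀' hpi, ← hnorm] at hξ
  have h3 := h _ hξ
  rw [hval, hnorm, mul_pow, ← mul_assoc] at h3
  exact h3

theorem form_smul_self (k : ℂ) (F : H1) : (D.form (k • F) (k • F)).re = ‖k‖ ^ 2 * (D.form F F).re := by
  have h : D.form (k • F) F = (starRingEnd ℂ) k * D.form F F := by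
    rw [← D.form_conj, form_smul, map_mul, D.form_conj]
  rw [form_smul, h, ← mul_assoc, Complex.mul_conj', ← Complex.ofReal_pow, Complex.re_ofReal_mul]

/-- Wave packets concentrated near minima of the lower band span a space on which the form is
below the threshold, provided the plane waves are independent with respect to the perturbation. -/
theorem exists_negative_family (hneg : ∀ᵐ x ∂D.m, D.h x ≤ 0) {N : Type*} [Fintype N]
    (p : N → Plane) (hp : ∀ j, p j ∈ minimumSet D.A)
    (hnd : ∀ c : N → ℂ,
      ∫ x, D.h x * ‖∑ j, c j * wave x ((2 * Real.pi)⁻¹ • p j)‖ ^ 2 ∂D.m = 0 → c = 0) :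
    ∃ V : N → H1, ∀ c : N → ℂ, c ≠ 0 → (D.form (∑ j, c j • V j) (∑ j, c j • V j)).re <
      D.kappa * ‖(∑ j, c j • V j).1.1‖ ^ 2 := by
  classical
  set ξ₀ : N → Plane := fun j => (2 * Real.pi)⁻¹ • p j with hξ₀
  obtain ⟨C, hC⟩ := D.bounded_h
  have hC0 : 0 ≤ C := (abs_nonneg _).trans (hC 0)
  choose K hK δ hδ hpar using fun j => D.exists_parabola_lowerBand (hp j)
  -- The radii shrink to zero while `log (d / e) = n + 1` diverges: packets approach plane waves and
  -- the kinetic excess vanishes.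
  let d : ℕ → ℝ := fun n => 1 / ((n : ℝ) + 1)
  let e : ℕ → ℝ := fun n => d n * Real.exp (-((n : ℝ) + 1))
  have hd : ∀ n, 0 < d n := fun n => by positivity
  have he : ∀ n, 0 < e n := fun n => mul_pos (hd n) (Real.exp_pos _)
  have hed : ∀ n, e n < d n := fun n => by
    refine mul_lt_of_lt_one_right (hd n) (Real.exp_lt_one_iff.2 ?_)
    have : (0 : ℝ) ≤ n := n.cast_nonneg
    linarith
  have hdlim : Tendsto d atTop (𝓝 0) := tendsto_one_div_add_atTop_nhds_zero_nat
  have hmass : Tendsto (fun n => (annulusMass (e n) (d n))⁻¹) atTop (𝓝 0) := by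
    have h1 : ∀ n, (annulusMass (e n) (d n))⁻¹ =
        (2 * volume.real (Metric.ball (0 : Plane) 1))⁻¹ * d n := by
      intro n
      have h2 : d n / e n = Real.exp ((n : ℝ) + 1) := by
        simp only [e]
        rw [Real.exp_neg, div_mul_eq_div_div, div_self (hd n).ne', one_div, inv_inv]
      rw [annulusMass, h2, Real.log_exp, ← mul_assoc, mul_inv]
      simp [d]
    simp only [h1]
    simpa using hdlim.const_mul (2 * volume.real (Metric.ball (0 : Plane) 1))⁻¹
  choose V hV using fun n j => D.exists_wavePacket (he n) (hed n) (ξ₀ j)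
  -- If every `n` fails, the bad coefficient vectors are normalized and converge along a subsequence
  -- to some `c₀` of norm one; the limiting integral is then both nonnegative and nonpositive.
  by_contra! hcon
  have hsphere : ∀ n, ∃ c ∈ Metric.sphere (0 : N → ℂ) 1,
      D.kappa * ‖(∑ j, c j • V n j).1.1‖ ^ 2 ≤
        (D.form (∑ j, c j • V n j) (∑ j, c j • V n j)).re := by
    intro n
    obtain ⟨c, hc, h⟩ := hcon (V n)
    have hcn : ‖c‖ ≠ 0 := norm_ne_zero_iff.2 hc
    refine ⟨((‖c‖⁻¹ : ℝ) : ℂ) • c, ?_, ?_⟩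
    · rw [mem_sphere_zero_iff_norm, norm_smul, Complex.norm_real, norm_inv, norm_norm,
        inv_mul_cancel₀ hcn]
    · have h1 : ∑ j, (((‖c‖⁻¹ : ℝ) : ℂ) • c) j • V n j =
          ((‖c‖⁻¹ : ℝ) : ℂ) • ∑ j, c j • V n j := by
        rw [Finset.smul_sum]
        exact Finset.sum_congr rfl fun j _ => by rw [Pi.smul_apply, smul_eq_mul, mul_smul]
      have h2 : ∀ (k : ℂ) (F : H1), ‖(k • F).1.1‖ = ‖k‖ * ‖F.1.1‖ := fun k F => norm_smul k F.1.1
      rw [h1, form_smul_self, h2, mul_pow, mul_left_comm]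
      exact mul_le_mul_of_nonneg_left h (sq_nonneg _)
  choose c hc hform using hsphere
  obtain ⟨c₀, hc₀, φ, hφ, hlim⟩ := (isCompact_sphere (0 : N → ℂ) 1).tendsto_subseq hc
  have hc1 : ∀ n j, ‖c n j‖ ≤ 1 := fun n j =>
    (norm_le_pi_norm (c n) j).trans (mem_sphere_zero_iff_norm.1 (hc n)).le
  have hhat : ∀ n, hat (∑ j, c n j • V n j) =ᵐ[volume] fun ξ =>
      (∑ j, c n j * (profile (e n) (d n) (ξ - ξ₀ j) : ℂ)) •
        polarization D.A ((2 * Real.pi) • ξ) := by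
    intro n
    filter_upwards [coeFn_hat_sum (c n) (V n) (hV n)] with ξ h
    rw [h, Finset.sum_smul]
    exact Finset.sum_congr rfl fun j _ => smul_smul _ _ _
  let g : ℕ → Plane → ℂ := fun n x => ∑ j, c n j * packet (e n) (d n) (ξ₀ j) x
  have hparn : ∀ᶠ n in atTop, ∀ j ξ, ‖ξ - ξ₀ j‖ < d n →
      lowerBand D.A ((2 * Real.pi) • ξ) - D.kappa ≤ (∑ j, K j) * ‖ξ - ξ₀ j‖ ^ 2 := by
    rw [eventually_all]
    intro j
    filter_upwards [hdlim.eventually (gt_mem_nhds (hδ j))] with n hn ξ hξ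
    refine (hpar j ξ (hξ.trans hn)).trans (mul_le_mul_of_nonneg_right ?_ (sq_nonneg _))
    exact Finset.single_le_sum (fun j _ => hK j) (Finset.mem_univ j)
  have hmain : ∀ᶠ n in atTop, 0 ≤ 2 * Fintype.card N *
      (Fintype.card N * ((∑ j, K j) * (annulusMass (e n) (d n))⁻¹)) +
        ∫ x, D.h x * ‖g n x‖ ^ 2 ∂D.m := by
    filter_upwards [hparn] with n hn
    have h1 := D.freeForm_wavePacket_le (he n) (hed n) ξ₀ hn (c n) (hc1 n) (hhat n)
    have h2 := D.nuForm_re_le hneg (D.trace_wavePacket (he n) (hed n) ξ₀ (c n) (hhat n))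
    have h3 := hform n
    rw [form, Complex.add_re] at h3
    linarith
  have hpacket : ∀ j x, Tendsto (fun n => packet (e n) (d n) (ξ₀ j) x) atTop
      (𝓝 (wave x (ξ₀ j))) := by
    intro j x
    rw [tendsto_iff_norm_sub_tendsto_zero]
    refine squeeze_zero (fun n => norm_nonneg _)
      (fun n => norm_packet_sub_le (he n) (hed n) (ξ₀ j) x) ?_
    simpa using (hdlim.const_mul ‖x‖).const_mul (2 * Real.pi)
  have hg : ∀ x, Tendsto (fun n => g (φ n) x) atTop (𝓝 (∑ j, c₀ j * wave x (ξ₀ j))) := by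
    intro x
    refine tendsto_finsetSum _ fun j _ => ?_
    exact ((tendsto_pi_nhds.1 hlim) j).mul ((hpacket j x).comp hφ.tendsto_atTop)
  have hgmeas : ∀ n, AEStronglyMeasurable (g n) D.m := fun n => by
    have hm := D.trace_wavePacket (he n) (hed n) ξ₀ (c n) (hhat n)
    refine AEStronglyMeasurable.congr ?_ hm
    exact (EuclideanSpace.proj (𝕜 := ℂ) (0 : Fin 2)).continuous.comp_aestronglyMeasurable
      (Lp.aestronglyMeasurable (D.trace (∑ j, c n j • V n j)))
  have hgbound : ∀ n x, ‖g n x‖ ≤ Fintype.card N := by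
    intro n x
    refine (norm_sum_le_of_le (n := fun _ => (1 : ℝ)) _ fun j _ => ?_).trans (by simp)
    rw [norm_mul]
    exact mul_le_one₀ (hc1 n j) (norm_nonneg _) (norm_packet_le (he n) (hed n) _ x)
  have hint : Tendsto (fun n => ∫ x, D.h x * ‖g (φ n) x‖ ^ 2 ∂D.m) atTop
      (𝓝 (∫ x, D.h x * ‖∑ j, c₀ j * wave x (ξ₀ j)‖ ^ 2 ∂D.m)) := by
    refine tendsto_integral_of_dominated_convergence (fun _ => C * (Fintype.card N : ℝ) ^ 2)
      (fun n => D.measurable_h.aestronglyMeasurable.mul ((hgmeas _).norm.pow 2))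
      (integrable_const _) (fun n => Eventually.of_forall fun x => ?_)
      (Eventually.of_forall fun x => ((hg x).norm.pow 2).const_mul _)
    rw [norm_mul, Real.norm_of_nonneg (sq_nonneg ‖g (φ n) x‖), Real.norm_eq_abs]
    have h1 := hC x
    have h2 := hgbound (φ n) x
    gcongr
  have hnonneg : 0 ≤ ∫ x, D.h x * ‖∑ j, c₀ j * wave x (ξ₀ j)‖ ^ 2 ∂D.m := by
    have h1 := (((hmass.const_mul (∑ j, K j)).const_mul (Fintype.card N : ℝ)).const_mul
      (2 * (Fintype.card N : ℝ))).comp hφ.tendsto_atTop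
    simp only [mul_zero] at h1
    have h2 := h1.add hint
    rw [zero_add] at h2
    exact ge_of_tendsto h2 (hφ.tendsto_atTop.eventually hmain)
  have hnonpos : ∫ x, D.h x * ‖∑ j, c₀ j * wave x (ξ₀ j)‖ ^ 2 ∂D.m ≤ 0 :=
    integral_nonpos_of_ae (hneg.mono fun x hx => mul_nonpos_of_nonpos_of_nonneg hx (sq_nonneg _))
  have hzero := hnd c₀ (le_antisymm hnonpos hnonneg)
  rw [hzero] at hc₀
  simp at hc₀

/-! ### Support of the perturbation and the eigenvalue count. -/

theorem h_nonpos_of_nu_nonpos (hnu : D.nu ≤ 0) : ∀ᵐ x ∂D.m, D.h x ≤ 0 := by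
  refine ae_le_of_forall_setIntegral_le (g := fun _ => (0 : ℝ)) D.integrable_h (integrable_zero _ _ _)
    fun s hs _ => ?_
  rw [← D.nu_apply hs, integral_zero]
  exact hnu s hs

theorem totalVariation_eq_zero {U : Set Plane} (hU : MeasurableSet U)
    (h : ∀ᵐ x ∂D.m, x ∈ U → D.h x = 0) : D.nu.totalVariation U = 0 := by
  have hzero : ∀ s, MeasurableSet s → D.nu (s ∩ U) = 0 := by
    intro s hs
    rw [D.nu_apply (hs.inter hU)]
    refine (setIntegral_congr_ae (hs.inter hU) (g := fun _ => (0 : ℝ)) ?_).trans (integral_zero _ _)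
    filter_upwards [h] with x hx hx2
    exact hx hx2.2
  obtain ⟨i, hi, hi1, hi2, hpos, hneg⟩ := D.nu.toJordanDecomposition_spec
  rw [SignedMeasure.totalVariation, Measure.add_apply, hpos, hneg,
    SignedMeasure.toMeasureOfZeroLE_apply _ _ hi hU,
    SignedMeasure.toMeasureOfLEZero_apply _ _ hi.compl hU]
  simp [hzero i hi, hzero iᶜ hi.compl]

theorem wave_eq_exp (x p : Plane) :
    wave x ((2 * Real.pi)⁻¹ • p) = Complex.exp (Complex.I * (inner ℝ p x : ℝ)) := by
  rw [wave, inner_smul_left, mul_comm]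
  have : 2 * Real.pi * ((starRingEnd ℝ) (2 * Real.pi)⁻¹ * (inner ℝ p x : ℝ)) = inner ℝ p x := by
    have hpi : Real.pi ≠ 0 := Real.pi_ne_zero
    simp only [conj_trivial]
    field_simp
  rw [this]

/-- When the limiting integral is zero, the open set where the trigonometric polynomial is nonzero
is null for `|ν|`, so the polynomial vanishes on the support and the circle argument kills its
coefficients. An infinite minimum set is treated through its finite subsets. -/
theorem hasManyEigenvalues_of_infinite_support (hD : D.RelativelyFormBounded) (hnu : D.nu ≤ 0)
    {x₀ : Plane} {r : ℝ} (hinf : (D.nu.totalVariation.support ∩ Metric.sphere x₀ r).Infinite) :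
    D.HasManyEigenvalues := by
  have hneg := D.h_nonpos_of_nu_nonpos hnu
  obtain ⟨C, hC⟩ := D.bounded_h
  have hcard : ∀ s : Finset Plane, (s : Set Plane) ⊆ minimumSet D.A →
      (s.card : ℕ∞) ≤ countBelow D.hamiltonian D.kappa := by
    intro s hs
    have hnd : ∀ c : s → ℂ, ∫ x, D.h x *
        ‖∑ j, c j * wave x ((2 * Real.pi)⁻¹ • (j : Plane))‖ ^ 2 ∂D.m = 0 → c = 0 := by
      intro c hc
      refine trigPolynomial_eq_zero (fun j : s => (j : Plane)) Subtype.val_injective c x₀ r _ hinf ?_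
      set T : Plane → ℂ := fun x => ∑ j : s, c j * wave x ((2 * Real.pi)⁻¹ • (j : Plane)) with hT
      have hTc : Continuous T := by
        simp only [hT, wave]
        fun_prop
      have hTb : ∀ x, ‖T x‖ ≤ ∑ j : s, ‖c j‖ := fun x => by
        refine norm_sum_le_of_le _ fun j _ => ?_
        rw [norm_mul, norm_wave, mul_one]
      have hi : Integrable (fun x => -(D.h x * ‖T x‖ ^ 2)) D.m := by
        refine Integrable.neg (Integrable.mul_bdd (c := (∑ j : s, ‖c j‖) ^ 2) D.integrable_h
          (hTc.norm.pow 2).aestronglyMeasurable (Eventually.of_forall fun x => ?_))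
        rw [Real.norm_of_nonneg (sq_nonneg _)]
        have := hTb x
        gcongr
      have hae := (integral_eq_zero_iff_of_nonneg_ae (hneg.mono fun x hx =>
        neg_nonneg.2 (mul_nonpos_of_nonpos_of_nonneg hx (sq_nonneg _))) hi).1
        (by rw [integral_neg, hc, neg_zero])
      have hU : IsOpen {x | T x ≠ 0} := isOpen_ne_fun hTc continuous_const
      have hnull := D.totalVariation_eq_zero hU.measurableSet (by
        filter_upwards [hae] with x hx hx2
        simpa [show T x ≠ 0 from hx2] using hx)
      intro x hx
      by_contra hne
      refine (Measure.mem_support_iff_forall x |>.1 hx _ (hU.mem_nhds ?_)).ne' hnull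
      simpa only [hT, Set.mem_ofPred_eq, wave_eq_exp] using hne
    obtain ⟨V, hV⟩ := D.exists_negative_family hneg (fun j : s => (j : Plane)) (fun j => hs j.2) hnd
    simpa using D.card_le_countBelow hD V hV
  have hle : (minimumSet D.A).encard ≤ countBelow D.hamiltonian D.kappa := by
    by_cases hfin : (minimumSet D.A).Finite
    · rw [hfin.encard_eq_coe_toFinset_card]
      exact hcard _ (by simp)
    · have htop : countBelow D.hamiltonian D.kappa = ⊤ := by
        rw [ENat.eq_top_iff_forall_ge]
        intro n
        obtain ⟨s, hs, hn⟩ := Set.Infinite.exists_subset_card_eq hfin n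
        rw [← hn]
        exact hcard s hs
      rw [htop]
      exact le_top
  refine ⟨hle, fun hS => D.infinite_eigenvaluesBelow hD ?_⟩
  rw [hS.encard_eq, top_le_iff] at hle
  exact hle

/-! ### The spherically symmetric case. -/

theorem measure_absolutelyContinuous_totalVariation (hneg : ∀ᵐ x ∂D.m, D.h x < 0) :
    D.m ≪ D.nu.totalVariation := by
  refine Measure.AbsolutelyContinuous.mk fun s hs h0 => ?_
  have h1 := D.nu.null_of_totalVariation_zero h0
  rw [D.nu_apply hs] at h1
  have hr := ae_restrict_of_ae (s := s) hneg
  have h2 := (integral_eq_zero_iff_of_nonneg_ae (μ := D.m.restrict s) (f := fun x => -D.h x)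
    (hr.mono fun x hx => (neg_pos.2 hx).le) D.integrable_h.neg.integrableOn).1
    (by rw [integral_neg, h1, neg_zero])
  have h3 : ∀ᵐ x ∂D.m.restrict s, False := by
    filter_upwards [hr, h2] with x hx hx2
    simp only [Pi.zero_apply, neg_eq_zero] at hx2
    exact hx.ne hx2
  rw [← Measure.restrict_eq_zero]
  simpa using h3

theorem nu_nonpos (hneg : ∀ᵐ x ∂D.m, D.h x < 0) : D.nu ≤ 0 := by
  intro s hs
  rw [D.nu_apply hs]
  exact setIntegral_nonpos_of_ae (hneg.mono fun x hx => hx.le)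

/-- The measure is not concentrated at the origin, since points have zero capacity. -/
theorem measure_compl_origin_ne_zero (hm : D.m ≠ 0) : D.m {0}ᶜ ≠ 0 := by
  intro h0
  have hae : ∀ᵐ x ∂D.m, x = 0 := h0
  -- Here the outer radius goes to infinity: packets centred at frequency zero keep the value one at
  -- the origin while their Sobolev norm vanishes. The inner radius one makes the `L²`-norm at most
  -- the gradient norm.
  let d : ℕ → ℝ := fun n => Real.exp ((n : ℝ) + 1)
  have hd : ∀ n, 1 < d n := fun n => Real.one_lt_exp_iff.2 (by positivity)
  have hmass : Tendsto (fun n => (annulusMass 1 (d n))⁻¹) atTop (𝓝 0) := by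
    have h1 : ∀ n, (annulusMass 1 (d n))⁻¹ =
        (2 * volume.real (Metric.ball (0 : Plane) 1))⁻¹ * (1 / ((n : ℝ) + 1)) := by
      intro n
      rw [annulusMass, div_one, Real.log_exp, ← mul_assoc, mul_inv, one_div]
    simp only [h1]
    simpa using tendsto_one_div_add_atTop_nhds_zero_nat.const_mul
      (2 * volume.real (Metric.ball (0 : Plane) 1))⁻¹
  choose F hF using fun n => D.exists_wavePacket one_pos (hd n) 0
  simp only [sub_zero] at hF
  have htr : ∀ n, D.m.real Set.univ ≤ ‖D.trace (F n)‖ ^ 2 := by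
    intro n
    have h1 := D.trace_wavePacket one_pos (hd n) (fun _ : Unit => (0 : Plane)) (fun _ => 1) (F := F n)
      (by simpa using hF n)
    have h2 : packet 1 (d n) 0 0 = 1 := by
      have h3 : ∀ ξ : Plane, wave 0 ξ = 1 := fun ξ => by simp [wave]
      simp only [packet, h3, one_mul, sub_zero]
      rw [integral_complex_ofReal, integral_profile one_pos (hd n), Complex.ofReal_one]
    rw [norm_sq_eq_integral, ← mul_one (D.m.real Set.univ), ← smul_eq_mul, ← integral_const]
    refine integral_mono_ae (integrable_const _) (integrable_norm_sq _) ?_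
    filter_upwards [hae, h1] with x hx hx1
    rw [hx] at hx1 ⊢
    rw [norm_sq_C2, hx1]
    simp [h2]
  have hnorm : ∀ n, ‖F n‖ ^ 2 ≤ (1 + 2 * Real.pi) ^ 2 * (2 * (annulusMass 1 (d n))⁻¹) := by
    intro n
    have hpi : 0 < Real.pi := Real.pi_pos
    have hgrad : ‖(F n).1.2‖ ^ 2 ≤ (2 * Real.pi) ^ 2 * (2 * (annulusMass 1 (d n))⁻¹) := by
      rw [← integral_norm_sq_mul_profile_sq one_pos (hd n), norm_sq_eq_integral,
        ← integral_const_mul, ← integral_const_mul]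
      refine integral_mono_ae (integrable_norm_sq _)
        (((integrable_norm_sq_mul_profile_sq one_pos (hd n)).const_mul _).const_mul _) ?_
      filter_upwards [H1_snd (F n), hF n] with ξ h1 h2
      have h3 := norm_polarization_sq_le D.A ((2 * Real.pi) • ξ)
      rw [h1, h2, norm_smul, norm_smul, Complex.norm_real, Complex.norm_real,
        Real.norm_of_nonneg (by positivity), Real.norm_of_nonneg (profile_nonneg one_pos (hd n) _)]
      have h4 := mul_le_mul_of_nonneg_left h3
        (by positivity : 0 ≤ (2 * Real.pi * ‖ξ‖ * profile 1 (d n) ξ) ^ 2)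
      nlinarith
    have hhat : ‖hat (F n)‖ ^ 2 ≤ ‖(F n).1.2‖ ^ 2 := by
      have : ‖hat (F n)‖ ≤ ‖(F n).1.2‖ := by
        refine Lp.norm_le_norm_of_ae_le ?_
        filter_upwards [H1_snd (F n), hF n] with ξ h1 h2
        rw [h1, norm_smul, Complex.norm_real, Real.norm_of_nonneg (by positivity)]
        by_cases h3 : ‖ξ‖ ≤ 1
        · rw [h2, profile_of_le h3]
          simp
        · refine le_mul_of_one_le_left (norm_nonneg _) ?_
          nlinarith [Real.pi_gt_three, not_le.1 h3]
      gcongr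
    have h5 : ‖F n‖ ^ 2 ≤ ‖(F n).1.2‖ ^ 2 := by
      have h6 : ‖F n‖ = max ‖(F n).1.1‖ ‖(F n).1.2‖ := rfl
      rw [norm_fst_eq] at h6
      have h7 : ‖hat (F n)‖ ≤ ‖(F n).1.2‖ := by
        exact le_of_sq_le_sq hhat (norm_nonneg _)
      rw [h6, max_eq_right h7]
    have h8 : 0 < (annulusMass 1 (d n))⁻¹ := inv_pos.2 (annulusMass_pos one_pos (hd n))
    refine h5.trans (hgrad.trans ?_)
    gcongr
    linarith
  have hlim : D.m.real Set.univ ≤ 0 := by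
    have h1 : Tendsto (fun n => ‖D.trace‖ ^ 2 * ((1 + 2 * Real.pi) ^ 2 *
        (2 * (annulusMass 1 (d n))⁻¹))) atTop (𝓝 0) := by
      simpa using ((hmass.const_mul 2).const_mul ((1 + 2 * Real.pi) ^ 2)).const_mul (‖D.trace‖ ^ 2)
    refine ge_of_tendsto' h1 fun n => (htr n).trans ?_
    have h2 := D.trace.le_opNorm (F n)
    calc ‖D.trace (F n)‖ ^ 2 ≤ (‖D.trace‖ * ‖F n‖) ^ 2 := by gcongr
      _ = ‖D.trace‖ ^ 2 * ‖F n‖ ^ 2 := by ring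
      _ ≤ _ := mul_le_mul_of_nonneg_left (hnorm n) (sq_nonneg _)
  have h2 : D.m.real Set.univ = 0 := le_antisymm hlim measureReal_nonneg
  rw [measureReal_eq_zero_iff, Measure.measure_univ_eq_zero] at h2
  exact hm h2

theorem exists_sphere_subset_support (hm : D.m ≠ 0)
    (hR : ∀ R : Plane ≃ₗᵢ[ℝ] Plane, D.m.map R = D.m) :
    ∃ r : ℝ, 0 < r ∧ Metric.sphere 0 r ⊆ D.m.support := by
  have h1 : D.m ({0}ᶜ ∩ D.m.support) ≠ 0 := by
    rw [measure_inter_conull Measure.support_mem_ae]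
    exact D.measure_compl_origin_ne_zero hm
  obtain ⟨x, hx0, hx⟩ := nonempty_of_measure_ne_zero h1
  refine ⟨‖x‖, norm_pos_iff.2 hx0, fun y hy => ?_⟩
  have hxy : ‖x‖ = ‖y‖ := by simpa using hy.symm
  -- The reflection that exchanges two points of equal norm carries one point of the support to any
  -- other on its circle.
  let R : Plane ≃ₗᵢ[ℝ] Plane := Submodule.reflection (ℝ ∙ (x - y))ᗮ
  have hRx : R x = y := Submodule.reflection_sub hxy
  rw [Measure.mem_support_iff_forall] at hx ⊢
  intro U hU
  rw [← hR R]
  have h2 : R ⁻¹' U ∈ 𝓝 x := R.continuous.continuousAt (by rw [hRx]; exact hU)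
  refine (hx _ h2).trans_le ?_
  exact Measure.le_map_apply R.continuous.measurable.aemeasurable U

theorem infinite_sphere {r : ℝ} (hr : 0 < r) : (Metric.sphere (0 : Plane) r).Infinite := by
  have h1 : IsPreconnected (Metric.sphere (0 : Plane) r) := by
    refine isPreconnected_sphere ?_ 0 r
    rw [← Module.finrank_eq_rank]
    simp
  refine h1.infinite_of_nontrivial ?_
  refine ⟨EuclideanSpace.single 0 r, ?_, EuclideanSpace.single 0 (-r), ?_, fun h => ?_⟩
  · simp [abs_of_pos hr]
  · simp [abs_of_pos hr]
  · have := congrArg (fun v : Plane => v 0) h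
    simp at this
    linarith

end System

end SpinOrbit

end

theorem corollary2 (D : SpinOrbit.System) (hD : D.RelativelyFormBounded) :
    (D.nu ≤ 0 →
      (∃ (c : SpinOrbit.Plane) (r : ℝ),
        (D.nu.totalVariation.support ∩ Metric.sphere c r).Infinite) →
      D.HasManyEigenvalues) ∧
    (D.m ≠ 0 →
      (∀ R : SpinOrbit.Plane ≃ₗᵢ[ℝ] SpinOrbit.Plane, D.m.map R = D.m) →
      (∀ᵐ x ∂D.m, D.h x < 0) →
      D.HasManyEigenvalues) := by
  refine ⟨fun hnu ⟨c, r, hinf⟩ => D.hasManyEigenvalues_of_infinite_support hD hnu hinf,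
    fun hm hR hneg => ?_⟩
  obtain ⟨r, hr, hsub⟩ := D.exists_sphere_subset_support hm hR
  refine D.hasManyEigenvalues_of_infinite_support hD (D.nu_nonpos hneg) (x₀ := 0) (r := r) ?_
  refine (SpinOrbit.System.infinite_sphere hr).mono fun x hx => ⟨?_, hx⟩
  exact (D.measure_absolutelyContinuous_totalVariation hneg).support_mono (hsub hx)
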